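/- **Setting.** Let $d\ge 2$ and let $q\ge 2$ be an integer. Consider $\mathbb{Z}^d$ with its nearest-neighbour edge set $\mathbb{E}^d=\{\{x,y\}:\|x-y\|_1=1\}$. For finite $\Lambda\subset\mathbb{Z}^d$ let $\mathbb{E}_\Lambda$ be the set of edges with both endpoints in $\Lambda$. *Random-cluster measures.* For $p\in[0,1]$ let $\phi^1_{\Lambda,p,q}$ be the probability measure on $\{0,1\}^{\mathbb{E}^d}$ carried by the configurations $\omega$ with $\omega(e)=1$ for all $e\notin\mathbb{E}_\Lambda$, on which $$\phi^1_{\Lambda,p,q}(\omega)\ \propto\ \Big\{\prod_{e\in\mathbb{E}_\Lambda}p^{\omega(e)}(1-p)^{1-\omega(e)}\Big\}\,q^{k(\omega)},$$ where $k(\omega)$ is the number of connected components of the graph of open edges of $\omega$ (those with $\omega(e)=1$) that contain an endpoint of an edge of $\mathbb{E}_\Lambda$. Let $\phi^1_{p,q}$ be the weak limit of $\phi^1_{\Lambda,p,q}$ as $\Lambda\uparrow\mathbb{Z}^d$. Write $C(0)$ for the open cluster of the origin and $0\leftrightarrow A$ for the event $C(0)\cap A\neq\varnothing$. Put $B(0,n)=\{y:\|y\|_1\le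 n\}$, let $\partial B(0,n)$ be the set of sites outside $B(0,n)$ having a neighbour in it, and set $$Y(p,q)=\limsup_{n\to\infty}n^{d-1}\phi^1_{p,q}\big(0\leftrightarrow\partial B(0,n)\big),\qquad p_g=\sup\{p\in[0,1]:Y(p,q)<\infty\},\qquad \beta_g=-\tfrac12\ln(1-p_g).$$ *Potts model.* For finite $\Lambda\subset\mathbb{Z}^d$ and $\sigma\in\{1,\dots,q\}^{\mathbb{Z}^d}$ let $$H_\Lambda(\sigma)=2\beta\sum_{\{x,y\}\in\mathbb{E}^d,\ \{x,y\}\cap\Lambda\ne\varnothing}\mathbf 1_{\{\sigma(x)\ne\sigma(y)\}}.$$ A probability measure $\mu$ on $\{1,\dots,q\}^{\mathbb{Z}^d}$ is a Gibbs measure for the $q$-state Potts model at inverse temperature $\beta$ if for every finite $\Lambda$ and every bounded measurable $f$, $\mu$-a.s., $$E_\mu\big(f\,\big|\,(\sigma_x)_{x\notin\Lambda}\big)=\frac{\sum_{\eta\in\{1,\dots,q\}^\Lambda}e^{-H_\Lambda(\eta\sigma_{\Lambda^c})}f(\eta\sigma_{\Lambda^c})}{\sum_{\eta\in\{1,\dots,q\}^\Lambda}e^{-H_\Lambda(\eta\sigma_{\Lambda^c})}},$$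 where $\eta\sigma_{\Lambda^c}$ equals $\eta$ on $\Lambda$ and $\sigma$ off $\Lambda$. Let $\Lambda_t=\{x\in\mathbb{Z}^d:\|x\|_\infty\le t\}$, let $n_{\Lambda_t}=(n_{\Lambda_t}(1),\dots,n_{\Lambda_t}(q))$ with $n_{\Lambda_t}(k)=|\{x\in\Lambda_t:\sigma_x=k\}|$, and let $\nu=(\tfrac1q,\dots,\tfrac1q)$. **Theorem.** Let $0\le\beta<\beta_g$ and $p=1-e^{-2\beta}$. There is a unique Gibbs measure for the $q$-state Potts model at inverse temperature $\beta$. Moreover $$\chi(p,q)=\sum_{k=1}^{\infty}k\,\phi^1_{p,q}(|C(0)|=k)<\infty,$$ and under this Gibbs measure, as $t\to\infty$, $$\frac{n_{\Lambda_t}-|\Lambda_t|\,\nu}{\sqrt{|\Lambda_t|}}\ \Longrightarrow\ \mathcal N\Big(0,\ \frac{\chi(p,q)}{q^2}\,(qI-J)\Big)$$ in distribution, where $I$ is the $q\times q$ identity matrix and $J$ is the $q\times q$ matrix all of whose entries equal $1$. -/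

import Mathlib

open MeasureTheory ProbabilityTheory Filter Topology
open scoped ENNReal NNReal

namespace PottsCLT

/-! ### The lattice `ℤ^d` -/

/-- The sites `ℤ^d`. -/
abbrev Site (d : ℕ) : Type := Fin d → ℤ

/-- The norm `‖x‖ = ∑ |x_i|` on `ℤ^d`. -/
def norm1 {d : ℕ} (x : Site d) : ℤ := ∑ i, |x i|

/-- The nearest-neighbour graph on `ℤ^d`. -/
def lattice (d : ℕ) : SimpleGraph (Site d) where
  Adj x y := norm1 (x - y) = 1
  symm := ⟨fun x y h => by simpa [norm1, abs_sub_comm] using h⟩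
  loopless := ⟨fun x h => by simp [norm1] at h⟩

/-- The edges of the lattice. -/
abbrev Edge (d : ℕ) : Type := (lattice d).edgeSet

/-- The outer boundary of a set of sites. -/
def outerBoundary {d : ℕ} (A : Set (Site d)) : Set (Site d) :=
  {y | y ∉ A ∧ ∃ x ∈ A, norm1 (x - y) = 1}

/-- The `ℓ¹` ball of radius `n` centred at the origin. -/
def ball1 (d n : ℕ) : Set (Site d) := {y | norm1 y ≤ n}

/-- The box `{x : max |x_i| ≤ t}`. -/
noncomputable def box (d t : ℕ) : Finset (Site d) :=
  Finset.Icc (fun _ => -(t : ℤ)) (fun _ => (t : ℤ))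

/-! ### Random-cluster measures -/

/-- Edge configurations; `true` means open. -/
abbrev EdgeConfig (d : ℕ) : Type := Edge d → Bool

/-- The graph of open edges. -/
def openGraph {d : ℕ} (ω : EdgeConfig d) : SimpleGraph (Site d) :=
  SimpleGraph.fromEdgeSet {e | ∃ h : e ∈ (lattice d).edgeSet, ω ⟨e, h⟩ = true}

/-- The open cluster of a site. -/
def cluster {d : ℕ} (ω : EdgeConfig d) (x : Site d) : Set (Site d) :=
  {y | (openGraph ω).Reachable x y}

open Classical in
/-- The edges with both endpoints in `Λ`. -/
noncomputable def innerEdges {d : ℕ} (Λ : Finset (Site d)) : Finset (Edge d) :=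
  Finset.subtype (fun e => e ∈ (lattice d).edgeSet) Λ.sym2

/-- The number of connected components of the open graph which meet the edge set `E`. -/
noncomputable def numClusters {d : ℕ} (E : Finset (Edge d)) (ω : EdgeConfig d) : ℕ :=
  {c : (openGraph ω).ConnectedComponent |
    ∃ e ∈ E, ∃ x ∈ (e : Sym2 (Site d)), (openGraph ω).connectedComponentMk x = c}.ncard

open Classical in
/-- The configuration equal to `ω` on `E` and to `η` off `E`. -/
noncomputable def glueEdges {d : ℕ} (E : Finset (Edge d)) (ω : E → Bool) (η : EdgeConfig d) :
    EdgeConfig d :=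
  fun e => if h : e ∈ E then ω ⟨e, h⟩ else η e

/-- The unnormalised random-cluster weight of `ω` on `E` with boundary condition `η`. -/
noncomputable def fkWeight {d : ℕ} (p q : ℝ) (E : Finset (Edge d)) (η : EdgeConfig d)
    (ω : E → Bool) : ℝ :=
  (∏ e, if ω e then p else 1 - p) * q ^ numClusters E (glueEdges E ω η)

open Classical in
/-- The random-cluster measure on `E` with boundary condition `η`: `FiniteMeasure.normalize`
divides by the total mass, which is the partition function. -/
noncomputable def fkMeasure {d : ℕ} (p q : ℝ) (E : Finset (Edge d)) (η : EdgeConfig d) :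
    ProbabilityMeasure (EdgeConfig d) :=
  FiniteMeasure.normalize
    (∑ ω : E → Bool, (fkWeight p q E η ω).toNNReal •
      (diracProba (glueEdges E ω η)).toFiniteMeasure)

/-- The wired infinite-volume random-cluster measure `φ¹_{p,q}`: the weak limit, as `Λ ↑ ℤ^d`
through the finite subsets, of the random-cluster measures on `Λ` for which every edge outside is
open. -/
noncomputable def wiredFK (d : ℕ) (p q : ℝ) : ProbabilityMeasure (EdgeConfig d) :=
  limUnder (atTop : Filter (Finset (Site d)))
    (fun Λ => fkMeasure p q (innerEdges Λ) (fun _ => true))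

/-- `Y(p,q) = limsup n^{d-1} φ¹_{p,q}(0 ↔ ∂B(0,n))`. -/
noncomputable def radiusLimsup (d : ℕ) (p q : ℝ) : ℝ≥0∞ :=
  limsup (fun n : ℕ => (n : ℝ≥0∞) ^ (d - 1) *
    (wiredFK d p q : Measure (EdgeConfig d))
      {ω | ∃ y ∈ outerBoundary (ball1 d n), y ∈ cluster ω 0}) atTop

/-- The critical probability `p_g(q)`. -/
noncomputable def pG (d : ℕ) (q : ℝ) : ℝ :=
  sSup {p : ℝ | p ∈ Set.Icc 0 1 ∧ radiusLimsup d p q < ∞}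

/-- The inverse temperature `β_g`. -/
noncomputable def betaG (d : ℕ) (q : ℝ) : ℝ := -(1 / 2) * Real.log (1 - pG d q)

/-- `χ(p,q) = ∑_k k φ¹_{p,q}(|C(0)| = k)`. -/
noncomputable def chi (d : ℕ) (p q : ℝ) : ℝ≥0∞ :=
  ∑' k : ℕ, (k : ℝ≥0∞) *
    (wiredFK d p q : Measure (EdgeConfig d)) {ω | (cluster ω 0).encard = k}

/-! ### The Potts model -/

/-- Spin configurations with `q` states. -/
abbrev SpinConfig (d q : ℕ) : Type := Site d → Fin q

open Classical in
/-- The Hamiltonian in the volume `Λ` (with the inverse temperature included):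
`2β` times the number of edges meeting `Λ` whose endpoints have different spins. -/
noncomputable def hamiltonian {d q : ℕ} (β : ℝ) (Λ : Finset (Site d)) (σ : SpinConfig d q) : ℝ :=
  2 * β * ∑ᶠ e ∈ {e : Sym2 (Site d) | e ∈ (lattice d).edgeSet ∧ ∃ x ∈ e, x ∈ Λ},
    if ∃ x ∈ e, ∃ y ∈ e, σ x ≠ σ y then (1 : ℝ) else 0

open Classical in
/-- The configuration equal to `η` on `Λ` and to `σ` off `Λ`. -/
noncomputable def glueSpins {d q : ℕ} (Λ : Finset (Site d)) (η : Λ → Fin q)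
    (σ : SpinConfig d q) : SpinConfig d q :=
  fun x => if h : x ∈ Λ then η ⟨x, h⟩ else σ x

open Classical in
/-- The finite-volume Gibbs average `Π_Λ f (σ)`. -/
noncomputable def gibbsKernel {d q : ℕ} (β : ℝ) (Λ : Finset (Site d)) (f : SpinConfig d q → ℝ)
    (σ : SpinConfig d q) : ℝ :=
  (∑ η : Λ → Fin q, Real.exp (-hamiltonian β Λ (glueSpins Λ η σ)) * f (glueSpins Λ η σ)) /
    ∑ η : Λ → Fin q, Real.exp (-hamiltonian β Λ (glueSpins Λ η σ))

/-- Gibbs measures for the `q`-state Potts model at inverse temperature `β`; the conditioning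
`σ`-algebra is the one generated by the spins outside `Λ`. -/
def IsPottsGibbs {d q : ℕ} (β : ℝ) (μ : ProbabilityMeasure (SpinConfig d q)) : Prop :=
  ∀ (Λ : Finset (Site d)) (f : SpinConfig d q → ℝ), Measurable f → (∃ M, ∀ σ, |f σ| ≤ M) →
    (μ : Measure (SpinConfig d q))[f | cylinderEvents ((Λ : Set (Site d))ᶜ)]
      =ᵐ[(μ : Measure (SpinConfig d q))] gibbsKernel β Λ f

/-- The vector `n_Λ` of the numbers of sites of `Λ` of each colour. -/
noncomputable def colourCount {d q : ℕ} (Λ : Finset (Site d)) (σ : SpinConfig d q) :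
    EuclideanSpace ℝ (Fin q) :=
  WithLp.toLp 2 fun k => ((Λ.filter fun x => σ x = k).card : ℝ)

/-- The uniform vector `ν = (1/q, …, 1/q)`. -/
noncomputable def uniformVec (q : ℕ) : EuclideanSpace ℝ (Fin q) :=
  WithLp.toLp 2 fun _ => 1 / (q : ℝ)

/-- The normalised fluctuation `(n_{Λ_t} - |Λ_t| ν) / √|Λ_t|`. -/
noncomputable def fluctuation {d q : ℕ} (t : ℕ) (σ : SpinConfig d q) :
    EuclideanSpace ℝ (Fin q) :=
  (√((box d t).card : ℝ))⁻¹ •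
    (colourCount (box d t) σ - ((box d t).card : ℝ) • uniformVec q)

end PottsCLT

/-! Everything is expressed through the odds `x = p/(1-p) = e^{2β} - 1`. Expanding the Boltzmann
weight edge by edge (Edwards–Sokal) turns the Gibbs kernel in a box with boundary spins `τ` into a
random-cluster measure followed by a uniform choice among the spins compatible with the clusters and
with `τ` (`gibbsKernel_eq_spinMean`). Clusters that do not reach the boundary receive independent
uniform colours, so uniqueness and the central limit theorem both follow once wired clusters are
known to be small.

Order. As `q` is an integer, `q^{k(ω)}` is the order of the group `invSpins q ω` of spins constant
on clusters, and the product formula for two subgroups gives the lattice condition. Holley's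
inequality then yields one comparison principle (`wmean_mul_le_rcMean`). It gives the
infinite-volume wired measure as a monotone limit, the domination of all spin boundary conditions by
the wired one, and a one-sided decorrelation bound.

Decay. If an increasing event `A` forces many increasing events with disjoint supports, then
multiplying the odds by `θ < 1` multiplies the bound on the probability of `A` by `exp(-(1-θ) E N)`,
where `N` counts the forced events that fail (`rcMean_scale_le_exp`). Here the forced events are
crossings of annuli. Below `p_g` there are odds at which the radius tail is `O(n^{1-d})`. A union
bound over a sphere shows that annuli of large fixed ratio are crossed with probability at most 1/2,
and the order of `log n` such annuli push the exponent strictly beyond `d-1`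
(`exists_geometric_gain`). A second decrease of the odds can then use a positive power of `n` of
thinner annuli, so the tail becomes stretched exponential (`exists_fast_decay_step`). In particular
the cluster size has a finite second moment.

Uniqueness. Given the set of sites not joined to the boundary of the box, the configuration inside
that set is random-cluster with free boundary, whatever `τ` is. With the domination by the wired
measure, this bounds the influence of `τ` on an edge by the wired probability that the edge is
joined to the boundary (`rcMean_openInd_le`). Hence the Gibbs kernels converge uniformly in `τ` to
the colouring of the infinite-volume wired clusters (`tendstoUniformly_gibbsKernel`), which gives
existence and uniqueness together.

Fluctuations. Given the clusters, the characteristic function of the colour counts is a product over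
clusters. A second-order expansion replaces it by a Gaussian whose exponent is proportional to
`|Λ|⁻¹ ∑_C |C ∩ Λ|²`, with an error of order `|Λ|^{-1/2} E|C(0)|²`. The sum equals `∑_{u ∈ Λ} |C(u)
∩ Λ|`, and its average tends to `χ` in `L¹` (`tendsto_integral_abs_avgHits_sub`). A uniform colour
has covariance `(qI - J)/q²`, hence the limit. -/

namespace PottsCLT

/-! ### Correlation inequalities: Holley's inequality and the group form of the cluster count -/

section

/-! ### Weighted means on a finite set and Holley's inequality -/

section Holley

open scoped FinsetFamily

variable {α : Type*}

/-- The mean of `f` over the finite set `s` with respect to the weight `w`. -/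
noncomputable def wmean (s : Finset α) (w f : α → ℝ) : ℝ :=
  (∑ a ∈ s, w a * f a) / ∑ a ∈ s, w a

theorem wmean_add (s : Finset α) (w f g : α → ℝ) :
    wmean s w (fun a => f a + g a) = wmean s w f + wmean s w g := by
  simp [wmean, mul_add, Finset.sum_add_distrib, add_div]

theorem wmean_sub (s : Finset α) (w f g : α → ℝ) :
    wmean s w (fun a => f a - g a) = wmean s w f - wmean s w g := by
  simp [wmean, mul_sub, Finset.sum_sub_distrib, sub_div]

theorem wmean_sum {ι : Type*} (s : Finset α) (w : α → ℝ) (I : Finset ι) (f : ι → α → ℝ) :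
    wmean s w (fun a => ∑ i ∈ I, f i a) = ∑ i ∈ I, wmean s w (f i) := by
  simp only [wmean, Finset.mul_sum, ← Finset.sum_div]
  rw [Finset.sum_comm]

theorem wmean_const_mul (s : Finset α) (w f : α → ℝ) (c : ℝ) :
    wmean s w (fun a => c * f a) = c * wmean s w f := by
  simp only [wmean, ← mul_div_assoc, Finset.mul_sum]
  congr 1
  exact Finset.sum_congr rfl fun a _ => by ring

theorem wmean_const {s : Finset α} {w : α → ℝ} (hw : 0 < ∑ a ∈ s, w a) (c : ℝ) :
    wmean s w (fun _ => c) = c := by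
  rw [wmean, ← Finset.sum_mul, mul_div_assoc, mul_div_cancel₀ _ hw.ne']

theorem wmean_mono {s : Finset α} {w f g : α → ℝ} (hw : ∀ a ∈ s, 0 ≤ w a)
    (h : ∀ a ∈ s, f a ≤ g a) : wmean s w f ≤ wmean s w g :=
  div_le_div_of_nonneg_right
    (Finset.sum_le_sum fun a ha => mul_le_mul_of_nonneg_left (h a ha) (hw a ha))
    (Finset.sum_nonneg hw)

theorem wmean_nonneg {s : Finset α} {w f : α → ℝ} (hw : ∀ a ∈ s, 0 ≤ w a)
    (h : ∀ a ∈ s, 0 ≤ f a) : 0 ≤ wmean s w f :=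
  div_nonneg (Finset.sum_nonneg fun a ha => mul_nonneg (hw a ha) (h a ha)) (Finset.sum_nonneg hw)

theorem abs_wmean_sub_le {s : Finset α} {w f g h : α → ℝ} (hw : ∀ a ∈ s, 0 ≤ w a)
    (hfg : ∀ a ∈ s, |f a - g a| ≤ h a) : |wmean s w f - wmean s w g| ≤ wmean s w h := by
  rw [← wmean_sub, abs_le]
  constructor
  · have := wmean_mono hw (f := fun a => (-1) * h a) (g := fun a => f a - g a)
      (fun a ha => by linarith [(abs_le.1 (hfg a ha)).1])
    rw [wmean_const_mul] at this
    linarith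
  · exact wmean_mono hw fun a ha => (abs_le.1 (hfg a ha)).2

theorem wmean_const_mul_weight {s : Finset α} {w f : α → ℝ} {c : ℝ} (hc : c ≠ 0) :
    wmean s (fun a => c * w a) f = wmean s w f := by
  simp only [wmean, mul_assoc, ← Finset.mul_sum]
  exact mul_div_mul_left _ _ hc

theorem wmean_weight_congr {s : Finset α} {w w' f : α → ℝ} (h : ∀ a ∈ s, w a = w' a) :
    wmean s w f = wmean s w' f := by
  rw [wmean, wmean, Finset.sum_congr rfl h,
    Finset.sum_congr rfl fun a ha => by rw [h a ha]]

variable [DistribLattice α] [OrderBot α]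

/-- Holley's inequality for two weights on two finite subsets of a distributive lattice. -/
theorem wmean_le_wmean_of_holley {s t : Finset α} {u v f : α → ℝ}
    (hs : ∀ a ∈ s, ∀ b ∈ t, a ⊓ b ∈ s) (ht : ∀ a ∈ s, ∀ b ∈ t, a ⊔ b ∈ t)
    (hu : ∀ a ∈ s, 0 ≤ u a) (hv : ∀ a ∈ t, 0 ≤ v a)
    (hu' : 0 < ∑ a ∈ s, u a) (hv' : 0 < ∑ a ∈ t, v a)
    (huv : ∀ a ∈ s, ∀ b ∈ t, u a * v b ≤ u (a ⊓ b) * v (a ⊔ b)) (hf : Monotone f) :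
    wmean s u f ≤ wmean t v f := by
  classical
  have key : ∀ g : α → ℝ, Monotone g → 0 ≤ g → wmean s u g ≤ wmean t v g := by
    intro g hg hg0
    set u' : α → ℝ := fun a => if a ∈ s then u a else 0
    set v' : α → ℝ := fun a => if a ∈ t then v a else 0
    have hu0 : 0 ≤ u' := fun a => by
      by_cases h : a ∈ s
      · simpa [u', h] using hu a h
      · simp [u', h]
    have hv0 : 0 ≤ v' := fun a => by
      by_cases h : a ∈ t
      · simpa [v', h] using hv a h
      · simp [v', h]
    have h := four_functions_theorem (u' * g) v' u' (v' * g) (mul_nonneg hu0 hg0) hv0 hu0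
      (mul_nonneg hv0 hg0) (fun a b => by
        by_cases ha : a ∈ s
        · by_cases hb : b ∈ t
          · have h1 := huv a ha b hb
            have h2 : g a ≤ g (a ⊔ b) := hg le_sup_left
            have h3 : 0 ≤ u a * v b := mul_nonneg (hu a ha) (hv b hb)
            have h4 : 0 ≤ g a := hg0 a
            simp only [Pi.mul_apply, u', v', ha, hb, hs a ha b hb, ht a ha b hb, if_true]
            calc u a * g a * v b = (u a * v b) * g a := by ring
              _ ≤ (u (a ⊓ b) * v (a ⊔ b)) * g (a ⊔ b) := mul_le_mul h1 h2 h4 (h3.trans h1)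
              _ = _ := by ring
          · simp only [v', hb, if_false, mul_zero]
            exact mul_nonneg (hu0 _) (mul_nonneg (hv0 _) (hg0 _))
        · simp only [Pi.mul_apply, u', ha, if_false, zero_mul]
          exact mul_nonneg (hu0 _) (mul_nonneg (hv0 _) (hg0 _))) s t
    have e1 : ∑ a ∈ s, (u' * g) a = ∑ a ∈ s, u a * g a :=
      Finset.sum_congr rfl fun a ha => by simp [u', ha]
    have e2 : ∑ a ∈ t, v' a = ∑ a ∈ t, v a := Finset.sum_congr rfl fun a ha => by simp [v', ha]
    have e3 : ∑ a ∈ s ⊼ t, u' a ≤ ∑ a ∈ s, u a := by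
      refine (Finset.sum_le_sum_of_subset_of_nonneg (t := s) ?_ fun a _ _ => hu0 a).trans_eq
        (Finset.sum_congr rfl fun a ha => by simp [u', ha])
      intro c hc
      obtain ⟨a, ha, b, hb, rfl⟩ := Finset.mem_infs.1 hc
      exact hs a ha b hb
    have e4 : ∑ a ∈ s ⊻ t, (v' * g) a ≤ ∑ a ∈ t, v a * g a := by
      refine (Finset.sum_le_sum_of_subset_of_nonneg (t := t) ?_
        fun a _ _ => mul_nonneg (hv0 a) (hg0 a)).trans_eq
        (Finset.sum_congr rfl fun a ha => by simp [v', ha])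
      intro c hc
      obtain ⟨a, ha, b, hb, rfl⟩ := Finset.mem_sups.1 hc
      exact ht a ha b hb
    rw [e1, e2] at h
    rw [wmean, wmean, div_le_div_iff₀ hu' hv', mul_comm (∑ a ∈ t, v a * g a)]
    refine h.trans (mul_le_mul e3 e4 (Finset.sum_nonneg fun a _ => ?_) hu'.le)
    exact mul_nonneg (hv0 a) (hg0 a)
  have h := key (fun a => f a - f ⊥) (fun a b hab => sub_le_sub_right (hf hab) _)
    (fun a => sub_nonneg.2 (hf bot_le))
  rw [wmean_sub, wmean_sub, wmean_const hu', wmean_const hv'] at h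
  linarith

end Holley

/-! ### Open graphs and locally constant spin configurations -/

variable {d : ℕ}

theorem openGraph_adj {ω : EdgeConfig d} {x y : Site d} :
    (openGraph ω).Adj x y ↔ ∃ h : (lattice d).Adj x y, ω ⟨s(x, y), h⟩ = true := by
  simp only [openGraph, SimpleGraph.fromEdgeSet_adj, Set.mem_ofPred_eq]
  constructor
  · rintro ⟨⟨h, h'⟩, -⟩
    exact ⟨h, h'⟩
  · rintro ⟨h, h'⟩
    exact ⟨⟨h, h'⟩, h.ne⟩

theorem openGraph_mono {ω ω' : EdgeConfig d} (h : ω ≤ ω') : openGraph ω ≤ openGraph ω' := by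
  intro x y hxy
  obtain ⟨hl, ho⟩ := openGraph_adj.1 hxy
  exact openGraph_adj.2 ⟨hl, Bool.eq_true_of_true_le (ho ▸ h ⟨s(x, y), hl⟩)⟩

theorem openGraph_sup_adj {ω ω' : EdgeConfig d} {x y : Site d} :
    (openGraph (ω ⊔ ω')).Adj x y ↔ (openGraph ω).Adj x y ∨ (openGraph ω').Adj x y := by
  simp only [openGraph_adj, Pi.sup_apply, ← exists_or]
  exact exists_congr fun h => by simp

/-- The group of spin configurations which are constant along the open edges. -/
def invSpins (q : ℕ) [NeZero q] (ω : EdgeConfig d) : AddSubgroup (Site d → Fin q) where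
  carrier := {σ | ∀ x y, (openGraph ω).Adj x y → σ x = σ y}
  add_mem' := fun {a b} ha hb x y h => by simp [ha x y h, hb x y h]
  zero_mem' := fun _ _ _ => rfl
  neg_mem' := fun {a} ha x y h => by simp [ha x y h]

variable {q : ℕ} [NeZero q]

theorem mem_invSpins {ω : EdgeConfig d} {σ : Site d → Fin q} :
    σ ∈ invSpins q ω ↔ ∀ x y, (openGraph ω).Adj x y → σ x = σ y := Iff.rfl

theorem eq_of_reachable {ω : EdgeConfig d} {S : Type*} {σ : Site d → S}
    (hσ : ∀ x y, (openGraph ω).Adj x y → σ x = σ y)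
    {x y : Site d} (h : (openGraph ω).Reachable x y) : σ x = σ y := by
  obtain ⟨w⟩ := h
  induction w with
  | nil => rfl
  | cons hadj _ ih => exact (hσ _ _ hadj).trans ih

/-- A set of sites containing `x` and closed under open edges contains everything joined to `x`. -/
theorem mem_of_reachable {ω : EdgeConfig d} {W : Set (Site d)}
    (hW : ∀ u v, u ∈ W → (openGraph ω).Adj u v → v ∈ W)
    {x y : Site d} (hx : x ∈ W) (h : (openGraph ω).Reachable x y) : y ∈ W := by
  obtain ⟨w⟩ := h
  induction w with
  | nil => exact hx
  | cons hadj _ ih => exact ih (hW _ _ hx hadj)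

theorem invSpins_sup (ω ω' : EdgeConfig d) :
    invSpins q (ω ⊔ ω') = invSpins q ω ⊓ invSpins q ω' := by
  ext σ
  simp only [AddSubgroup.mem_inf, mem_invSpins, openGraph_sup_adj]
  exact ⟨fun h => ⟨fun x y hx => h x y (Or.inl hx), fun x y hx => h x y (Or.inr hx)⟩,
    fun h x y hx => hx.elim (h.1 x y) (h.2 x y)⟩

theorem invSpins_anti {ω ω' : EdgeConfig d} (h : ω ≤ ω') : invSpins q ω' ≤ invSpins q ω :=
  fun _ hσ x y hxy => hσ x y (openGraph_mono h hxy)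

/-- The product formula `|H| |K| = |H + K| |H ∩ K|` with `H + K ≤ L`. Applied to `invSpins` it is
the lattice condition for `q^{k(ω)}`: the group of `ω ⊔ ω'` is the intersection of the two groups,
and that of `ω ⊓ ω'` contains both. No component needs to be counted. -/
theorem card_mul_card_le_of_sup_le {G : Type*} [AddCommGroup G] (H K L : AddSubgroup G) [Finite L]
    (hH : H ≤ L) (hK : K ≤ L) :
    Nat.card H * Nat.card K ≤ Nat.card L * Nat.card (H ⊓ K : AddSubgroup G) := by
  have h1 : Nat.card (H ⊓ K : AddSubgroup G) * K.relIndex H = Nat.card H := by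
    rw [← AddSubgroup.inf_relIndex_left, ← AddSubgroup.relIndex_bot_left,
      ← AddSubgroup.relIndex_bot_left]
    exact AddSubgroup.relIndex_mul_relIndex _ _ _ bot_le inf_le_left
  have h2 : Nat.card K * K.relIndex (H ⊔ K) = Nat.card (H ⊔ K : AddSubgroup G) := by
    rw [← AddSubgroup.relIndex_bot_left, ← AddSubgroup.relIndex_bot_left]
    exact AddSubgroup.relIndex_mul_relIndex _ _ _ bot_le le_sup_right
  rw [AddSubgroup.relIndex_sup_right] at h2
  have h3 : Nat.card (H ⊔ K : AddSubgroup G) ≤ Nat.card L :=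
    AddSubgroup.card_le_of_le (sup_le hH hK)
  calc Nat.card H * Nat.card K
      = Nat.card (H ⊓ K : AddSubgroup G) * (Nat.card K * K.relIndex H) := by rw [← h1]; ring
    _ ≤ Nat.card (H ⊓ K : AddSubgroup G) * Nat.card L := Nat.mul_le_mul_left _ (h2.trans_le h3)
    _ = _ := mul_comm _ _

end

/-! ### Finite-volume wired measures: stochastic order and dependence on the odds -/

section

variable {d q : ℕ}

/-! ### Connectedness of the lattice -/

theorem lattice_adj_update (x : Site d) (i : Fin d) (a : ℤ) :
    (lattice d).Adj (Function.update x i a) (Function.update x i (a + 1)) := by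
  change norm1 _ = 1
  unfold norm1
  rw [Finset.sum_eq_single i]
  · simp
  · intro j _ hj
    simp [hj]
  · simp

/-- A function which does not change along the edges of a coordinate line is constant on it. -/
theorem apply_update_eq {S : Type*} {σ : Site d → S} {P : Site d → Prop}
    (hσ : ∀ u v, P u → P v → (lattice d).Adj u v → σ u = σ v) {x : Site d} {i : Fin d}
    (hP : ∀ a, P (Function.update x i a)) (a b : ℤ) :
    σ (Function.update x i a) = σ (Function.update x i b) := by
  have h : ∀ a : ℤ, σ (Function.update x i a) = σ (Function.update x i 0) := by
    intro a
    induction a using Int.induction_on with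
    | zero => rfl
    | succ k ih => exact (hσ _ _ (hP _) (hP _) (lattice_adj_update x i k)).symm.trans ih
    | pred k ih =>
      refine (hσ _ _ (hP _) (hP _) ?_).trans ih
      simpa using lattice_adj_update x i (-(k : ℤ) - 1)
  exact (h a).trans (h b).symm

/-- Connectedness of the lattice, by changing one coordinate at a time. The target type is arbitrary
so that the lemma also applies to predicates on sites. -/
theorem apply_eq_of_adj {S : Type*} {σ : Site d → S}
    (hσ : ∀ u v, (lattice d).Adj u v → σ u = σ v) (x y : Site d) : σ x = σ y := by
  classical
  have h : ∀ s : Finset (Fin d), σ (fun i => if i ∈ s then y i else x i) = σ x := by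
    intro s
    induction s using Finset.induction_on with
    | empty => simp
    | insert i s hi ih =>
      rw [← ih]
      have h1 : (fun j => if j ∈ insert i s then y j else x j) =
          Function.update (fun j => if j ∈ s then y j else x j) i (y i) := by
        ext j
        by_cases hj : j = i
        · subst hj; simp
        · simp [hj]
      rw [h1, apply_update_eq (P := fun _ => True) (fun u v _ _ => hσ u v) (fun _ => trivial)
        (y i) (x i)]
      congr 1
      ext j
      by_cases hj : j = i
      · subst hj; simp [hi]
      · simp [hj]
  simpa using (h Finset.univ).symm

/-! ### Configurations open outside a finite set of edges -/

open Classical in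
/-- The configurations which are open outside `E`. -/
noncomputable def wiredConfigs (E : Finset (Edge d)) : Finset (EdgeConfig d) :=
  Finset.univ.image fun ω : E → Bool => glueEdges E ω fun _ => true

theorem mem_wiredConfigs {E : Finset (Edge d)} {ω : EdgeConfig d} :
    ω ∈ wiredConfigs E ↔ ∀ e ∉ E, ω e = true := by
  classical
  simp only [wiredConfigs, Finset.mem_image, Finset.mem_univ, true_and]
  constructor
  · rintro ⟨ξ, rfl⟩ e he
    simp [glueEdges, he]
  · intro h
    refine ⟨fun e => ω e, ?_⟩
    ext e
    by_cases he : e ∈ E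
    · simp [glueEdges, he]
    · simp [glueEdges, he, h e he]

theorem wiredConfigs_mono {E E' : Finset (Edge d)} (h : E ⊆ E') :
    wiredConfigs E ⊆ wiredConfigs E' := fun _ hω =>
  mem_wiredConfigs.2 fun e he => mem_wiredConfigs.1 hω e fun h' => he (h h')

theorem sup_mem_wiredConfigs {E : Finset (Edge d)} (a : EdgeConfig d) {b : EdgeConfig d}
    (hb : b ∈ wiredConfigs E) : a ⊔ b ∈ wiredConfigs E :=
  mem_wiredConfigs.2 fun e he => by simp [mem_wiredConfigs.1 hb e he]

theorem inf_mem_wiredConfigs {E : Finset (Edge d)} {a b : EdgeConfig d}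
    (ha : a ∈ wiredConfigs E) (hb : b ∈ wiredConfigs E) : a ⊓ b ∈ wiredConfigs E :=
  mem_wiredConfigs.2 fun e he => by simp [mem_wiredConfigs.1 hb e he, mem_wiredConfigs.1 ha e he]

open Classical in
/-- The number of open edges in `E`. -/
noncomputable def openCount (E : Finset (Edge d)) (ω : EdgeConfig d) : ℕ :=
  (E.filter fun e => ω e = true).card

theorem openCount_inf_add_sup (E : Finset (Edge d)) (a b : EdgeConfig d) :
    openCount E (a ⊓ b) + openCount E (a ⊔ b) = openCount E a + openCount E b := by
  classical
  simp only [openCount, Finset.card_filter]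
  rw [← Finset.sum_add_distrib, ← Finset.sum_add_distrib]
  refine Finset.sum_congr rfl fun e _ => ?_
  cases ha : a e <;> cases hb : b e <;> simp [ha, hb]

theorem openCount_mono (E : Finset (Edge d)) : Monotone (openCount E) := fun a b hab =>
  Finset.card_le_card fun e he => by
    simp only [Finset.mem_filter] at he ⊢
    exact ⟨he.1, Bool.eq_true_of_true_le (he.2 ▸ hab e)⟩

/-- The endpoints of the edges in `E`. -/
def endpoints (E : Finset (Edge d)) : Set (Site d) := {x | ∃ e ∈ E, x ∈ (e : Sym2 (Site d))}

theorem finite_endpoints (E : Finset (Edge d)) : (endpoints E).Finite := by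
  have : endpoints E = ⋃ e ∈ E, {x | x ∈ (e : Sym2 (Site d))} := by
    ext x; simp [endpoints]
  rw [this]
  refine Set.Finite.biUnion E.finite_toSet fun e _ => ?_
  obtain ⟨e, he⟩ := e
  induction e using Sym2.ind with
  | _ a b =>
    refine (Set.toFinite {a, b}).subset fun x hx => ?_
    simpa using hx

theorem adj_of_not_mem {E : Finset (Edge d)} {ω : EdgeConfig d} (hω : ω ∈ wiredConfigs E)
    {u v : Site d} (h : (lattice d).Adj u v) :
    (openGraph ω).Adj u v ∨ (u ∈ endpoints E ∧ v ∈ endpoints E) := by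
  by_cases he : (⟨s(u, v), h⟩ : Edge d) ∈ E
  · exact Or.inr ⟨⟨_, he, by simp⟩, ⟨_, he, by simp⟩⟩
  · exact Or.inl (openGraph_adj.2 ⟨h, mem_wiredConfigs.1 hω _ he⟩)

variable [NeZero q]

theorem finite_invSpins {E : Finset (Edge d)} {ω : EdgeConfig d} (hω : ω ∈ wiredConfigs E) :
    Finite (invSpins q ω) := by
  -- A compatible spin configuration is determined by its values on `V`, since all other edges are
  -- open. The origin is added so that `V` is nonempty when `E` is empty.
  set V : Set (Site d) := insert 0 (endpoints E)
  have hV : V.Finite := (finite_endpoints E).insert 0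
  have : Finite V := hV
  refine Finite.of_injective (fun (σ : invSpins q ω) (x : V) => (σ : Site d → Fin q) x) ?_
  rintro ⟨σ, hσ⟩ ⟨σ', hσ'⟩ h
  have hx : ∀ x ∈ V, σ x = σ' x := fun x hx => congrFun h ⟨x, hx⟩
  ext1
  funext x
  have := apply_eq_of_adj (σ := fun x => σ x = σ' x) (fun u v huv => ?_) x 0
  · exact this ▸ hx 0 (Set.mem_insert _ _)
  · rcases adj_of_not_mem hω huv with h | ⟨hu, hv⟩
    · simp only [hσ _ _ h, hσ' _ _ h]
    · simp only [hx u (Or.inr hu), hx v (Or.inr hv)]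

theorem card_invSpins_pos {E : Finset (Edge d)} {ω : EdgeConfig d} (hω : ω ∈ wiredConfigs E) :
    0 < Nat.card (invSpins q ω) :=
  have := finite_invSpins (q := q) hω
  Nat.card_pos

/-! ### Wired random-cluster means in finite volume -/

variable (q) in
/-- The random-cluster weight with odds `x`. -/
noncomputable def rcWeight (x : ℝ) (E : Finset (Edge d)) (ω : EdgeConfig d) : ℝ :=
  x ^ openCount E ω * Nat.card (invSpins q ω)

variable (q) in
/-- The mean of `f` under the wired random-cluster measure on `E` with odds `x`. -/
noncomputable def rcMean (x : ℝ) (E : Finset (Edge d)) (f : EdgeConfig d → ℝ) : ℝ :=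
  wmean (wiredConfigs E) (rcWeight q x E) f

theorem rcWeight_nonneg {x : ℝ} (hx : 0 ≤ x) (E : Finset (Edge d)) (ω : EdgeConfig d) :
    0 ≤ rcWeight q x E ω := by
  unfold rcWeight; positivity

open Classical in
/-- The configuration which is closed on `E` and open elsewhere. -/
noncomputable def closedOn (E : Finset (Edge d)) : EdgeConfig d := fun e => decide (e ∉ E)

theorem closedOn_mem (E : Finset (Edge d)) : closedOn E ∈ wiredConfigs E :=
  mem_wiredConfigs.2 fun e he => by simp [closedOn, he]

theorem rcWeight_closedOn_pos (x : ℝ) (E : Finset (Edge d)) :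
    0 < rcWeight q x E (closedOn E) := by
  have h : openCount E (closedOn E) = 0 := by
    simp only [openCount, Finset.card_eq_zero, Finset.filter_eq_empty_iff]
    intro e he
    simp [closedOn, he]
  have := card_invSpins_pos (q := q) (closedOn_mem E)
  simp only [rcWeight, h, pow_zero, one_mul]
  exact_mod_cast this

theorem sum_rcWeight_pos {x : ℝ} (hx : 0 ≤ x) (E : Finset (Edge d)) :
    0 < ∑ ω ∈ wiredConfigs E, rcWeight q x E ω :=
  Finset.sum_pos' (fun _ _ => rcWeight_nonneg hx E _)
    ⟨_, closedOn_mem E, rcWeight_closedOn_pos x E⟩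

/-- Holley's condition for two volumes and two odds. On `E' \ E` the configuration `b` is open, so
`a ⊓ b` and `a` agree there. Inside `E`, the edges open in `a` but not in `b` pass from the factor
with odds `x` to the factor with the larger odds `y`. The cluster factors are handled by the product
formula for subgroups. -/
theorem rcWeight_mul_le {x y : ℝ} (hx : 0 ≤ x) (hxy : x ≤ y) {E E' : Finset (Edge d)}
    (hE : E ⊆ E') {a b : EdgeConfig d} (ha : a ∈ wiredConfigs E') (hb : b ∈ wiredConfigs E) :
    rcWeight q x E' a * rcWeight q y E b ≤
      rcWeight q x E' (a ⊓ b) * rcWeight q y E (a ⊔ b) := by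
  classical
  have hab := inf_mem_wiredConfigs ha (wiredConfigs_mono hE hb)
  have := finite_invSpins (q := q) hab
  have h1 : (Nat.card (invSpins q a) : ℝ) * Nat.card (invSpins q b) ≤
      Nat.card (invSpins q (a ⊓ b)) * Nat.card (invSpins q (a ⊔ b)) := by
    rw [invSpins_sup]
    exact_mod_cast card_mul_card_le_of_sup_le _ _ _ (invSpins_anti inf_le_left)
      (invSpins_anti inf_le_right)
  have hsplit : ∀ c : EdgeConfig d, openCount E' c = openCount E c + openCount (E' \ E) c := by
    intro c
    simp only [openCount]
    rw [← Finset.card_union_of_disjoint, ← Finset.filter_union, Finset.union_sdiff_of_subset hE]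
    exact Finset.disjoint_filter_filter Finset.disjoint_sdiff
  have h2 : openCount (E' \ E) (a ⊓ b) = openCount (E' \ E) a := by
    simp only [openCount]
    congr 1
    refine Finset.filter_congr fun e he => ?_
    simp [mem_wiredConfigs.1 hb e (Finset.mem_sdiff.1 he).2]
  have h3 := openCount_inf_add_sup E a b
  obtain ⟨n, hn⟩ : ∃ n, openCount E a = openCount E (a ⊓ b) + n :=
    ⟨_, (Nat.add_sub_cancel' (openCount_mono E inf_le_left)).symm⟩
  have h4 : openCount E (a ⊔ b) = openCount E b + n := by omega
  have h5 : x ^ openCount E' a * y ^ openCount E b ≤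
      x ^ openCount E' (a ⊓ b) * y ^ openCount E (a ⊔ b) := by
    rw [hsplit a, hsplit (a ⊓ b), h2, hn, h4, pow_add, pow_add, pow_add, pow_add]
    have hy : 0 ≤ y := hx.trans hxy
    have hpow : x ^ n ≤ y ^ n := pow_le_pow_left₀ hx hxy n
    calc x ^ openCount E (a ⊓ b) * x ^ n * x ^ openCount (E' \ E) a * y ^ openCount E b
        = (x ^ openCount E (a ⊓ b) * x ^ openCount (E' \ E) a * y ^ openCount E b) * x ^ n := by
          ring
      _ ≤ (x ^ openCount E (a ⊓ b) * x ^ openCount (E' \ E) a * y ^ openCount E b) * y ^ n :=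
          mul_le_mul_of_nonneg_left hpow (by positivity)
      _ = _ := by ring
  have hy : 0 ≤ y := hx.trans hxy
  unfold rcWeight
  calc _ = (x ^ openCount E' a * y ^ openCount E b) *
        ((Nat.card (invSpins q a) : ℝ) * Nat.card (invSpins q b)) := by ring
    _ ≤ (x ^ openCount E' (a ⊓ b) * y ^ openCount E (a ⊔ b)) *
        (Nat.card (invSpins q (a ⊓ b)) * Nat.card (invSpins q (a ⊔ b))) :=
        mul_le_mul h5 h1 (by positivity) (by positivity)
    _ = _ := by ring

/-- Comparison of wired random-cluster measures: the mean of an increasing function increases when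
the volume shrinks, when the odds grow, and when a factor `g` of the density that is
non-increasing on the smaller volume is removed. -/
theorem wmean_mul_le_rcMean {x y : ℝ} (hx : 0 ≤ x) (hxy : x ≤ y) {E E' : Finset (Edge d)}
    (hE : E ⊆ E') {g f : EdgeConfig d → ℝ} (hg0 : ∀ a, 0 ≤ g a)
    (hg : ∀ a ∈ wiredConfigs E', ∀ b ∈ wiredConfigs E, g a ≤ g (a ⊓ b))
    (hpos : 0 < ∑ ω ∈ wiredConfigs E', rcWeight q x E' ω * g ω) (hf : Monotone f) :
    wmean (wiredConfigs E') (fun ω => rcWeight q x E' ω * g ω) f ≤ rcMean q y E f := by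
  refine wmean_le_wmean_of_holley
    (fun a ha b hb => inf_mem_wiredConfigs ha (wiredConfigs_mono hE hb))
    (fun a _ b hb => sup_mem_wiredConfigs a hb)
    (fun a _ => mul_nonneg (rcWeight_nonneg hx _ _) (hg0 a))
    (fun a _ => rcWeight_nonneg (hx.trans hxy) _ _) hpos (sum_rcWeight_pos (hx.trans hxy) E)
    (fun a ha b hb => ?_) hf
  have h1 := rcWeight_mul_le (q := q) hx hxy hE ha hb
  calc rcWeight q x E' a * g a * rcWeight q y E b
      = (rcWeight q x E' a * rcWeight q y E b) * g a := by ring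
    _ ≤ (rcWeight q x E' (a ⊓ b) * rcWeight q y E (a ⊔ b)) * g (a ⊓ b) :=
        mul_le_mul h1 (hg a ha b hb) (hg0 a)
          (mul_nonneg (rcWeight_nonneg hx _ _) (rcWeight_nonneg (hx.trans hxy) _ _))
    _ = _ := by ring

theorem rcMean_mono_anti {x y : ℝ} (hx : 0 ≤ x) (hxy : x ≤ y) {E E' : Finset (Edge d)}
    (hE : E ⊆ E') {f : EdgeConfig d → ℝ} (hf : Monotone f) :
    rcMean q x E' f ≤ rcMean q y E f := by
  have := wmean_mul_le_rcMean (q := q) hx hxy hE (g := fun _ => 1) (fun _ => zero_le_one)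
    (fun _ _ _ _ => le_rfl) (by simpa using sum_rcWeight_pos hx E') hf
  simpa [rcMean] using this

/-- Since `b ∈ wiredConfigs E` is open off `E`, the configurations `a ⊓ b` and `a` agree wherever
`g` looks. Tilting the law by `g` therefore does not disturb the comparison with the wired measure
on `E`. This is the source of all later decorrelation. -/
theorem rcMean_mul_le {x : ℝ} (hx : 0 ≤ x) {E E' : Finset (Edge d)} (hE : E ⊆ E')
    {f g : EdgeConfig d → ℝ} (hf : Monotone f) (hg0 : ∀ a, 0 ≤ g a)
    (hg : DependsOn g ((E : Set (Edge d))ᶜ)) :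
    rcMean q x E' (fun ω => f ω * g ω) ≤ rcMean q x E f * rcMean q x E' g := by
  have hZ := sum_rcWeight_pos (q := q) hx E'
  have hnn : 0 ≤ ∑ ω ∈ wiredConfigs E', rcWeight q x E' ω * g ω :=
    Finset.sum_nonneg fun a _ => mul_nonneg (rcWeight_nonneg hx _ _) (hg0 a)
  rcases hnn.eq_or_lt with h0 | hpos
  · have h1 : ∀ ω ∈ wiredConfigs E', rcWeight q x E' ω * g ω = 0 :=
      (Finset.sum_eq_zero_iff_of_nonneg
        fun a _ => mul_nonneg (rcWeight_nonneg hx _ _) (hg0 a)).1 h0.symm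
    have h2 : rcMean q x E' (fun ω => f ω * g ω) = 0 := by
      unfold rcMean wmean
      rw [Finset.sum_eq_zero, zero_div]
      intro ω hω
      rw [mul_left_comm, h1 ω hω, mul_zero]
    have h3 : rcMean q x E' g = 0 := by
      unfold rcMean wmean
      rw [← h0, zero_div]
    rw [h2, h3, mul_zero]
  · have h := wmean_mul_le_rcMean (q := q) hx le_rfl hE hg0 (fun a _ b hb => le_of_eq ?_) hpos hf
    · unfold wmean at h
      rw [div_le_iff₀ hpos] at h
      have e : ∑ a ∈ wiredConfigs E', rcWeight q x E' a * (f a * g a) =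
        ∑ a ∈ wiredConfigs E', rcWeight q x E' a * g a * f a :=
          Finset.sum_congr rfl fun a _ => by ring
      rw [show rcMean q x E' g = (∑ a ∈ wiredConfigs E', rcWeight q x E' a * g a) /
        ∑ a ∈ wiredConfigs E', rcWeight q x E' a from rfl, ← mul_div_assoc]
      change _ / _ ≤ _
      rw [e]
      exact div_le_div_of_nonneg_right h hZ.le
    · refine hg fun e he => ?_
      simp [mem_wiredConfigs.1 hb e (by simpa using he)]

theorem rcMean_const {x : ℝ} (hx : 0 ≤ x) (E : Finset (Edge d)) (c : ℝ) :
    rcMean q x E (fun _ => c) = c := wmean_const (sum_rcWeight_pos hx E) c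

theorem rcMean_mono {x : ℝ} (hx : 0 ≤ x) {E : Finset (Edge d)} {f g : EdgeConfig d → ℝ}
    (h : ∀ ω, f ω ≤ g ω) : rcMean q x E f ≤ rcMean q x E g :=
  wmean_mono (fun _ _ => rcWeight_nonneg hx _ _) fun ω _ => h ω

theorem rcMean_nonneg {x : ℝ} (hx : 0 ≤ x) {E : Finset (Edge d)} {f : EdgeConfig d → ℝ}
    (h : ∀ ω, 0 ≤ f ω) : 0 ≤ rcMean q x E f :=
  wmean_nonneg (fun _ _ => rcWeight_nonneg hx _ _) fun ω _ => h ω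

/-! ### Decrease of crossing probabilities with the odds -/

section Crossings

variable {ι : Type*} (I : Finset ι) (B : ι → Set (EdgeConfig d))

open Classical in
/-- The number of indices `k ∈ I` such that `B k` does not occur. -/
noncomputable def missCount (ω : EdgeConfig d) : ℕ := (I.filter fun k => ω ∉ B k).card

variable {I B} {S : ι → Set (Edge d)}

theorem missCount_anti (hB : ∀ k ∈ I, IsUpperSet (B k)) : Antitone (missCount I B) := by
  classical
  intro a b hab
  refine Finset.card_le_card fun k hk => ?_
  simp only [Finset.mem_filter] at hk ⊢
  exact ⟨hk.1, fun h => hk.2 (hB k hk.1 hab h)⟩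

theorem missCount_le_card (ω : EdgeConfig d) : missCount I B ω ≤ I.card := by
  classical
  exact Finset.card_filter_le _ _

/-- Each event `B k` that begins to occur between `a` and `b` must have gained an open edge in `S
k`, and these sets are disjoint. So at least as many edges are gained as misses are lost. -/
theorem openCount_add_missCount_mono {E : Finset (Edge d)}
    (hdisj : ∀ k ∈ I, ∀ l ∈ I, k ≠ l → Disjoint (S k) (S l)) (hSE : ∀ k ∈ I, S k ⊆ E)
    (hBS : ∀ k ∈ I, DependsOn (· ∈ B k) (S k)) {a b : EdgeConfig d} (hab : a ≤ b) :
    openCount E a + missCount I B a ≤ openCount E b + missCount I B b := by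
  classical
  have hex : ∀ k ∈ I.filter (fun k => a ∉ B k ∧ b ∈ B k),
      ∃ e ∈ S k, a e = false ∧ b e = true := by
    intro k hk
    simp only [Finset.mem_filter] at hk
    by_contra! hcon
    refine hk.2.1 ?_
    have := hBS k hk.1 (x := a) (y := b) fun e he => by
      have h1 := hcon e he
      have h2 := hab e
      cases ha : a e
      · simpa [ha] using (h1 ha)
      · exact (Bool.eq_true_of_true_le (ha ▸ h2)).symm
    exact (iff_of_eq this).2 hk.2.2
  have h1 : (I.filter fun k => a ∉ B k ∧ b ∈ B k).card ≤
      (E.filter fun e => a e = false ∧ b e = true).card := by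
    refine Finset.card_le_card_of_forall_subsingleton (fun k e => e ∈ S k) ?_ ?_
    · intro k hk
      obtain ⟨e, he, he'⟩ := hex k hk
      exact ⟨e, Finset.mem_filter.2 ⟨hSE k (Finset.mem_filter.1 hk).1 he, he'⟩, he⟩
    · rintro e - k ⟨hk, hke⟩ l ⟨hl, hle⟩
      by_contra hne
      exact Set.disjoint_left.1 (hdisj k (Finset.mem_filter.1 hk).1 l (Finset.mem_filter.1 hl).1
        hne) hke hle
  have h2 : openCount E a + (E.filter fun e => a e = false ∧ b e = true).card ≤ openCount E b := by
    unfold openCount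
    rw [← Finset.card_union_of_disjoint]
    · refine Finset.card_le_card fun e he => ?_
      simp only [Finset.mem_union, Finset.mem_filter] at he ⊢
      rcases he with ⟨h, h'⟩ | ⟨h, -, h'⟩
      · exact ⟨h, Bool.eq_true_of_true_le (h' ▸ hab e)⟩
      · exact ⟨h, h'⟩
    · refine Finset.disjoint_filter.2 fun e _ h h' => ?_
      simp [h] at h'
  have h3 : missCount I B a ≤ missCount I B b + (I.filter fun k => a ∉ B k ∧ b ∈ B k).card := by
    unfold missCount
    refine le_trans (Finset.card_le_card fun k hk => ?_) (Finset.card_union_le _ _)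
    simp only [Finset.mem_union, Finset.mem_filter] at hk ⊢
    by_cases hb : b ∈ B k
    · exact Or.inr ⟨hk.1, hk.2, hb⟩
    · exact Or.inl ⟨hk.1, hb⟩
  omega

/-- Changing the odds from `x` to `θ * x` tilts the law by `θ ^ openCount`. On `A` nothing is
missed, so the tilt may be replaced there by `θ ^ (openCount + missCount)`, which is non-increasing.
Removing such a factor can only raise the probability of `A`, and the two normalising constants
differ by a mean of `θ ^ missCount`. -/
theorem rcMean_scale_le {x θ : ℝ} (hx : 0 < x) (hθ : 0 < θ) (hθ1 : θ ≤ 1) {E : Finset (Edge d)}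
    (hdisj : ∀ k ∈ I, ∀ l ∈ I, k ≠ l → Disjoint (S k) (S l)) (hSE : ∀ k ∈ I, S k ⊆ E)
    (hBS : ∀ k ∈ I, DependsOn (· ∈ B k) (S k)) (hB : ∀ k ∈ I, IsUpperSet (B k))
    {A : Set (EdgeConfig d)} (hA : IsUpperSet A) (hAB : ∀ k ∈ I, A ⊆ B k) :
    rcMean q (θ * x) E (A.indicator 1) ≤
      rcMean q x E (A.indicator 1) * rcMean q x E fun ω => θ ^ missCount I B ω := by
  classical
  have hAmono : Monotone (A.indicator (1 : EdgeConfig d → ℝ)) := by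
    intro a b hab
    by_cases ha : a ∈ A
    · simp [ha, hA hab ha]
    · simp only [ha, not_false_eq_true, Set.indicator_of_notMem]
      exact Set.indicator_nonneg (fun _ _ => zero_le_one) _
  have hw : ∀ ω, rcWeight q (θ * x) E ω = rcWeight q x E ω * θ ^ openCount E ω := fun ω => by
    unfold rcWeight; rw [mul_pow]; ring
  set g : EdgeConfig d → ℝ := fun ω => θ ^ (openCount E ω + missCount I B ω)
  have hZ := sum_rcWeight_pos (q := q) (x := θ * x) (by positivity) E
  have hgpos : 0 < ∑ ω ∈ wiredConfigs E, rcWeight q x E ω * g ω := by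
    refine Finset.sum_pos' (fun ω _ => mul_nonneg (rcWeight_nonneg hx.le _ _) (by positivity))
      ⟨_, closedOn_mem E, mul_pos (rcWeight_closedOn_pos x E) (by positivity)⟩
  have h1 := wmean_mul_le_rcMean (q := q) hx.le le_rfl (Finset.Subset.refl E) (g := g)
    (fun a => by positivity) (fun a _ b _ => pow_le_pow_of_le_one hθ.le hθ1
      (openCount_add_missCount_mono hdisj hSE hBS inf_le_left)) hgpos hAmono
  have h2 : rcMean q (θ * x) E (fun ω => θ ^ missCount I B ω) ≤
      rcMean q x E (fun ω => θ ^ missCount I B ω) :=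
    rcMean_mono_anti (by positivity) (mul_le_of_le_one_left hx.le hθ1) (Finset.Subset.refl E)
      fun a b hab => pow_le_pow_of_le_one hθ.le hθ1 (missCount_anti hB hab)
  -- The left side is the probability of `A` under the law tilted by `g`, times the ratio of the
  -- total masses of the tilts by `g` and by `θ ^ openCount`.
  have h3 : rcMean q (θ * x) E (A.indicator 1) =
      wmean (wiredConfigs E) (fun ω => rcWeight q x E ω * g ω) (A.indicator 1) *
        rcMean q (θ * x) E (fun ω => θ ^ missCount I B ω) := by
    unfold rcMean wmean
    have e1 : ∑ ω ∈ wiredConfigs E, rcWeight q (θ * x) E ω * θ ^ missCount I B ω =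
        ∑ ω ∈ wiredConfigs E, rcWeight q x E ω * g ω :=
      Finset.sum_congr rfl fun ω _ => by rw [hw, mul_assoc, ← pow_add]
    have e2 : ∑ ω ∈ wiredConfigs E, rcWeight q (θ * x) E ω * A.indicator 1 ω =
        ∑ ω ∈ wiredConfigs E, rcWeight q x E ω * g ω * A.indicator 1 ω := by
      refine Finset.sum_congr rfl fun ω _ => ?_
      by_cases h : ω ∈ A
      · have : missCount I B ω = 0 := by
          simp only [missCount, Finset.card_eq_zero, Finset.filter_eq_empty_iff, not_not]
          exact fun k hk => hAB k hk h
        simp [h, g, this, hw]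
      · simp [h]
    rw [e1, e2]
    field_simp
  rw [h3]
  exact mul_le_mul h1 h2 (rcMean_nonneg (by positivity) fun ω => by positivity)
    (rcMean_nonneg hx.le fun ω => Set.indicator_nonneg (fun _ _ => zero_le_one) _)

/-- An integrated form of the differential inequality for the logarithm of the probability of `A`. A
single step of ratio `θ` yields only the mean of `θ ^ missCount`, which may be much larger than the
exponential wanted here. Cutting the change into many small multiplicative steps repairs this. -/
theorem rcMean_scale_le_exp {x θ : ℝ} (hx : 0 < x) (hθ : 0 < θ) (hθ1 : θ ≤ 1)
    {E : Finset (Edge d)}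
    (hdisj : ∀ k ∈ I, ∀ l ∈ I, k ≠ l → Disjoint (S k) (S l)) (hSE : ∀ k ∈ I, S k ⊆ E)
    (hBS : ∀ k ∈ I, DependsOn (· ∈ B k) (S k)) (hB : ∀ k ∈ I, IsUpperSet (B k))
    {A : Set (EdgeConfig d)} (hA : IsUpperSet A) (hAB : ∀ k ∈ I, A ⊆ B k) :
    rcMean q (θ * x) E (A.indicator 1) ≤ rcMean q x E (A.indicator 1) *
      Real.exp (-((1 - θ) * rcMean q x E fun ω => (missCount I B ω : ℝ))) := by
  have hAmono : Monotone (A.indicator (1 : EdgeConfig d → ℝ)) := by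
    intro a b hab
    by_cases ha : a ∈ A
    · simp [ha, hA hab ha]
    · simp only [ha, not_false_eq_true, Set.indicator_of_notMem]
      exact Set.indicator_nonneg (fun _ _ => zero_le_one) _
  have hA0 : 0 ≤ rcMean q x E (A.indicator 1) :=
    rcMean_nonneg hx.le fun ω => Set.indicator_nonneg (fun _ _ => zero_le_one) _
  set K := I.card with hK
  rcases Nat.eq_zero_or_pos K with hK0 | hKpos
  · have h0 : ∀ ω, missCount I B ω = 0 := fun ω =>
      Nat.le_zero.1 ((missCount_le_card ω).trans_eq (hK.symm.trans hK0))
    simp only [h0, Nat.cast_zero, rcMean_const hx.le, mul_zero, neg_zero, Real.exp_zero, mul_one]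
    exact rcMean_mono_anti (by positivity) (mul_le_of_le_one_left hx.le hθ1)
      (Finset.Subset.refl E) hAmono
  have hKR : (0 : ℝ) < K := by exact_mod_cast hKpos
  -- With `K` steps of this ratio the total change is `θ`, and in each step the exponent `missCount
  -- / K` of `θ` is at most 1.
  set θ' : ℝ := θ ^ (1 / (K : ℝ)) with hθ'
  have hθ'0 : 0 < θ' := Real.rpow_pos_of_pos hθ _
  have hθ'1 : θ' ≤ 1 := Real.rpow_le_one hθ.le hθ1 (by positivity)
  have hθ'K : θ' ^ K = θ := by
    rw [hθ', ← Real.rpow_natCast, ← Real.rpow_mul hθ.le, one_div, inv_mul_cancel₀ hKR.ne',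
      Real.rpow_one]
  set m := rcMean q x E fun ω => θ' ^ missCount I B ω with hm
  have hm0 : 0 ≤ m := rcMean_nonneg hx.le fun ω => by positivity
  have hiter : ∀ j : ℕ, rcMean q (θ' ^ j * x) E (A.indicator 1) ≤
      rcMean q x E (A.indicator 1) * m ^ j := by
    intro j
    induction j with
    | zero => simp
    | succ j ih =>
      have h1 := rcMean_scale_le (q := q) (x := θ' ^ j * x) (by positivity) hθ'0 hθ'1 hdisj hSE
        hBS hB hA hAB
      have h2 : rcMean q (θ' ^ j * x) E (fun ω => θ' ^ missCount I B ω) ≤ m :=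
        rcMean_mono_anti (by positivity)
          (mul_le_of_le_one_left hx.le (pow_le_one₀ hθ'0.le hθ'1)) (Finset.Subset.refl E)
          fun a b hab => pow_le_pow_of_le_one hθ'0.le hθ'1 (missCount_anti hB hab)
      rw [pow_succ', mul_assoc]
      calc _ ≤ _ := h1
        _ ≤ (rcMean q x E (A.indicator 1) * m ^ j) * m :=
            mul_le_mul ih h2 (rcMean_nonneg (by positivity) fun ω => by positivity) (by positivity)
        _ = _ := by ring
  have hmle : m ≤ 1 - (1 - θ) / K * rcMean q x E fun ω => (missCount I B ω : ℝ) := by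
    rw [hm]
    calc _ ≤ rcMean q x E (fun ω => 1 - (1 - θ) / K * (missCount I B ω : ℝ)) := by
          refine rcMean_mono hx.le fun ω => ?_
          set h := missCount I B ω
          have hle : (h : ℝ) ≤ K := by exact_mod_cast missCount_le_card (I := I) (B := B) ω
          -- Weighted means of `θ` and `1` with weights `h/K` and `1 - h/K` give `θ^{h/K} ≤ 1 -
          -- (1-θ) h/K`, which is linear in `h` and can be averaged.
          have := Real.geom_mean_le_arith_mean2_weighted (w₁ := h / K) (w₂ := 1 - h / K)
            (p₁ := θ) (p₂ := 1) (by positivity) (by rw [sub_nonneg, div_le_one hKR]; exact hle)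
            hθ.le zero_le_one (by ring)
          rw [Real.one_rpow, mul_one] at this
          have e : θ' ^ h = θ ^ ((h : ℝ) / K) := by
            rw [hθ', ← Real.rpow_natCast, ← Real.rpow_mul hθ.le]; congr 1; ring
          rw [e]
          refine this.trans_eq ?_
          field_simp
          ring
      _ = _ := by
          unfold rcMean
          rw [wmean_sub, wmean_const (sum_rcWeight_pos hx.le E), wmean_const_mul]
  have hfin := hiter K
  rw [hθ'K] at hfin
  refine hfin.trans (mul_le_mul_of_nonneg_left ?_ hA0)
  set R := rcMean q x E fun ω => (missCount I B ω : ℝ)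
  calc m ^ K ≤ (Real.exp (-((1 - θ) / K * R))) ^ K := by
        refine pow_le_pow_left₀ hm0 (hmle.trans ?_) K
        have := Real.add_one_le_exp (-((1 - θ) / K * R))
        linarith
    _ = Real.exp (-((1 - θ) * R)) := by
        rw [← Real.exp_nat_mul]
        congr 1
        field_simp

end Crossings

end

/-! ### Weak limits through local functions, and the measures of the statement in terms of odds -/

section

/-! ### Local functions on a countable product of finite sets -/

section Local

set_option linter.unusedSectionVars false

variable {ι S : Type*} [Finite S] [TopologicalSpace S] [DiscreteTopology S]

theorem continuous_of_dependsOn {β : Type*} [TopologicalSpace β] {J : Finset ι}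
    {f : (ι → S) → β} (hf : DependsOn f (J : Set ι)) : Continuous f := by
  rcases isEmpty_or_nonempty β with hβ | hβ
  · have : IsEmpty (ι → S) := ⟨fun x => hβ.false (f x)⟩
    exact continuous_of_discreteTopology
  obtain ⟨g, rfl⟩ := dependsOn_iff_exists_comp.1 hf
  exact continuous_of_discreteTopology.comp (by fun_prop)

theorem finite_range_of_dependsOn {β : Type*} {J : Finset ι}
    {f : (ι → S) → β} (hf : DependsOn f (J : Set ι)) : (Set.range f).Finite := by
  rcases isEmpty_or_nonempty β with hβ | hβ
  · exact Set.toFinite _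
  obtain ⟨g, rfl⟩ := dependsOn_iff_exists_comp.1 hf
  exact (Set.toFinite (Set.range g)).subset (Set.range_comp_subset_range _ _)

theorem exists_bound_of_dependsOn {J : Finset ι} {f : (ι → S) → ℝ}
    (hf : DependsOn f (J : Set ι)) : ∃ C, ∀ x, |f x| ≤ C := by
  obtain ⟨C, hC⟩ := ((finite_range_of_dependsOn hf).image fun y => |y|).bddAbove
  exact ⟨C, fun x => hC ⟨f x, ⟨x, rfl⟩, rfl⟩⟩

variable [MeasurableSpace S] [DiscreteMeasurableSpace S] [Countable ι]

theorem measurable_of_dependsOn {β : Type*} [MeasurableSpace β] {J : Finset ι}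
    {f : (ι → S) → β} (hf : DependsOn f (J : Set ι)) : Measurable f := by
  rcases isEmpty_or_nonempty β with hβ | hβ
  · have : IsEmpty (ι → S) := ⟨fun x => hβ.false (f x)⟩
    exact measurable_of_empty f
  obtain ⟨g, rfl⟩ := dependsOn_iff_exists_comp.1 hf
  exact (measurable_of_finite g).comp (by fun_prop)

theorem measurableSet_of_dependsOn {J : Finset ι} {A : Set (ι → S)}
    (hA : DependsOn (· ∈ A) (J : Set ι)) : MeasurableSet A :=
  measurableSet_setOfPred.2 (measurable_of_dependsOn hA)

theorem integrable_of_dependsOn {J : Finset ι} {f : (ι → S) → ℝ}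
    (hf : DependsOn f (J : Set ι)) (μ : Measure (ι → S)) [IsFiniteMeasure μ] :
    Integrable f μ := by
  obtain ⟨C, hC⟩ := exists_bound_of_dependsOn hf
  exact Integrable.of_bound (measurable_of_dependsOn hf).aestronglyMeasurable C
    (Eventually.of_forall hC)

theorem dependsOn_indicator {J : Set ι} {A : Set (ι → S)} (hA : DependsOn (· ∈ A) J) :
    DependsOn (A.indicator (1 : (ι → S) → ℝ)) J := by
  intro x y h
  have : x ∈ A ↔ y ∈ A := iff_of_eq (hA h)
  by_cases hx : x ∈ A
  · simp [hx, this.1 hx]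
  · have hy : y ∉ A := fun hy => hx (this.2 hy)
    simp [hx, hy]

theorem measure_ext_of_local {P Q : Measure (ι → S)} [IsProbabilityMeasure P]
    [IsProbabilityMeasure Q]
    (h : ∀ (J : Finset ι) (A : Set (ι → S)), DependsOn (· ∈ A) (J : Set ι) → P A = Q A) :
    P = Q := by
  refine ext_of_generate_finite _ generateFrom_measurableCylinders.symm
    isPiSystem_measurableCylinders (fun A hA => ?_) (by simp)
  obtain ⟨J, B, hB, rfl⟩ := (mem_measurableCylinders _).1 hA
  refine h J _ fun x y hxy => ?_
  simp only [mem_cylinder, eq_iff_iff]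
  rw [show J.restrict x = J.restrict y from funext fun i => hxy i i.2]

variable [BorelSpace S]

/-- The integral of a local function is continuous in the measure. -/
theorem continuous_integral_of_dependsOn {J : Finset ι} {f : (ι → S) → ℝ}
    (hf : DependsOn f (J : Set ι)) :
    Continuous fun P : ProbabilityMeasure (ι → S) => ∫ x, f x ∂(P : Measure (ι → S)) := by
  obtain ⟨C, hC⟩ := exists_bound_of_dependsOn hf
  let g : BoundedContinuousFunction (ι → S) ℝ :=
    BoundedContinuousFunction.ofNormedAddCommGroup f (continuous_of_dependsOn hf) C hC
  exact continuous_iff_continuousAt.2 fun P =>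
    (ProbabilityMeasure.tendsto_iff_forall_integral_tendsto.1 (continuous_id.tendsto P)) g

theorem probabilityMeasure_ext_of_local {P Q : ProbabilityMeasure (ι → S)}
    (h : ∀ (J : Finset ι) (f : (ι → S) → ℝ), DependsOn f (J : Set ι) →
      ∫ x, f x ∂(P : Measure (ι → S)) = ∫ x, f x ∂(Q : Measure (ι → S))) : P = Q := by
  have hP : IsProbabilityMeasure (P : Measure (ι → S)) := P.2
  have hQ : IsProbabilityMeasure (Q : Measure (ι → S)) := Q.2
  refine Subtype.ext (measure_ext_of_local (P := (P : Measure (ι → S)))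
    (Q := (Q : Measure (ι → S))) fun J A hA => ?_)
  have h1 := h J _ (dependsOn_indicator hA)
  rw [integral_indicator_one (measurableSet_of_dependsOn hA),
    integral_indicator_one (measurableSet_of_dependsOn hA)] at h1
  exact (measureReal_eq_measureReal_iff).1 h1

/-- A net of probability measures converges weakly as soon as the integrals of all local functions
converge. -/
theorem exists_tendsto_of_local {γ : Type*} {F : Filter γ} [NeBot F]
    {M : γ → ProbabilityMeasure (ι → S)}
    (h : ∀ (J : Finset ι) (f : (ι → S) → ℝ), DependsOn f (J : Set ι) →
      ∃ l, Tendsto (fun i => ∫ x, f x ∂(M i : Measure (ι → S))) F (𝓝 l)) :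
    ∃ P, Tendsto M F (𝓝 P) := by
  -- Probability measures on this compact product form a compact space, so a cluster point exists.
  -- All cluster points give the same integrals to local functions and hence coincide.
  obtain ⟨P, -, hP⟩ := isCompact_univ.exists_mapClusterPt (f := F) (u := M) (by simp)
  refine ⟨P, isCompact_univ.tendsto_nhds_of_unique_mapClusterPt (by simp) fun Q _ hQ => ?_⟩
  refine probabilityMeasure_ext_of_local fun J f hf => ?_
  obtain ⟨l, hl⟩ := h J f hf
  have key : ∀ R, MapClusterPt R F M → ∫ x, f x ∂(R : Measure (ι → S)) = l := fun R hR => by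
    have := hR.tendsto_comp ((continuous_integral_of_dependsOn hf).tendsto R)
    have h2 : NeBot (𝓝 (∫ x, f x ∂(R : Measure (ι → S))) ⊓ 𝓝 l) :=
      NeBot.mono this (inf_le_inf_left _ hl)
    exact eq_of_nhds_neBot h2
  rw [key P hP, key Q hQ]

end Local

variable {d q : ℕ}

/-! ### The wired measures of the statement -/

section Link

variable [NeZero q]

/-- Locally constant spin configurations are functions on the set of open clusters. -/
noncomputable def invSpinsEquiv (ω : EdgeConfig d) :
    invSpins q ω ≃ ((openGraph ω).ConnectedComponent → Fin q) where
  toFun σ := SimpleGraph.ConnectedComponent.lift (σ : Site d → Fin q)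
    fun _ _ w _ => eq_of_reachable σ.2 w.reachable
  invFun t := ⟨fun x => t ((openGraph ω).connectedComponentMk x), fun x y h => by
    simp only [SimpleGraph.ConnectedComponent.connectedComponentMk_eq_of_adj h]⟩
  left_inv σ := by ext; rfl
  right_inv t := by
    ext c
    induction c using SimpleGraph.ConnectedComponent.ind
    rfl

/-- `numClusters` counts only components meeting `E`. When `E` is nonempty these are all components,
because every edge off `E` is open and the lattice is connected. -/
theorem card_invSpins_eq {E : Finset (Edge d)} (hE : E.Nonempty) {ω : EdgeConfig d}
    (hω : ω ∈ wiredConfigs E) : Nat.card (invSpins q ω) = q ^ numClusters E ω := by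
  set T : Set (openGraph ω).ConnectedComponent := {c | ∃ e ∈ E, ∃ x ∈ (e : Sym2 (Site d)),
    (openGraph ω).connectedComponentMk x = c} with hT
  have hTe : T = (openGraph ω).connectedComponentMk '' endpoints E := by
    ext c
    simp only [hT, endpoints, Set.mem_ofPred_eq, Set.mem_image]
    exact ⟨fun ⟨e, he, x, hx, h⟩ => ⟨x, ⟨e, he, hx⟩, h⟩, fun ⟨x, ⟨e, he, hx⟩, h⟩ => ⟨e, he, x, hx, h⟩⟩
  have hTu : T = Set.univ := by
    rw [Set.eq_univ_iff_forall]
    intro c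
    induction c using SimpleGraph.ConnectedComponent.ind with | _ x => ?_
    obtain ⟨⟨e, he⟩, heE⟩ := hE
    induction e using Sym2.ind with | _ a b => ?_
    have ha : a ∈ endpoints E := ⟨_, heE, by simp⟩
    have := apply_eq_of_adj (σ := fun x => (openGraph ω).connectedComponentMk x ∈ T)
      (fun u v huv => ?_) x a
    · exact this ▸ (hTe ▸ Set.mem_image_of_mem _ ha)
    · rcases adj_of_not_mem hω huv with h | ⟨hu, hv⟩
      · simp only [SimpleGraph.ConnectedComponent.connectedComponentMk_eq_of_adj h]
      · simp only [hTe, Set.mem_image_of_mem _ hu, Set.mem_image_of_mem _ hv]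
  have hfin : Finite (openGraph ω).ConnectedComponent :=
    Set.finite_univ_iff.1 (hTu ▸ hTe ▸ (finite_endpoints E).image _)
  rw [Nat.card_congr (invSpinsEquiv ω), Nat.card_fun, Nat.card_fin]
  congr 1
  change _ = T.ncard
  rw [hTu, Set.ncard_univ]

/-- A constant factor cancels in the normalised measure. It differs from 1 only for empty `E`, where
`numClusters` vanishes although there is one cluster; the only configuration is then the fully open
one. -/
theorem exists_card_invSpins (E : Finset (Edge d)) :
    ∃ c : ℝ, c ≠ 0 ∧ ∀ ω ∈ wiredConfigs E, (q : ℝ) ^ numClusters E ω =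
      c * Nat.card (invSpins q ω) := by
  rcases E.eq_empty_or_nonempty with rfl | hE
  · have h1 : ∀ ω ∈ wiredConfigs (∅ : Finset (Edge d)), ω = fun _ => true := fun ω hω =>
      funext fun e => mem_wiredConfigs.1 hω e (by simp)
    have h2 := card_invSpins_pos (q := q) (ω := fun _ => true) (E := (∅ : Finset (Edge d)))
      (mem_wiredConfigs.2 fun _ _ => rfl)
    have h3 : (0 : ℝ) < Nat.card (invSpins q (fun _ => true : EdgeConfig d)) := by exact_mod_cast h2
    refine ⟨(q : ℝ) ^ numClusters (∅ : Finset (Edge d)) (fun _ => true) *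
      (Nat.card (invSpins q (fun _ => true : EdgeConfig d)) : ℝ)⁻¹, ?_, ?_⟩
    · have : (q : ℝ) ≠ 0 := NeZero.ne _
      positivity
    · intro ω hω
      rw [h1 ω hω]
      field_simp
  · exact ⟨1, one_ne_zero, fun ω hω => by
      rw [card_invSpins_eq hE hω]; push_cast; ring⟩

theorem sum_wiredConfigs (E : Finset (Edge d)) (F : EdgeConfig d → ℝ) :
    ∑ ω ∈ wiredConfigs E, F ω = ∑ ξ : E → Bool, F (glueEdges E ξ fun _ => true) := by
  classical
  rw [wiredConfigs, Finset.sum_image]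
  intro ξ _ ξ' _ h
  ext e
  have := congrFun h e
  simpa [glueEdges] using this

theorem exists_fkWeight_eq {p : ℝ} (hp : p < 1) (E : Finset (Edge d)) :
    ∃ c : ℝ, c ≠ 0 ∧ ∀ ξ : E → Bool, fkWeight p q E (fun _ => true) ξ =
      c * rcWeight q (p / (1 - p)) E (glueEdges E ξ fun _ => true) := by
  classical
  obtain ⟨c, hc, h⟩ := exists_card_invSpins (q := q) E
  have hp' : (1 - p) ≠ 0 := by linarith
  refine ⟨c * (1 - p) ^ E.card, mul_ne_zero hc (pow_ne_zero _ hp'), fun ξ => ?_⟩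
  set ω := glueEdges E ξ fun _ => true with hω
  have hmem : ω ∈ wiredConfigs E := Finset.mem_image_of_mem _ (Finset.mem_univ _)
  have h1 : (∏ e, if ξ e then p else 1 - p) = (1 - p) ^ E.card * (p / (1 - p)) ^ openCount E ω := by
    have h2 : (∏ e, if ξ e then p else 1 - p) =
        ∏ e ∈ E, (1 - p) * if ω e = true then p / (1 - p) else 1 := by
      rw [← Finset.prod_coe_sort E]
      refine Finset.prod_congr rfl fun e _ => ?_
      have : ω e = ξ e := by simp [hω, glueEdges]
      rw [this]
      split_ifs
      · field_simp
      · ring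
    rw [h2, Finset.prod_mul_distrib, Finset.prod_const, Finset.prod_ite, Finset.prod_const,
      Finset.prod_const_one, mul_one, openCount]
  rw [fkWeight, h1, ← hω, h ω hmem, rcWeight]
  ring

theorem integral_fkMeasure {p : ℝ} (hp0 : 0 ≤ p) (hp : p < 1) (E : Finset (Edge d))
    (f : EdgeConfig d → ℝ) :
    ∫ ω, f ω ∂(fkMeasure p q E (fun _ => true) : Measure (EdgeConfig d)) =
      rcMean q (p / (1 - p)) E f := by
  classical
  obtain ⟨c, hc, hcw⟩ := exists_fkWeight_eq (q := q) hp E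
  have hx : 0 ≤ p / (1 - p) := div_nonneg hp0 (by linarith)
  have hw0 : ∀ ξ : E → Bool, 0 ≤ fkWeight p q E (fun _ => true) ξ := fun ξ => by
    unfold fkWeight
    refine mul_nonneg (Finset.prod_nonneg fun e _ => ?_) (by positivity)
    split_ifs <;> linarith
  set ν : FiniteMeasure (EdgeConfig d) := ∑ ξ : E → Bool,
    (fkWeight p q E (fun _ => true) ξ).toNNReal •
      (diracProba (glueEdges E ξ fun _ => true)).toFiniteMeasure with hν
  have hνm : (ν : Measure (EdgeConfig d)) = ∑ ξ : E → Bool,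
      (fkWeight p q E (fun _ => true) ξ).toNNReal •
        Measure.dirac (glueEdges E ξ fun _ => true) := by
    rw [hν, FiniteMeasure.toMeasure_sum]
    rfl
  have hint : ∀ g : EdgeConfig d → ℝ, ∫ ω, g ω ∂(ν : Measure (EdgeConfig d)) =
      ∑ ξ : E → Bool, fkWeight p q E (fun _ => true) ξ * g (glueEdges E ξ fun _ => true) := by
    intro g
    rw [hνm, integral_finsetSum_measure]
    · refine Finset.sum_congr rfl fun ξ _ => ?_
      rw [integral_smul_nnreal_measure, integral_dirac, NNReal.smul_def, Real.coe_toNNReal _ (hw0 ξ),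
        smul_eq_mul]
    · intro ξ _
      exact (integrable_dirac (by simp)).smul_measure_nnreal
  have hmass : (ν.mass : ℝ) = ∑ ξ : E → Bool, fkWeight p q E (fun _ => true) ξ := by
    have := hint fun _ => 1
    simp only [integral_const, smul_eq_mul, mul_one] at this
    rw [← this]
    rfl
  have hZ := sum_rcWeight_pos (q := q) hx E
  have hmass' : (ν.mass : ℝ) = c * ∑ ω ∈ wiredConfigs E, rcWeight q (p / (1 - p)) E ω := by
    rw [hmass, sum_wiredConfigs, Finset.mul_sum]
    exact Finset.sum_congr rfl fun ξ _ => hcw ξ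
  -- `normalize` takes a default value at the zero measure, which has to be excluded.
  have hν0 : ν ≠ 0 := by
    intro h0
    rw [h0] at hmass'
    simp only [FiniteMeasure.zero_mass, NNReal.coe_zero] at hmass'
    exact mul_ne_zero hc hZ.ne' hmass'.symm
  rw [fkMeasure, ← hν, FiniteMeasure.toMeasure_normalize_eq_of_nonzero ν hν0,
    integral_smul_nnreal_measure, hint, NNReal.smul_def, NNReal.coe_inv, hmass', rcMean, wmean,
    sum_wiredConfigs, sum_wiredConfigs, smul_eq_mul]
  simp only [hcw, mul_assoc]
  rw [← Finset.mul_sum, ← sum_wiredConfigs E (rcWeight q (p / (1 - p)) E)]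
  field_simp

end Link

end

/-! ### The infinite-volume wired measure as a monotone, translation-invariant limit -/

section

variable {d q : ℕ}

/-! ### The infinite-volume wired measure -/

theorem monotone_indicator {A : Set (EdgeConfig d)} (hA : IsUpperSet A) :
    Monotone (A.indicator (1 : EdgeConfig d → ℝ)) := by
  intro a b hab
  by_cases ha : a ∈ A
  · simp [ha, hA hab ha]
  · simp only [ha, not_false_eq_true, Set.indicator_of_notMem]
    exact Set.indicator_nonneg (fun _ _ => zero_le_one) _

/-- The indicator that the edge `e` is open. -/
noncomputable def openInd (e : Edge d) (ω : EdgeConfig d) : ℝ := if ω e = true then 1 else 0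

theorem openInd_mono (e : Edge d) : Monotone (openInd e) := by
  intro a b hab
  have := hab e
  unfold openInd
  cases ha : a e
  · simp only [Bool.false_eq_true, if_false]; split_ifs <;> norm_num
  · rw [ha] at this; simp [Bool.eq_true_of_true_le this]

/-- Adding a large multiple of the number of open edges makes a local function increasing. -/
theorem monotone_add_sum_openInd {J : Finset (Edge d)} {f : EdgeConfig d → ℝ}
    (hf : DependsOn f (J : Set (Edge d))) {C : ℝ} (hC : ∀ a b, f a - f b ≤ C) :
    Monotone fun ω => f ω + C * ∑ e ∈ J, openInd e ω := by
  intro a b hab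
  have hC0 : 0 ≤ C := by simpa using hC a a
  have hle : ∑ e ∈ J, openInd e a ≤ ∑ e ∈ J, openInd e b :=
    Finset.sum_le_sum fun e _ => openInd_mono e hab
  by_cases h : ∀ e ∈ J, a e = b e
  · have h1 : f a = f b := hf h
    simp only [h1]
    gcongr
  -- Some edge of `J` opens, so the sum gains at least 1, and `C` times this gain absorbs the
  -- oscillation of `f`.
  · push Not at h
    obtain ⟨e, he, hne⟩ := h
    have h1 : openInd e b = openInd e a + 1 := by
      have := hab e
      unfold openInd
      cases ha : a e <;> cases hb : b e <;> simp_all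
      exact absurd (Bool.eq_true_of_true_le this) Bool.false_ne_true
    have h2 : ∑ e ∈ J, openInd e a + 1 ≤ ∑ e ∈ J, openInd e b := by
      classical
      rw [← Finset.add_sum_erase J _ he, ← Finset.add_sum_erase J _ he, h1]
      have : ∑ e ∈ J.erase e, openInd e a ≤ ∑ e ∈ J.erase e, openInd e b :=
        Finset.sum_le_sum fun e _ => openInd_mono e hab
      linarith
    have h3 := hC a b
    have h4 := mul_le_mul_of_nonneg_left h2 hC0
    simp only
    linarith

variable [NeZero q]

/-- Means of increasing functions decrease as the volume grows and are bounded below by the value at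
`⊥`. A local function is a difference of two increasing ones. -/
theorem exists_tendsto_rcMean {x : ℝ} (hx : 0 ≤ x) {J : Finset (Edge d)} {f : EdgeConfig d → ℝ}
    (hf : DependsOn f (J : Set (Edge d))) :
    ∃ l, Tendsto (fun E => rcMean q x E f) atTop (𝓝 l) := by
  have hmono : ∀ g : EdgeConfig d → ℝ, Monotone g →
      ∃ l, Tendsto (fun E => rcMean q x E g) atTop (𝓝 l) := fun g hg => by
    refine ⟨_, tendsto_atTop_ciInf (fun E E' hE => rcMean_mono_anti hx le_rfl hE hg) ⟨g ⊥, ?_⟩⟩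
    rintro _ ⟨E, rfl⟩
    change _ ≤ rcMean q x E g
    rw [← rcMean_const (q := q) hx E (g ⊥)]
    exact rcMean_mono hx fun ω => hg bot_le
  obtain ⟨C, hC⟩ := exists_bound_of_dependsOn hf
  obtain ⟨l₁, h₁⟩ := hmono _ (monotone_add_sum_openInd hf (C := 2 * C) fun a b => by
    linarith [(abs_le.1 (hC a)).2, (abs_le.1 (hC b)).1])
  obtain ⟨l₂, h₂⟩ := hmono (fun ω => ∑ e ∈ J, openInd e ω) fun a b hab =>
    Finset.sum_le_sum fun e _ => openInd_mono e hab
  refine ⟨l₁ - 2 * C * l₂, (h₁.sub (h₂.const_mul (2 * C))).congr fun E => ?_⟩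
  unfold rcMean
  rw [wmean_add, wmean_const_mul]
  ring

theorem tendsto_innerEdges : Tendsto (innerEdges (d := d)) atTop atTop := by
  classical
  refine tendsto_atTop_finset_of_monotone (fun Λ Λ' h e he => ?_) fun e => ?_
  · simp only [innerEdges, Finset.mem_subtype] at he ⊢
    exact Finset.sym2_mono h he
  · obtain ⟨e, he⟩ := e
    induction e using Sym2.ind with | _ a b => ?_
    exact ⟨{a, b}, by simp [innerEdges]⟩

variable (d q) in
/-- The infinite-volume wired random-cluster measure with odds `x`. -/
noncomputable def rcInf (x : ℝ) : ProbabilityMeasure (EdgeConfig d) := wiredFK d (x / (1 + x)) q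

/-- Convergence holds along all finite edge sets, hence along the sets `innerEdges Λ`. Existence of
the weak limit is what makes `limUnder` in `wiredFK` the actual limit and not a default value. -/
theorem tendsto_rcMean {x : ℝ} (hx : 0 ≤ x) {J : Finset (Edge d)} {f : EdgeConfig d → ℝ}
    (hf : DependsOn f (J : Set (Edge d))) :
    Tendsto (fun E => rcMean q x E f) atTop
      (𝓝 (∫ ω, f ω ∂(rcInf d q x : Measure (EdgeConfig d)))) := by
  set p := x / (1 + x) with hp
  have hx1 : 0 < 1 + x := by linarith
  have hp0 : 0 ≤ p := div_nonneg hx hx1.le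
  have hp1 : p < 1 := (div_lt_one hx1).2 (by linarith)
  have hpx : p / (1 - p) = x := by
    have : 1 - p = 1 / (1 + x) := by rw [hp]; field_simp; ring
    rw [this, hp]; field_simp
  have hint : ∀ (E : Finset (Edge d)) (f : EdgeConfig d → ℝ),
      ∫ ω, f ω ∂(fkMeasure p q E (fun _ => true) : Measure (EdgeConfig d)) = rcMean q x E f :=
    fun E f => by rw [integral_fkMeasure hp0 hp1, hpx]
  obtain ⟨P, hP⟩ := exists_tendsto_of_local (F := atTop)
    (M := fun E : Finset (Edge d) => fkMeasure p q E (fun _ => true)) fun J f hf => by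
      simp only [hint]
      exact exists_tendsto_rcMean hx hf
  have hPeq : rcInf d q x = P := (hP.comp tendsto_innerEdges).limUnder_eq
  rw [hPeq]
  have := ((continuous_integral_of_dependsOn hf).tendsto P).comp hP
  exact this.congr fun E => hint E f

theorem integral_rcInf_le_rcMean {x : ℝ} (hx : 0 ≤ x) {J : Finset (Edge d)}
    {f : EdgeConfig d → ℝ} (hf : DependsOn f (J : Set (Edge d))) (hf' : Monotone f)
    (E : Finset (Edge d)) :
    ∫ ω, f ω ∂(rcInf d q x : Measure (EdgeConfig d)) ≤ rcMean q x E f :=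
  le_of_tendsto (tendsto_rcMean hx hf)
    (eventually_atTop.2 ⟨E, fun _ h => rcMean_mono_anti hx le_rfl h hf'⟩)

theorem integral_rcInf_mono {x y : ℝ} (hx : 0 ≤ x) (hxy : x ≤ y) {J : Finset (Edge d)}
    {f : EdgeConfig d → ℝ} (hf : DependsOn f (J : Set (Edge d))) (hf' : Monotone f) :
    ∫ ω, f ω ∂(rcInf d q x : Measure (EdgeConfig d)) ≤
      ∫ ω, f ω ∂(rcInf d q y : Measure (EdgeConfig d)) :=
  le_of_tendsto_of_tendsto' (tendsto_rcMean hx hf) (tendsto_rcMean (hx.trans hxy) hf)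
    fun E => rcMean_mono_anti hx hxy (Finset.Subset.refl E) hf'

theorem integral_rcInf_mul_le {x : ℝ} (hx : 0 ≤ x) {J K E : Finset (Edge d)}
    {f g : EdgeConfig d → ℝ} (hf : DependsOn f (J : Set (Edge d))) (hf' : Monotone f)
    (hg : DependsOn g (K : Set (Edge d))) (hg0 : ∀ ω, 0 ≤ g ω) (hKE : Disjoint K E) :
    ∫ ω, f ω * g ω ∂(rcInf d q x : Measure (EdgeConfig d)) ≤
      rcMean q x E f * ∫ ω, g ω ∂(rcInf d q x : Measure (EdgeConfig d)) := by
  classical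
  have hfg : DependsOn (fun ω => f ω * g ω) ((J ∪ K : Finset (Edge d)) : Set (Edge d)) := by
    intro a b hab
    simp only
    rw [hf fun e he => hab e (by simp at he ⊢; tauto), hg fun e he => hab e (by simp at he ⊢; tauto)]
  refine le_of_tendsto_of_tendsto (tendsto_rcMean hx hfg)
    ((tendsto_rcMean hx hg).const_mul _) ?_
  filter_upwards [eventually_ge_atTop E] with E' hE'
  refine rcMean_mul_le hx hE' hf' hg0 (hg.mono fun e heK heE => ?_)
  exact Finset.disjoint_left.1 hKE heK heE

/-- An increasing local event that forces many local events in disjoint sets of edges becomes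
much less likely when the odds decrease. -/
theorem rcInf_scale_le {x θ : ℝ} (hx : 0 < x) (hθ : 0 < θ) (hθ1 : θ ≤ 1)
    {ι : Type*} {I : Finset ι} {B : ι → Set (EdgeConfig d)} {S : ι → Finset (Edge d)}
    (hdisj : ∀ k ∈ I, ∀ l ∈ I, k ≠ l → Disjoint (S k) (S l))
    (hBS : ∀ k ∈ I, DependsOn (· ∈ B k) (S k : Set (Edge d))) (hB : ∀ k ∈ I, IsUpperSet (B k))
    {A : Set (EdgeConfig d)} {J : Finset (Edge d)} (hAJ : DependsOn (· ∈ A) (J : Set (Edge d)))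
    (hA : IsUpperSet A) (hAB : ∀ k ∈ I, A ⊆ B k) :
    (rcInf d q (θ * x) : Measure (EdgeConfig d)).real A ≤
      (rcInf d q x : Measure (EdgeConfig d)).real A * Real.exp (-((1 - θ) *
        ∑ k ∈ I, (1 - (rcInf d q x : Measure (EdgeConfig d)).real (B k)))) := by
  classical
  have hmc : ∀ ω, (missCount I B ω : ℝ) = ∑ k ∈ I, (1 - (B k).indicator 1 ω) := fun ω => by
    rw [missCount, Finset.card_filter]
    push_cast
    refine Finset.sum_congr rfl fun k _ => ?_
    by_cases h : ω ∈ B k <;> simp [h]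
  have hreal : ∀ {y : ℝ} (_ : 0 ≤ y) {D : Set (EdgeConfig d)} {K : Finset (Edge d)},
      DependsOn (· ∈ D) (K : Set (Edge d)) → Tendsto (fun E => rcMean q y E (D.indicator 1)) atTop
        (𝓝 ((rcInf d q y : Measure (EdgeConfig d)).real D)) := fun hy D K hD => by
    rw [← integral_indicator_one (measurableSet_of_dependsOn hD)]
    exact tendsto_rcMean hy (dependsOn_indicator hD)
  have hlim : Tendsto (fun E => ∑ k ∈ I, (1 - rcMean q x E ((B k).indicator 1))) atTop
      (𝓝 (∑ k ∈ I, (1 - (rcInf d q x : Measure (EdgeConfig d)).real (B k)))) :=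
    tendsto_finsetSum _ fun k hk => (hreal hx.le (hBS k hk)).const_sub 1
  refine le_of_tendsto_of_tendsto (hreal (by positivity) hAJ) ((hreal hx.le hAJ).mul
    ((Real.continuous_exp.tendsto _).comp (hlim.const_mul (1 - θ)).neg)) ?_
  filter_upwards [eventually_ge_atTop (I.biUnion S)] with E hE
  refine (rcMean_scale_le_exp hx hθ hθ1 (S := fun k => (S k : Set (Edge d)))
    (fun k hk l hl hkl => by exact_mod_cast hdisj k hk l hl hkl)
    (fun k hk e he => hE (Finset.mem_biUnion.2 ⟨k, hk, he⟩)) hBS hB hA hAB).trans_eq ?_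
  simp only [hmc, Function.comp_apply]
  congr 4
  unfold rcMean
  rw [wmean_sum]
  refine Finset.sum_congr rfl fun k _ => ?_
  rw [wmean_sub, wmean_const (sum_rcWeight_pos hx.le E)]

/-! ### Translation invariance -/

/-- Translation of edges. -/
def shiftEdge (a : Site d) : Edge d ≃ Edge d where
  toFun e := ⟨Sym2.map (· + a) e, by
    obtain ⟨e, he⟩ := e
    induction e using Sym2.ind with | _ u v => ?_
    change norm1 (u - v) = 1 at he
    change norm1 (u + a - (v + a)) = 1
    simpa using he⟩
  invFun e := ⟨Sym2.map (· - a) e, by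
    obtain ⟨e, he⟩ := e
    induction e using Sym2.ind with | _ u v => ?_
    change norm1 (u - v) = 1 at he
    change norm1 (u - a - (v - a)) = 1
    simpa using he⟩
  left_inv e := by
    ext1
    simp [Sym2.map_map]
  right_inv e := by
    ext1
    simp [Sym2.map_map]

/-- Translation of edge configurations. -/
def shift (a : Site d) (ω : EdgeConfig d) : EdgeConfig d := fun e => ω (shiftEdge a e)

theorem shift_injective (a : Site d) : Function.Injective (shift a) := by
  intro ω ω' h
  funext e
  have := congrFun h ((shiftEdge a).symm e)
  simpa [shift] using this

theorem openGraph_shift_adj {a : Site d} {ω : EdgeConfig d} {u v : Site d} :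
    (openGraph (shift a ω)).Adj u v ↔ (openGraph ω).Adj (u + a) (v + a) := by
  rw [openGraph_adj, openGraph_adj]
  constructor
  · rintro ⟨h, h'⟩
    exact ⟨(shiftEdge a ⟨s(u, v), h⟩).2, h'⟩
  · rintro ⟨h, h'⟩
    have hl : (lattice d).Adj u v := by
      change norm1 _ = 1 at h ⊢
      simpa using h
    exact ⟨hl, h'⟩

theorem reachable_shift {a : Site d} {ω : EdgeConfig d} {u v : Site d} :
    (openGraph (shift a ω)).Reachable u v ↔ (openGraph ω).Reachable (u + a) (v + a) := by
  let φ : openGraph (shift a ω) ≃g openGraph ω :=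
    { toEquiv := Equiv.addRight a
      map_rel_iff' := openGraph_shift_adj.symm }
  exact (SimpleGraph.Iso.reachable_iff (φ := φ)).symm

theorem card_invSpins_shift (a : Site d) (ω : EdgeConfig d) :
    Nat.card (invSpins q (shift a ω)) = Nat.card (invSpins q ω) := by
  refine Nat.card_congr
    { toFun := fun σ => ⟨fun x => (σ : Site d → Fin q) (x - a), fun u v h => ?_⟩
      invFun := fun σ => ⟨fun x => (σ : Site d → Fin q) (x + a), fun u v h => ?_⟩
      left_inv := fun σ => by ext; simp
      right_inv := fun σ => by ext; simp }
  · exact σ.2 _ _ (openGraph_shift_adj.2 (by simpa using h))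
  · exact σ.2 _ _ (openGraph_shift_adj.1 h)

theorem shift_mem_wiredConfigs {a : Site d} {E : Finset (Edge d)} {ω : EdgeConfig d} :
    shift a ω ∈ wiredConfigs E ↔ ω ∈ wiredConfigs (E.map (shiftEdge a).toEmbedding) := by
  simp only [mem_wiredConfigs, Finset.mem_map_equiv]
  constructor
  · intro h e he
    have := h _ he
    simpa [shift] using this
  · intro h e he
    exact h _ (by simpa using he)

theorem rcMean_shift (x : ℝ) (a : Site d) (E : Finset (Edge d)) (f : EdgeConfig d → ℝ) :
    rcMean q x (E.map (shiftEdge a).toEmbedding) (fun ω => f (shift a ω)) = rcMean q x E f := by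
  classical
  have hw : ∀ ω, rcWeight q x (E.map (shiftEdge a).toEmbedding) ω = rcWeight q x E (shift a ω) := by
    intro ω
    unfold rcWeight
    rw [card_invSpins_shift]
    congr 2
    unfold openCount
    rw [Finset.filter_map, Finset.card_map]
    rfl
  have himg : wiredConfigs E = (wiredConfigs (E.map (shiftEdge a).toEmbedding)).image (shift a) := by
    ext ω
    simp only [Finset.mem_image]
    constructor
    · intro h
      have h2 : shift a (fun e => ω ((shiftEdge a).symm e)) = ω := by
        funext e; simp [shift]
      exact ⟨_, shift_mem_wiredConfigs.1 (h2.symm ▸ h), h2⟩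
    · rintro ⟨ω, h, rfl⟩
      exact shift_mem_wiredConfigs.2 h
  unfold rcMean wmean
  rw [himg, Finset.sum_image (fun _ _ _ _ h => shift_injective a h),
    Finset.sum_image (fun _ _ _ _ h => shift_injective a h)]
  simp only [hw]

theorem measurable_shift (a : Site d) : Measurable (shift a) :=
  measurable_pi_lambda _ fun _ => measurable_pi_apply _

theorem dependsOn_shift {β : Type*} {J : Finset (Edge d)} {f : EdgeConfig d → β}
    (hf : DependsOn f (J : Set (Edge d))) (a : Site d) :
    DependsOn (fun ω => f (shift a ω))
      ((J.map (shiftEdge a).toEmbedding : Finset (Edge d)) : Set (Edge d)) := by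
  intro ω ω' h
  refine hf fun e he => h _ ?_
  simpa using he

/-- The shift carries finite-volume wired measures to those of translated edge sets. Translated edge
sets still exhaust all edges, and the limit does not depend on the exhaustion. -/
theorem map_shift_rcInf {x : ℝ} (hx : 0 ≤ x) (a : Site d) :
    (rcInf d q x : Measure (EdgeConfig d)).map (shift a) = rcInf d q x := by
  have hP : IsProbabilityMeasure ((rcInf d q x : Measure (EdgeConfig d)).map (shift a)) :=
    Measure.isProbabilityMeasure_map (measurable_shift a).aemeasurable
  have : (⟨(rcInf d q x : Measure (EdgeConfig d)).map (shift a), hP⟩ :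
      ProbabilityMeasure (EdgeConfig d)) = rcInf d q x := by
    refine probabilityMeasure_ext_of_local fun J f hf => ?_
    change ∫ ω, f ω ∂((rcInf d q x : Measure (EdgeConfig d)).map (shift a)) = _
    rw [integral_map (measurable_shift a).aemeasurable
      (measurable_of_dependsOn hf).aestronglyMeasurable]
    have h1 := tendsto_rcMean (q := q) hx (dependsOn_shift hf a)
    have h2 : Tendsto (fun E : Finset (Edge d) => E.map (shiftEdge a).toEmbedding) atTop atTop := by
      refine tendsto_atTop_finset_of_monotone (fun E E' h => Finset.map_subset_map.2 h) fun e => ?_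
      exact ⟨{(shiftEdge a).symm e}, by simp⟩
    refine tendsto_nhds_unique (h1.comp h2) ((tendsto_rcMean (q := q) hx hf).congr fun E => ?_)
    exact (rcMean_shift x a E f).symm
  exact congrArg (fun P : ProbabilityMeasure (EdgeConfig d) => (P : Measure (EdgeConfig d))) this

theorem measurePreserving_shift {x : ℝ} (hx : 0 ≤ x) (a : Site d) :
    MeasurePreserving (shift a) (rcInf d q x : Measure (EdgeConfig d)) (rcInf d q x) :=
  ⟨measurable_shift a, map_shift_rcInf hx a⟩

end

/-! ### Local connection events and crossings of annuli -/

section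

variable {d q : ℕ}

/-! ### Geometry of the lattice -/

theorem norm1_add_le (x y : Site d) : norm1 (x + y) ≤ norm1 x + norm1 y := by
  unfold norm1
  rw [← Finset.sum_add_distrib]
  exact Finset.sum_le_sum fun i _ => abs_add_le _ _

theorem norm1_sub_comm (x y : Site d) : norm1 (x - y) = norm1 (y - x) := by
  simp [norm1, abs_sub_comm]

theorem abs_apply_le_norm1 (x : Site d) (i : Fin d) : |x i| ≤ norm1 x :=
  Finset.single_le_sum (f := fun i => |x i|) (fun _ _ => abs_nonneg _) (Finset.mem_univ i)

theorem norm1_le_add_one {x y : Site d} (h : (lattice d).Adj x y) : norm1 y ≤ norm1 x + 1 := by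
  have h1 : norm1 (x - y) = 1 := h
  have := norm1_add_le x (y - x)
  rw [norm1_sub_comm] at h1
  simp only [add_sub_cancel] at this
  omega

theorem mem_box {t : ℕ} {x : Site d} : x ∈ box d t ↔ ∀ i, |x i| ≤ t := by
  simp only [box, Finset.mem_Icc, Pi.le_def, abs_le]
  exact ⟨fun h i => ⟨h.1 i, h.2 i⟩, fun h => ⟨fun i => (h i).1, fun i => (h i).2⟩⟩

theorem card_box (d t : ℕ) : (box d t).card = (2 * t + 1) ^ d := by
  unfold box
  rw [Pi.card_Icc]
  simp only [Int.card_Icc, Finset.prod_const, Finset.card_univ, Fintype.card_fin]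
  congr 1
  omega

/-- The `ℓ¹` ball as a finite set. -/
noncomputable def ballFinset (d n : ℕ) : Finset (Site d) := (box d n).filter fun x => norm1 x ≤ n

theorem mem_ballFinset {n : ℕ} {x : Site d} : x ∈ ballFinset d n ↔ norm1 x ≤ n := by
  simp only [ballFinset, Finset.mem_filter, and_iff_right_iff_imp]
  exact fun h => mem_box.2 fun i => (abs_apply_le_norm1 x i).trans h

/-- The `ℓ¹` sphere as a finite set. -/
noncomputable def sphereFinset (d n : ℕ) : Finset (Site d) := (box d n).filter fun x => norm1 x = n

theorem mem_sphereFinset {n : ℕ} {x : Site d} : x ∈ sphereFinset d n ↔ norm1 x = n := by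
  simp only [sphereFinset, Finset.mem_filter, and_iff_right_iff_imp]
  exact fun h => mem_box.2 fun i => (abs_apply_le_norm1 x i).trans h.le

/-- A point of the sphere is determined by the sign of its first coordinate and by the other
coordinates, which lie in a box of dimension `d - 1`. The order `n^{d-1}` is the weight appearing in
`radiusLimsup`. -/
theorem card_sphereFinset_le (hd : 1 ≤ d) (n : ℕ) :
    (sphereFinset d n).card ≤ 2 * (2 * n + 1) ^ (d - 1) := by
  obtain ⟨k, rfl⟩ : ∃ k, d = k + 1 := ⟨d - 1, by omega⟩
  rw [Nat.add_sub_cancel, ← card_box k n]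
  have h2 : 2 * (box k n).card = ((Finset.univ : Finset Bool) ×ˢ box k n).card := by
    rw [Finset.card_product]; simp
  rw [h2]
  refine Finset.card_le_card_of_injOn (fun x => (decide (0 ≤ x 0), Fin.tail x)) ?_ ?_
  · intro x hx
    have hx' := (Finset.mem_filter.1 (Finset.mem_coe.1 hx)).1
    simp only [Finset.coe_product, Set.mem_prod, Finset.coe_univ, Set.mem_univ, true_and,
      Finset.mem_coe]
    exact mem_box.2 fun i => mem_box.1 hx' i.succ
  · intro x hx y hy hxy
    have hx' := mem_sphereFinset.1 (Finset.mem_coe.1 hx)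
    have hy' := mem_sphereFinset.1 (Finset.mem_coe.1 hy)
    simp only [Prod.mk.injEq, decide_eq_decide] at hxy
    obtain ⟨h0, ht⟩ := hxy
    have htail : ∀ i : Fin k, x i.succ = y i.succ := fun i => congrFun ht i
    have habs : |x 0| = |y 0| := by
      unfold norm1 at hx' hy'
      rw [Fin.sum_univ_succ] at hx' hy'
      simp only [htail] at hx'
      omega
    have hx0 : x 0 = y 0 := by
      rcases abs_eq_abs.1 habs with h | h
      · exact h
      · omega
    funext i
    exact Fin.cases hx0 htail i

open Classical in
/-- The edges with at least one endpoint in `Λ`. -/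
noncomputable def touchEdges (Λ : Finset (Site d)) : Finset (Edge d) :=
  (innerEdges (Λ.biUnion fun x => Finset.Icc (x - 1) (x + 1))).filter
    fun e => ∃ x ∈ (e : Sym2 (Site d)), x ∈ Λ

theorem mem_Icc_of_adj {x y : Site d} (h : (lattice d).Adj x y) :
    y ∈ Finset.Icc (x - 1) (x + 1) := by
  have h1 : norm1 (x - y) = 1 := h
  have : ∀ i, |x i - y i| ≤ 1 := fun i => (abs_apply_le_norm1 (x - y) i).trans h1.le
  simp only [Finset.mem_Icc, Pi.le_def]
  exact ⟨fun i => by have := abs_le.1 (this i); simp; omega,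
    fun i => by have := abs_le.1 (this i); simp; omega⟩

theorem mem_touchEdges {Λ : Finset (Site d)} {e : Edge d} :
    e ∈ touchEdges Λ ↔ ∃ x ∈ (e : Sym2 (Site d)), x ∈ Λ := by
  classical
  simp only [touchEdges, Finset.mem_filter, and_iff_right_iff_imp]
  rintro ⟨x, hx, hxΛ⟩
  obtain ⟨e, he⟩ := e
  obtain ⟨y, rfl⟩ := Sym2.mem_iff_exists.1 hx
  have hadj : (lattice d).Adj x y := he
  simp only [innerEdges, Finset.mem_subtype, Finset.mk_mem_sym2_iff, Finset.mem_biUnion]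
  exact ⟨⟨x, hxΛ, by simp⟩, ⟨x, hxΛ, mem_Icc_of_adj hadj⟩⟩

theorem mk_mem_touchEdges {Λ : Finset (Site d)} {x y : Site d} (h : (lattice d).Adj x y) :
    (⟨s(x, y), h⟩ : Edge d) ∈ touchEdges Λ ↔ x ∈ Λ ∨ y ∈ Λ := by
  rw [mem_touchEdges]
  simp

theorem touchEdges_mono {Λ Λ' : Finset (Site d)} (h : Λ ⊆ Λ') : touchEdges Λ ⊆ touchEdges Λ' :=
  fun e he => by
    obtain ⟨x, hx, hx'⟩ := mem_touchEdges.1 he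
    exact mem_touchEdges.2 ⟨x, hx, h hx'⟩

/-! ### Restricting a configuration to a set of edges -/

open Classical in
/-- The configuration `ω` with the edges outside `S` closed. -/
noncomputable def cut (S : Finset (Edge d)) (ω : EdgeConfig d) : EdgeConfig d :=
  fun e => if e ∈ S then ω e else false

theorem cut_le (S : Finset (Edge d)) (ω : EdgeConfig d) : cut S ω ≤ ω := fun e => by
  by_cases h : e ∈ S <;> simp [cut, h]

theorem cut_mono (S : Finset (Edge d)) : Monotone (cut S) := fun ω ω' h e => by
  by_cases he : e ∈ S
  · simpa [cut, he] using h e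
  · simp [cut, he]

theorem cut_mono_left {S S' : Finset (Edge d)} (h : S ⊆ S') (ω : EdgeConfig d) :
    cut S ω ≤ cut S' ω := fun e => by
  by_cases he : e ∈ S
  · simp [cut, he, h he]
  · simp [cut, he]

theorem dependsOn_cut {β : Type*} (S : Finset (Edge d)) (f : EdgeConfig d → β) :
    DependsOn (fun ω => f (cut S ω)) (S : Set (Edge d)) := by
  intro ω ω' h
  have : cut S ω = cut S ω' := by
    funext e
    by_cases he : e ∈ S
    · simpa [cut, he] using h e he
    · simp [cut, he]
  simp only [this]

theorem openGraph_cut_adj {S : Finset (Edge d)} {ω : EdgeConfig d} {x y : Site d} :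
    (openGraph (cut S ω)).Adj x y ↔
      ∃ h : (lattice d).Adj x y, (⟨s(x, y), h⟩ : Edge d) ∈ S ∧ ω ⟨s(x, y), h⟩ = true := by
  rw [openGraph_adj]
  refine exists_congr fun h => ?_
  by_cases he : (⟨s(x, y), h⟩ : Edge d) ∈ S <;> simp [cut, he]

theorem reachable_mono {ω ω' : EdgeConfig d} (h : ω ≤ ω') {x y : Site d}
    (hxy : (openGraph ω).Reachable x y) : (openGraph ω').Reachable x y :=
  hxy.mono (openGraph_mono h)

theorem cut_touchEdges_adj {Λ : Finset (Site d)} {ω : EdgeConfig d} {u v : Site d} (hu : u ∈ Λ)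
    (h : (openGraph ω).Adj u v) : (openGraph (cut (touchEdges Λ) ω)).Adj u v := by
  obtain ⟨hl, ho⟩ := openGraph_adj.1 h
  exact openGraph_cut_adj.2 ⟨hl, (mk_mem_touchEdges hl).2 (Or.inl hu), ho⟩

/-- If the cluster of `x` in the configuration restricted to the edges touching `Λ` stays in `Λ`,
then it is the whole cluster of `x`. -/
theorem reachable_cut_of_forall_mem {Λ : Finset (Site d)} {ω : EdgeConfig d} {x y : Site d}
    (h : ∀ z, (openGraph (cut (touchEdges Λ) ω)).Reachable x z → z ∈ Λ)
    (hxy : (openGraph ω).Reachable x y) : (openGraph (cut (touchEdges Λ) ω)).Reachable x y :=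
  mem_of_reachable (W := {z | (openGraph (cut (touchEdges Λ) ω)).Reachable x z})
    (fun u _ hu huv => SimpleGraph.Reachable.trans hu (cut_touchEdges_adj (h u hu) huv).reachable)
    (SimpleGraph.Reachable.refl x) hxy

/-- This makes leaving `Λ` a local event: a cluster that stays in `Λ` when only the edges touching
`Λ` are used is already the whole cluster. -/
theorem exists_exit_iff {Λ : Finset (Site d)} {ω : EdgeConfig d} {x : Site d} :
    (∃ y, y ∉ Λ ∧ (openGraph ω).Reachable x y) ↔
      ∃ y, y ∉ Λ ∧ (openGraph (cut (touchEdges Λ) ω)).Reachable x y := by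
  refine ⟨?_, fun ⟨y, hy, h⟩ => ⟨y, hy, reachable_mono (cut_le _ _) h⟩⟩
  rintro ⟨y, hy, h⟩
  by_contra! hcon
  exact hy (not_imp_not.1 (hcon y) (reachable_cut_of_forall_mem
    (fun z hz => not_imp_not.1 (hcon z) hz) h))

/-- The event that `x` is joined to a site outside `Λ`. -/
def exitEvent (Λ : Finset (Site d)) (x : Site d) : Set (EdgeConfig d) :=
  {ω | ∃ y, y ∉ Λ ∧ (openGraph ω).Reachable x y}

theorem isUpperSet_exitEvent (Λ : Finset (Site d)) (x : Site d) : IsUpperSet (exitEvent Λ x) :=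
  fun _ _ h ⟨y, hy, hr⟩ => ⟨y, hy, reachable_mono h hr⟩

theorem dependsOn_exitEvent (Λ : Finset (Site d)) (x : Site d) :
    DependsOn (· ∈ exitEvent Λ x) (touchEdges Λ : Set (Edge d)) := by
  have := dependsOn_cut (touchEdges Λ) (fun ω => ω ∈ exitEvent Λ x)
  convert this using 2 with ω
  exact exists_exit_iff

/-! ### Crossings of annuli -/

/-- The event that the cluster of the origin leaves the `ℓ¹` ball of radius `n`. -/
def farEvent (d n : ℕ) : Set (EdgeConfig d) := exitEvent (ballFinset d n) 0

theorem mem_farEvent {n : ℕ} {ω : EdgeConfig d} :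
    ω ∈ farEvent d n ↔ ∃ y, (n : ℤ) < norm1 y ∧ (openGraph ω).Reachable 0 y := by
  simp only [farEvent, exitEvent, Set.mem_ofPred_eq, mem_ballFinset, not_le]

/-- A path that leaves the ball enters its outer boundary at the first exit. -/
theorem farEvent_eq (d n : ℕ) :
    {ω : EdgeConfig d | ∃ y ∈ outerBoundary (ball1 d n), y ∈ cluster ω 0} = farEvent d n := by
  ext ω
  rw [mem_farEvent]
  simp only [outerBoundary, ball1, cluster, Set.mem_ofPred_eq, not_le]
  constructor
  · rintro ⟨y, ⟨hy, -⟩, hr⟩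
    exact ⟨y, hy, hr⟩
  · rintro ⟨y, hy, hr⟩
    by_contra! hcon
    have h := mem_of_reachable (W := {z | norm1 z ≤ n ∧ (openGraph ω).Reachable 0 z})
      (fun u v hu huv => ?_) ⟨by simp [norm1], SimpleGraph.Reachable.refl _⟩ hr
    · exact absurd h.1 (not_le.2 hy)
    · have hrv := SimpleGraph.Reachable.trans hu.2 huv.reachable
      refine ⟨?_, hrv⟩
      by_contra! hv
      exact hcon v ⟨hv, u, hu.1, (openGraph_adj.1 huv).1⟩ hrv

open Classical in
/-- The edges of the annulus between two radii. -/
noncomputable def annulusEdges (d m m' : ℕ) : Finset (Edge d) :=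
  (touchEdges (ballFinset d m')).filter fun e =>
    (∀ x ∈ (e : Sym2 (Site d)), (m : ℤ) ≤ norm1 x) ∧ ∃ x ∈ (e : Sym2 (Site d)), norm1 x < m'

theorem mem_annulusEdges {m m' : ℕ} {e : Edge d} : e ∈ annulusEdges d m m' ↔
    (∀ x ∈ (e : Sym2 (Site d)), (m : ℤ) ≤ norm1 x) ∧
      ∃ x ∈ (e : Sym2 (Site d)), norm1 x < m' := by
  classical
  simp only [annulusEdges, Finset.mem_filter, and_iff_right_iff_imp]
  rintro ⟨-, x, hx, hx'⟩
  exact mem_touchEdges.2 ⟨x, hx, mem_ballFinset.2 hx'.le⟩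

/-- The event that the annulus between two radii is crossed. -/
def crossEvent (d m m' : ℕ) : Set (EdgeConfig d) :=
  {ω | ∃ x y, norm1 x = m ∧ (m' : ℤ) ≤ norm1 y ∧
    (openGraph (cut (annulusEdges d m m') ω)).Reachable x y}

theorem isUpperSet_crossEvent (m m' : ℕ) : IsUpperSet (crossEvent d m m') :=
  fun _ _ h ⟨x, y, hx, hy, hr⟩ => ⟨x, y, hx, hy, reachable_mono (cut_mono _ h) hr⟩

theorem dependsOn_crossEvent (m m' : ℕ) :
    DependsOn (· ∈ crossEvent d m m') (annulusEdges d m m' : Set (Edge d)) :=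
  dependsOn_cut (annulusEdges d m m') fun ω => ∃ x y, norm1 x = m ∧ (m' : ℤ) ≤ norm1 y ∧
    (openGraph ω).Reachable x y

theorem disjoint_annulusEdges {m m' k k' : ℕ} (h : m' ≤ k) :
    Disjoint (annulusEdges d m m') (annulusEdges d k k') := by
  rw [Finset.disjoint_left]
  intro e he he'
  obtain ⟨x, hx, hx'⟩ := (mem_annulusEdges.1 he).2
  have := (mem_annulusEdges.1 he').1 x hx
  omega

/-- Without a crossing, the sites of norm less than `m`, together with the sites reached inside the
annulus from the sphere of radius `m`, form a set closed under open edges. It contains the origin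
and has no site of norm `m'` or more. This invariant set replaces the choice of a last visit to the
inner sphere. -/
theorem farEvent_subset_crossEvent {m m' n : ℕ} (hm : m < m') (hn : m' ≤ n) :
    farEvent d n ⊆ crossEvent d m m' := by
  intro ω hω
  obtain ⟨y, hy, hr⟩ := mem_farEvent.1 hω
  by_contra hcon
  set ω' := cut (annulusEdges d m m') ω
  have hlt : ∀ x z, norm1 x = m → (openGraph ω').Reachable x z → norm1 z < m' := by
    intro x z hx hz
    by_contra! h
    exact hcon ⟨x, z, hx, h, hz⟩
  have hW := mem_of_reachable
    (W := {z | norm1 z < m} ∪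
      {z | (m : ℤ) ≤ norm1 z ∧ ∃ x, norm1 x = m ∧ (openGraph ω').Reachable x z})
    (ω := ω) ?_ ?_ hr
  · rcases hW with h | ⟨-, x, hx, hz⟩
    · have : norm1 y < m := h
      omega
    · have := hlt x y hx hz
      omega
  · rintro u v hu huv
    obtain ⟨hl, ho⟩ := openGraph_adj.1 huv
    have h1 := norm1_le_add_one hl
    have h2 := norm1_le_add_one hl.symm
    by_cases hv : norm1 v < m
    · exact Or.inl hv
    right
    refine ⟨not_lt.1 hv, ?_⟩
    rcases hu with hu | ⟨hum, x, hx, hxu⟩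
    · have hu' : norm1 u < m := hu
      exact ⟨v, by omega, SimpleGraph.Reachable.refl _⟩
    · refine ⟨x, hx, hxu.trans (SimpleGraph.Adj.reachable ?_)⟩
      refine openGraph_cut_adj.2 ⟨hl, mem_annulusEdges.2 ⟨?_, u, by simp, hlt x u hx hxu⟩, ho⟩
      intro z hz
      rcases Sym2.mem_iff.1 hz with rfl | rfl
      · exact hum
      · exact not_lt.1 hv
  · have h0 : norm1 (0 : Site d) = 0 := by simp [norm1]
    rcases Nat.eq_zero_or_pos m with rfl | hm0
    · exact Or.inr ⟨by simp [h0], 0, by simp [h0], SimpleGraph.Reachable.refl _⟩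
    · left
      change norm1 (0 : Site d) < m
      rw [h0]; exact_mod_cast hm0

variable (d q) in
/-- The probability that the cluster of the origin has radius larger than `n`. -/
noncomputable def radProb (x : ℝ) (n : ℕ) : ℝ :=
  (rcInf d q x : Measure (EdgeConfig d)).real (farEvent d n)

theorem radProb_nonneg (x : ℝ) (n : ℕ) : 0 ≤ radProb d q x n := measureReal_nonneg

theorem radProb_le_one (x : ℝ) (n : ℕ) : radProb d q x n ≤ 1 := measureReal_le_one

theorem measurableSet_exitEvent (Λ : Finset (Site d)) (x : Site d) :
    MeasurableSet (exitEvent Λ x) := measurableSet_of_dependsOn (dependsOn_exitEvent Λ x)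

variable [NeZero q]

/-- A union bound over the inner sphere: the crossing starts at some `z` of norm `m`, and then the
cluster of `z` extends further than `r` from `z`. -/
theorem crossEvent_prob_le (hd : 1 ≤ d) {x : ℝ} (hx : 0 ≤ x) {m m' r : ℕ} (hr : m + r < m') :
    (rcInf d q x : Measure (EdgeConfig d)).real (crossEvent d m m') ≤
      2 * (2 * m + 1) ^ (d - 1) * radProb d q x r := by
  have hsub : crossEvent d m m' ⊆ ⋃ z ∈ sphereFinset d m, shift z ⁻¹' farEvent d r := by
    rintro ω ⟨u, v, hu, hv, huv⟩
    simp only [Set.mem_iUnion, Set.mem_preimage, mem_farEvent]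
    refine ⟨u, mem_sphereFinset.2 hu, v - u, ?_, ?_⟩
    · have := norm1_add_le u (v - u)
      simp only [add_sub_cancel] at this
      omega
    · rw [reachable_shift]
      simpa using reachable_mono (cut_le _ _) huv
  calc _ ≤ (rcInf d q x : Measure (EdgeConfig d)).real
        (⋃ z ∈ sphereFinset d m, shift z ⁻¹' farEvent d r) := measureReal_mono hsub
          (measure_ne_top _ _)
    _ ≤ ∑ z ∈ sphereFinset d m,
        (rcInf d q x : Measure (EdgeConfig d)).real (shift z ⁻¹' farEvent d r) :=
        measureReal_biUnion_finset_le _ _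
    _ = ∑ z ∈ sphereFinset d m, radProb d q x r := by
        refine Finset.sum_congr rfl fun z _ => ?_
        rw [radProb, measureReal_def, measureReal_def,
          (measurePreserving_shift hx z).measure_preimage (s := farEvent d r)
            (measurableSet_exitEvent _ _).nullMeasurableSet]
    _ = (sphereFinset d m).card * radProb d q x r := by simp
    _ ≤ _ := by
        refine mul_le_mul_of_nonneg_right ?_ (radProb_nonneg _ _)
        exact_mod_cast card_sphereFinset_le hd m

/-- If `K` disjoint annuli inside the ball of radius `n` are each crossed with probability at most
`1/2`, the radius tail gains a factor exponential in `K` when the odds are multiplied by `θ`. -/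
theorem radProb_scale_le {x θ : ℝ} (hx : 0 < x) (hθ : 0 < θ) (hθ1 : θ ≤ 1) {K n : ℕ} {m : ℕ → ℕ}
    (hm : StrictMono m) (hmn : m K ≤ n)
    (hcross : ∀ k < K, (rcInf d q x : Measure (EdgeConfig d)).real
      (crossEvent d (m k) (m (k + 1))) ≤ 1 / 2) :
    radProb d q (θ * x) n ≤ radProb d q x n * Real.exp (-((1 - θ) * (K / 2))) := by
  refine (rcInf_scale_le hx hθ hθ1 (I := Finset.range K)
    (B := fun k => crossEvent d (m k) (m (k + 1)))
    (S := fun k => annulusEdges d (m k) (m (k + 1))) ?_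
    (fun k _ => dependsOn_crossEvent _ _) (fun k _ => isUpperSet_crossEvent _ _)
    (dependsOn_exitEvent _ _) (isUpperSet_exitEvent _ _) ?_).trans ?_
  · intro k _ l _ hkl
    rcases lt_or_gt_of_ne hkl with h | h
    · exact disjoint_annulusEdges (hm.monotone h)
    · exact (disjoint_annulusEdges (hm.monotone h)).symm
  · intro k hk
    exact farEvent_subset_crossEvent (hm (Nat.lt_succ_self k))
      ((hm.monotone (Finset.mem_range.1 hk)).trans hmn)
  · refine mul_le_mul_of_nonneg_left (Real.exp_le_exp.2 (neg_le_neg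
      (mul_le_mul_of_nonneg_left ?_ (by linarith)))) measureReal_nonneg
    calc (K : ℝ) / 2 = ∑ k ∈ Finset.range K, (1 / 2 : ℝ) := by simp; ring
      _ ≤ _ := Finset.sum_le_sum fun k hk => by linarith [hcross k (Finset.mem_range.1 hk)]

theorem radProb_mono_left {x y : ℝ} (hx : 0 ≤ x) (hxy : x ≤ y) (n : ℕ) :
    radProb d q x n ≤ radProb d q y n := by
  have hmeas := measurableSet_exitEvent (ballFinset d n) 0
  have := integral_rcInf_mono (q := q) hx hxy
    (dependsOn_indicator (dependsOn_exitEvent (ballFinset d n) 0))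
    (monotone_indicator (isUpperSet_exitEvent _ _))
  rwa [integral_indicator_one hmeas, integral_indicator_one hmeas] at this

end

section

variable {d q : ℕ}

/-! ### Fast decay of the radius -/

theorem exists_bound_of_radiusLimsup {x : ℝ} (h : radiusLimsup d (x / (1 + x)) q < ∞) :
    ∃ C : ℝ, 0 ≤ C ∧ ∀ n : ℕ, radProb d q x n * (n : ℝ) ^ (d - 1) ≤ C := by
  obtain ⟨c, hc, hc'⟩ := ENNReal.lt_iff_exists_nnreal_btwn.1 h
  obtain ⟨n₀, hn₀⟩ := eventually_atTop.1 (eventually_lt_of_limsup_lt hc)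
  refine ⟨max c ((n₀ : ℝ) ^ (d - 1)), le_max_of_le_left c.2, fun n => ?_⟩
  rcases le_total n₀ n with hn | hn
  · refine le_max_of_le_left ?_
    have h1 := hn₀ n hn
    rw [farEvent_eq] at h1
    have h2 := ENNReal.toReal_mono (by simp) h1.le
    rw [ENNReal.toReal_mul, ENNReal.toReal_pow] at h2
    simp only [ENNReal.toReal_natCast, ENNReal.coe_toReal] at h2
    rw [mul_comm]
    exact h2
  · refine le_max_of_le_right ?_
    calc radProb d q x n * (n : ℝ) ^ (d - 1) ≤ 1 * (n₀ : ℝ) ^ (d - 1) :=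
          mul_le_mul (radProb_le_one x n) (by gcongr) (by positivity) zero_le_one
      _ = _ := one_mul _

variable [NeZero q]

/-- At odds `x` the tail `O(n^{1-d})` balances the size of the spheres, so annuli with a large
enough fixed ratio `L` are crossed with probability at most 1/2. The number of such annuli below
radius `L^j` is of order `j`, and lowering the odds turns each of them into a constant factor `a >
1`. The tail thus gains a small power beyond `d - 1`. -/
theorem exists_geometric_gain (hd : 2 ≤ d) {x θ C : ℝ} (hx : 0 < x) (hθ : 0 < θ) (hθ1 : θ < 1)
    (hC0 : 0 ≤ C) (hC : ∀ n : ℕ, radProb d q x n * (n : ℝ) ^ (d - 1) ≤ C) :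
    ∃ (L : ℕ) (a C' : ℝ), 4 ≤ L ∧ 1 < a ∧ 0 ≤ C' ∧
      ∀ j : ℕ, radProb d q (θ * x) (L ^ j) * ((L : ℝ) ^ (d - 1) * a) ^ j ≤ C' := by
  -- The crossing probability will be bounded by `2 * C * (6 / L)`, which is at most 1/2 for this
  -- `L`.
  obtain ⟨L₀, hL₀⟩ := exists_nat_ge (24 * C)
  set L := max 4 L₀ with hL
  have hL4 : 4 ≤ L := le_max_left _ _
  have hLC : 24 * C ≤ L := hL₀.trans (by exact_mod_cast le_max_right _ _)
  have hLR : (4 : ℝ) ≤ L := by exact_mod_cast hL4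
  set a := Real.exp ((1 - θ) / 2) with ha
  have ha1 : 1 < a := Real.one_lt_exp_iff.2 (by linarith)
  have hD : d - 1 ≠ 0 := by omega
  refine ⟨L, a, C * a + 1, hL4, ha1, by positivity, fun j => ?_⟩
  rcases Nat.eq_zero_or_pos j with rfl | hj
  · simp only [pow_zero, mul_one]
    have := radProb_le_one (d := d) (q := q) (θ * x) 1
    have : 0 ≤ C * a := by positivity
    linarith
  obtain ⟨K, rfl⟩ : ∃ K, j = K + 1 := ⟨j - 1, by omega⟩
  have hcross : ∀ k < K, (rcInf d q x : Measure (EdgeConfig d)).real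
      (crossEvent d (L ^ (k + 1)) (L ^ (k + 1 + 1))) ≤ 1 / 2 := by
    intro k _
    set m := L ^ (k + 1) with hm
    have hm1 : 1 ≤ m := Nat.one_le_pow _ _ (by omega)
    have hm' : L ^ (k + 1 + 1) = L * m := by rw [hm, pow_succ L (k + 1), mul_comm]
    have h4m : 4 * m ≤ L * m := Nat.mul_le_mul_right _ hL4
    -- The largest radius with `m + r < L * m`; since `L ≥ 4` it is at least `L * m / 2`.
    set r := L * m - m - 1 with hr
    have hmr : m + r < L * m := by omega
    rw [hm']
    refine (crossEvent_prob_le (by omega) hx.le hmr).trans ?_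
    have hrR : (L : ℝ) * m / 2 ≤ r := by
      have h : L * m ≤ 2 * r := by omega
      have : ((L * m : ℕ) : ℝ) ≤ ((2 * r : ℕ) : ℝ) := by exact_mod_cast h
      push_cast at this
      linarith
    have hmR : (1 : ℝ) ≤ m := by exact_mod_cast hm1
    have hr0 : (0 : ℝ) < r := lt_of_lt_of_le (by positivity) hrR
    have hrad : radProb d q x r ≤ C / (r : ℝ) ^ (d - 1) := by
      rw [le_div_iff₀ (by positivity)]; exact hC r
    have hratio : (2 * (m : ℝ) + 1) / r ≤ 6 / L := by
      rw [div_le_div_iff₀ hr0 (by positivity)]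
      nlinarith
    have hratio1 : (2 * (m : ℝ) + 1) / r ≤ 1 → ((2 * (m : ℝ) + 1) / r) ^ (d - 1) ≤
        (2 * (m : ℝ) + 1) / r := fun h => pow_le_of_le_one (by positivity) h hD
    have hle1 : (2 * (m : ℝ) + 1) / r ≤ 1 := by
      rw [div_le_one hr0]
      have hm4 : 4 ≤ m := hL4.trans (Nat.le_self_pow (by omega) L)
      have h : 2 * m + 1 ≤ r := by omega
      exact_mod_cast h
    calc 2 * (2 * (m : ℝ) + 1) ^ (d - 1) * radProb d q x r
        ≤ 2 * (2 * (m : ℝ) + 1) ^ (d - 1) * (C / (r : ℝ) ^ (d - 1)) := by gcongr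
      _ = 2 * C * ((2 * (m : ℝ) + 1) / r) ^ (d - 1) := by rw [div_pow]; ring
      _ ≤ 2 * C * (6 / L) := by gcongr; exact (hratio1 hle1).trans hratio
      _ ≤ 1 / 2 := by
          rw [← mul_div_assoc, div_le_iff₀ (by positivity)]
          linarith
  have h1 := radProb_scale_le hx hθ hθ1.le (K := K) (n := L ^ (K + 1)) (m := fun k => L ^ (k + 1))
    (fun k l hkl => Nat.pow_lt_pow_right (by omega) (by omega)) le_rfl hcross
  have h2 := hC (L ^ (K + 1))
  have he : Real.exp (-((1 - θ) * (K / 2))) * a ^ K = 1 := by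
    rw [ha, ← Real.exp_nat_mul, ← Real.exp_add, Real.exp_eq_one_iff]
    ring
  calc radProb d q (θ * x) (L ^ (K + 1)) * ((L : ℝ) ^ (d - 1) * a) ^ (K + 1)
      ≤ (radProb d q x (L ^ (K + 1)) * Real.exp (-((1 - θ) * (K / 2)))) *
          ((L : ℝ) ^ (d - 1) * a) ^ (K + 1) := by gcongr
    _ = (radProb d q x (L ^ (K + 1)) * ((L ^ (K + 1) : ℕ) : ℝ) ^ (d - 1)) *
          (Real.exp (-((1 - θ) * (K / 2))) * a ^ K) * a := by
        push_cast
        rw [mul_pow, ← pow_mul, ← pow_mul, mul_comm (d - 1), pow_succ a K]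
        ring
    _ ≤ C * 1 * a := by rw [he]; gcongr
    _ ≤ C * a + 1 := by linarith

theorem exists_pow_mul_exp_le {c : ℝ} (hc : 0 < c) (P : ℕ) :
    ∃ F : ℝ, 0 ≤ F ∧ ∀ y : ℝ, 0 ≤ y → y ^ P * Real.exp (-(c * y)) ≤ F := by
  refine ⟨P.factorial / c ^ P, by positivity, fun y hy => ?_⟩
  have h := Real.pow_div_factorial_le_exp (c * y) (by positivity) P
  rw [Real.exp_neg, ← div_eq_mul_inv, div_le_div_iff₀ (Real.exp_pos _) (by positivity)]
  rw [div_le_iff₀ (by positivity), mul_pow] at h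
  linarith

/-- The decay exponent now exceeds `d - 1`, so much thinner annuli are still crossed with small
probability. Between radii `L^j` and `L^{j+1}` there is room for `L^l` annuli of width `L^i + 1`,
where `l = j / M` and `i = j - l`. Their number is a positive power of the radius, so a further
decrease of the odds gives a stretched exponential, which beats every power. -/
theorem exists_fast_decay_step {x θ a C : ℝ} {L : ℕ} (hd : 2 ≤ d) (hx : 0 < x) (hθ : 0 < θ)
    (hθ1 : θ < 1) (hL : 4 ≤ L) (ha : 1 < a) (hC0 : 0 ≤ C)
    (hC : ∀ j : ℕ, radProb d q x (L ^ j) * ((L : ℝ) ^ (d - 1) * a) ^ j ≤ C) (N : ℕ) :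
    ∃ C' : ℝ, 0 ≤ C' ∧ ∀ j : ℕ, radProb d q (θ * x) (L ^ j) * ((L : ℝ) ^ N) ^ j ≤ C' := by
  -- The gain `a^j` is split into two factors `b^j`: one pays for making the annuli thinner, the
  -- other makes the crossing probability small.
  set b := Real.sqrt a with hb
  have hb1 : 1 < b := by rw [hb, Real.lt_sqrt zero_le_one]; simpa using ha
  have hbb : a = b * b := (Real.mul_self_sqrt (by linarith)).symm
  have hLR : (4 : ℝ) ≤ L := by exact_mod_cast hL
  have ha0 : 0 < a := by linarith
  have hb0 : 0 < b := by linarith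
  -- The cost of the thinning is `(L^{d-1} a)^l` with `l = j / M`, and this choice keeps it below
  -- `b^j`. The successor makes `M` a legitimate divisor.
  obtain ⟨M₀, hM₀⟩ := pow_unbounded_of_one_lt ((L : ℝ) ^ (d - 1) * a) hb1
  set M := M₀ + 1 with hM
  have hMb : (L : ℝ) ^ (d - 1) * a ≤ b ^ M :=
    hM₀.le.trans (pow_le_pow_right₀ hb1.le (Nat.le_succ _))
  set C₃ : ℝ := 2 * (3 * L) ^ (d - 1) * C with hC₃
  -- From scale `J` on, the bound `C₃ / b^j` for the crossing probabilities is at most 1/2.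
  obtain ⟨J, hJ⟩ := pow_unbounded_of_one_lt (2 * C₃) hb1
  set c : ℝ := (1 - θ) / 2 with hc
  have hc0 : 0 < c := by rw [hc]; linarith
  obtain ⟨F, hF0, hF⟩ := exists_pow_mul_exp_le hc0 (N * M)
  have main : ∀ j, J ≤ j → radProb d q (θ * x) (L ^ (j + 1)) ≤
      Real.exp (-(c * (L : ℝ) ^ (j / M))) := by
    intro j hj
    set l := j / M with hl
    have hlj : l ≤ j := Nat.div_le_self _ _
    obtain ⟨i, hi⟩ : ∃ i, j = i + l := ⟨j - l, by omega⟩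
    have hpow : L ^ j = L ^ i * L ^ l := by rw [hi, pow_add]
    have hLl : L ^ l ≤ L ^ j := Nat.pow_le_pow_right (by omega) hlj
    have hLi : 1 ≤ L ^ i := Nat.one_le_pow _ _ (by omega)
    have hmax : ∀ k ≤ L ^ l, L ^ j + k * (L ^ i + 1) ≤ L ^ (j + 1) := by
      intro k hk
      calc L ^ j + k * (L ^ i + 1) ≤ L ^ j + L ^ l * (L ^ i + 1) := by gcongr
        _ = L ^ j + L ^ j + L ^ l := by rw [hpow]; ring
        _ ≤ 4 * L ^ j := by omega
        _ ≤ L * L ^ j := Nat.mul_le_mul_right _ hL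
        _ = L ^ (j + 1) := by rw [pow_succ]; ring
    have hcross : ∀ k < L ^ l, (rcInf d q x : Measure (EdgeConfig d)).real
        (crossEvent d (L ^ j + k * (L ^ i + 1)) (L ^ j + (k + 1) * (L ^ i + 1))) ≤ 1 / 2 := by
      intro k hk
      refine (crossEvent_prob_le (by omega) hx.le (r := L ^ i) ?_).trans ?_
      · ring_nf; omega
      have h1 : ((L ^ j + k * (L ^ i + 1) : ℕ) : ℝ) ≤ (L : ℝ) ^ (j + 1) := by
        exact_mod_cast hmax k hk.le
      have h2 : (1 : ℝ) ≤ (L : ℝ) ^ (j + 1) := one_le_pow₀ (by linarith)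
      have h3 := hC i
      have hpos : (0 : ℝ) < ((L : ℝ) ^ (d - 1) * a) ^ i := by positivity
      rw [← le_div_iff₀ hpos] at h3
      have h4 : (((L : ℝ) ^ (d - 1)) * a) ^ l ≤ b ^ j := by
        calc (((L : ℝ) ^ (d - 1)) * a) ^ l ≤ (b ^ M) ^ l := by gcongr
          _ = b ^ (M * l) := by rw [← pow_mul]
          _ ≤ b ^ j := pow_le_pow_right₀ hb1.le (Nat.mul_div_le j M)
      calc 2 * (2 * ((L ^ j + k * (L ^ i + 1) : ℕ) : ℝ) + 1) ^ (d - 1) * radProb d q x (L ^ i)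
          ≤ 2 * (3 * (L : ℝ) ^ (j + 1)) ^ (d - 1) * (C / ((L : ℝ) ^ (d - 1) * a) ^ i) := by
            gcongr
            · exact radProb_nonneg _ _
            · linarith
        _ = C₃ * ((((L : ℝ) ^ (d - 1)) * a) ^ l / (b ^ j * b ^ j)) := by
            rw [← mul_pow b b, ← hbb, hC₃, hi]
            field_simp
            ring
        _ ≤ C₃ * (b ^ j / (b ^ j * b ^ j)) := by gcongr
        _ = C₃ / b ^ j := by field_simp
        _ ≤ 1 / 2 := by
            rw [div_le_div_iff₀ (by positivity) (by norm_num)]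
            have := pow_le_pow_right₀ hb1.le hj
            linarith
    have h1 := radProb_scale_le hx hθ hθ1.le (K := L ^ l) (n := L ^ (j + 1))
      (m := fun k => L ^ j + k * (L ^ i + 1))
      (fun k k' hkk => by
        have := Nat.mul_lt_mul_of_pos_right hkk (show 0 < L ^ i + 1 by omega)
        simp only; omega)
      (hmax _ le_rfl) hcross
    refine h1.trans ?_
    calc _ ≤ 1 * Real.exp (-((1 - θ) * (((L ^ l : ℕ) : ℝ) / 2))) := by
          gcongr; exact radProb_le_one _ _
      _ = _ := by rw [one_mul, hc]; push_cast; congr 2; ring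
  refine ⟨((L : ℝ) ^ N) ^ J + (L : ℝ) ^ (N * M) * F, by positivity, fun j => ?_⟩
  have hLN : (1 : ℝ) ≤ (L : ℝ) ^ N := one_le_pow₀ (by linarith)
  rcases le_or_gt j J with hj | hj
  · calc radProb d q (θ * x) (L ^ j) * ((L : ℝ) ^ N) ^ j ≤ 1 * ((L : ℝ) ^ N) ^ J :=
          mul_le_mul (radProb_le_one _ _) (pow_le_pow_right₀ hLN hj) (by positivity) zero_le_one
      _ ≤ _ := by
        have : 0 ≤ (L : ℝ) ^ (N * M) * F := by positivity
        linarith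
  · obtain ⟨i, rfl⟩ : ∃ i, j = i + 1 := ⟨j - 1, by omega⟩
    set l := i / M with hl
    -- This bounds the wanted power of the radius by a power of `L^l`, the quantity in the
    -- exponential.
    have hle : i + 1 ≤ M * (l + 1) := Nat.lt_mul_div_succ i (by omega)
    have h1 := main i (by omega)
    have h2 := hF ((L : ℝ) ^ l) (by positivity)
    calc radProb d q (θ * x) (L ^ (i + 1)) * ((L : ℝ) ^ N) ^ (i + 1)
        ≤ Real.exp (-(c * (L : ℝ) ^ l)) * ((L : ℝ) ^ N) ^ (M * (l + 1)) :=
          mul_le_mul h1 (pow_le_pow_right₀ hLN hle) (by positivity) (Real.exp_pos _).le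
      _ = (L : ℝ) ^ (N * M) * (((L : ℝ) ^ l) ^ (N * M) * Real.exp (-(c * (L : ℝ) ^ l))) := by
          rw [← pow_mul, ← pow_mul]
          have : (L : ℝ) ^ (N * (M * (l + 1))) = (L : ℝ) ^ (N * M) * (L : ℝ) ^ (l * (N * M)) := by
            rw [← pow_add]; congr 1; ring
          rw [this]; ring
      _ ≤ (L : ℝ) ^ (N * M) * F := by gcongr
      _ ≤ _ := by
        have : 0 ≤ ((L : ℝ) ^ N) ^ J := by positivity
        linarith

/-- Below the threshold the radius of the cluster of the origin decays faster than any power,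
along a geometric sequence of scales. -/
theorem exists_fast_decay (hd : 2 ≤ d) {x y : ℝ} (hx : 0 ≤ x) (hxy : x < y)
    (h : radiusLimsup d (y / (1 + y)) q < ∞) :
    ∃ L : ℕ, 4 ≤ L ∧ ∀ N : ℕ, ∃ C : ℝ, 0 ≤ C ∧
      ∀ j : ℕ, radProb d q x (L ^ j) * ((L : ℝ) ^ N) ^ j ≤ C := by
  have hy : 0 < y := hx.trans_lt hxy
  -- The odds are lowered twice, once for each improvement of the tail, from `y` to `θ² y = (x +
  -- y)/2`, which is still at least `x`.
  set θ := Real.sqrt ((x + y) / (2 * y)) with hθ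
  have hpos : 0 < (x + y) / (2 * y) := by positivity
  have hθ0 : 0 < θ := Real.sqrt_pos.2 hpos
  have hθ1 : θ < 1 := by
    rw [hθ, Real.sqrt_lt' one_pos, one_pow, div_lt_one (by positivity)]
    linarith
  have hθθ : θ * (θ * y) = (x + y) / 2 := by
    rw [← mul_assoc, hθ, Real.mul_self_sqrt hpos.le]
    field_simp
  obtain ⟨C, hC0, hC⟩ := exists_bound_of_radiusLimsup h
  obtain ⟨L, a, C', hL, ha, hC'0, hC'⟩ := exists_geometric_gain hd hy hθ0 hθ1 hC0 hC
  refine ⟨L, hL, fun N => ?_⟩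
  obtain ⟨C'', hC''0, hC''⟩ := exists_fast_decay_step hd (by positivity) hθ0 hθ1 hL ha hC'0 hC' N
  refine ⟨C'', hC''0, fun j => le_trans ?_ (hC'' j)⟩
  gcongr
  exact radProb_mono_left hx (by rw [hθθ]; linarith) _

end

section

variable {d q : ℕ}

/-! ### The size of the open cluster -/

theorem box_mono {s t : ℕ} (h : s ≤ t) : box d s ⊆ box d t := fun _ hx =>
  mem_box.2 fun i => (mem_box.1 hx i).trans (by exact_mod_cast h)

theorem exists_mem_box (u : Site d) : ∃ n, ∀ m ≥ n, u ∈ box d m :=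
  ⟨(norm1 u).toNat, fun m hm => mem_box.2 fun i =>
    (abs_apply_le_norm1 u i).trans (by have := Int.self_le_toNat (norm1 u); omega)⟩

theorem exists_subset_box (Λ : Finset (Site d)) : ∃ n, ∀ m ≥ n, Λ ⊆ box d m := by
  classical
  induction Λ using Finset.induction_on with
  | empty => exact ⟨0, fun m _ => by simp⟩
  | insert u Λ _ ih =>
    obtain ⟨n, hn⟩ := ih
    obtain ⟨n', hn'⟩ := exists_mem_box u
    exact ⟨max n n', fun m hm => Finset.insert_subset (hn' m (le_of_max_le_right hm))
      (hn m (le_of_max_le_left hm))⟩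

theorem tendsto_touchEdges_box : Tendsto (fun t => touchEdges (box d t)) atTop atTop := by
  refine tendsto_atTop_finset_of_monotone (fun s t h => touchEdges_mono (box_mono h)) fun e => ?_
  obtain ⟨e, he⟩ := e
  induction e using Sym2.ind with | _ a b => ?_
  obtain ⟨n, hn⟩ := exists_mem_box a
  exact ⟨n, mem_touchEdges.2 ⟨a, by simp, hn n le_rfl⟩⟩

/-- A connection uses finitely many edges. -/
theorem reachable_iff_exists_cut {ω : EdgeConfig d} {u v : Site d} :
    (openGraph ω).Reachable u v ↔
      ∃ n, (openGraph (cut (touchEdges (box d n)) ω)).Reachable u v := by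
  refine ⟨?_, fun ⟨n, h⟩ => reachable_mono (cut_le _ _) h⟩
  rintro ⟨w⟩
  induction w with
  | nil => exact ⟨0, SimpleGraph.Reachable.refl _⟩
  | @cons a b c hadj w ih =>
    obtain ⟨n, hn⟩ := ih
    obtain ⟨n', hn'⟩ := exists_mem_box a
    refine ⟨max n n', ?_⟩
    refine (SimpleGraph.Adj.reachable (cut_touchEdges_adj (hn' _ (le_max_right _ _)) hadj)).trans ?_
    exact reachable_mono (cut_mono_left (touchEdges_mono (box_mono (le_max_left _ _))) ω) hn

theorem measurableSet_reachable (u v : Site d) :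
    MeasurableSet {ω : EdgeConfig d | (openGraph ω).Reachable u v} := by
  have : {ω : EdgeConfig d | (openGraph ω).Reachable u v} =
      ⋃ n, {ω | (openGraph (cut (touchEdges (box d n)) ω)).Reachable u v} := by
    ext ω
    simp only [Set.mem_iUnion, Set.mem_ofPred_eq]
    exact reachable_iff_exists_cut
  rw [this]
  exact MeasurableSet.iUnion fun n => measurableSet_of_dependsOn
    (dependsOn_cut _ fun ω => (openGraph ω).Reachable u v)

/-- The number of sites in the cluster of `u`. -/
noncomputable def csize (u : Site d) (ω : EdgeConfig d) : ℝ≥0∞ := ((cluster ω u).encard : ℝ≥0∞)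

theorem csize_eq_tsum (u : Site d) (ω : EdgeConfig d) :
    csize u ω = ∑' v, {ω : EdgeConfig d | (openGraph ω).Reachable u v}.indicator 1 ω := by
  rw [csize, ← ENNReal.tsum_set_one, tsum_subtype (cluster ω u) fun _ => (1 : ℝ≥0∞)]
  rfl

theorem measurable_csize (u : Site d) : Measurable (csize u) := by
  have : csize u = fun ω => ∑' v,
      {ω : EdgeConfig d | (openGraph ω).Reachable u v}.indicator 1 ω :=
    funext (csize_eq_tsum u)
  rw [this]
  exact Measurable.tsum fun v => measurable_one.indicator (measurableSet_reachable u v)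

theorem csize_shift (u : Site d) (ω : EdgeConfig d) : csize 0 (shift u ω) = csize u ω := by
  rw [csize_eq_tsum, csize_eq_tsum, ← (Equiv.addRight u).tsum_eq fun v =>
    {ω : EdgeConfig d | (openGraph ω).Reachable u v}.indicator (1 : EdgeConfig d → ℝ≥0∞) ω]
  refine tsum_congr fun v => ?_
  have h : (openGraph (shift u ω)).Reachable 0 v ↔ (openGraph ω).Reachable u (v + u) := by
    rw [reachable_shift, zero_add]
  by_cases hr : (openGraph ω).Reachable u (v + u)
  · have h1 : shift u ω ∈ {ω : EdgeConfig d | (openGraph ω).Reachable 0 v} := h.2 hr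
    have h2 : ω ∈ {ω : EdgeConfig d | (openGraph ω).Reachable u (Equiv.addRight u v)} := hr
    rw [Set.indicator_of_mem h1, Set.indicator_of_mem h2]
    rfl
  · have h1 : shift u ω ∉ {ω : EdgeConfig d | (openGraph ω).Reachable 0 v} := mt h.1 hr
    have h2 : ω ∉ {ω : EdgeConfig d | (openGraph ω).Reachable u (Equiv.addRight u v)} := hr
    rw [Set.indicator_of_notMem h1, Set.indicator_of_notMem h2]

theorem csize_le_of_not_mem_farEvent {n : ℕ} {ω : EdgeConfig d} (h : ω ∉ farEvent d n) :
    csize 0 ω ≤ ((2 * n + 1) ^ d : ℕ) := by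
  have hsub : cluster ω 0 ⊆ (box d n : Set (Site d)) := by
    intro v hv
    by_contra hv'
    refine h (mem_farEvent.2 ⟨v, ?_, hv⟩)
    by_contra! hle
    exact hv' (mem_box.2 fun i => (abs_apply_le_norm1 v i).trans hle)
  have := Set.encard_le_encard hsub
  rw [Set.encard_coe_eq_coe_finsetCard, card_box] at this
  unfold csize
  exact_mod_cast this

variable (d q) in
/-- The radius of the cluster of the origin decays faster than any power along a geometric
sequence of scales. -/
def FastDecay (x : ℝ) : Prop :=
  ∃ L : ℕ, 4 ≤ L ∧ ∀ N : ℕ, ∃ C : ℝ, 0 ≤ C ∧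
      ∀ j : ℕ, radProb d q x (L ^ j) * ((L : ℝ) ^ N) ^ j ≤ C

theorem measurableSet_farEvent (n : ℕ) : MeasurableSet (farEvent d n) :=
  measurableSet_exitEvent _ _

/-- At the first scale `L^j` not exceeded by the radius, the cluster lies in the corresponding box
while the previous scale was exceeded. The second moment is therefore bounded by a series of squared
volumes times radius tails. -/
theorem lintegral_csize_sq_lt_top {x : ℝ} (h : FastDecay d q x) :
    ∫⁻ ω, csize 0 ω ^ 2 ∂(rcInf d q x : Measure (EdgeConfig d)) < ∞ := by
  obtain ⟨L, hL, h⟩ := h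
  -- The power `2d` compensates the squared volume, and one more power makes the series geometric.
  obtain ⟨C, hC0, hC⟩ := h (2 * d + 1)
  set P : Measure (EdgeConfig d) := (rcInf d q x : Measure (EdgeConfig d))
  have hPp : IsProbabilityMeasure P := (rcInf d q x).2
  set a : ℕ → ℝ≥0∞ := fun j => (((2 * L ^ (j + 1) + 1) ^ d : ℕ) : ℝ≥0∞) ^ 2 with ha
  have hpt : ∀ ω : EdgeConfig d, csize 0 ω ^ 2 ≤ (((2 * 1 + 1) ^ d : ℕ) : ℝ≥0∞) ^ 2 +
      ∑' j, a j * (farEvent d (L ^ j)).indicator 1 ω := by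
    intro ω
    by_cases hex : ∃ j, ω ∉ farEvent d (L ^ j)
    · classical
      obtain hj0 := Nat.find_spec hex
      rcases Nat.eq_zero_or_pos (Nat.find hex) with h0 | h0
      · rw [h0, pow_zero] at hj0
        exact le_add_right (pow_le_pow_left' (csize_le_of_not_mem_farEvent hj0) 2)
      · obtain ⟨i, hi⟩ : ∃ i, Nat.find hex = i + 1 := ⟨Nat.find hex - 1, by omega⟩
        have hin : ω ∈ farEvent d (L ^ i) := by
          by_contra hcon
          exact Nat.find_min hex (m := i) (by omega) hcon
        rw [hi] at hj0
        refine le_add_left ?_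
        calc csize 0 ω ^ 2 ≤ a i := pow_le_pow_left' (csize_le_of_not_mem_farEvent hj0) 2
          _ = a i * (farEvent d (L ^ i)).indicator 1 ω := by simp [hin]
          _ ≤ _ := ENNReal.le_tsum i
    -- If every scale is exceeded the series is infinite, so the pointwise bound holds without
    -- knowing that this event is null.
    · push Not at hex
      have : ∑' j, a j * (farEvent d (L ^ j)).indicator 1 ω = ∞ := by
        simp only [hex, Set.indicator_of_mem, Pi.one_apply, mul_one]
        refine top_unique ((ENNReal.tsum_const_eq_top_of_ne_zero (α := ℕ) one_ne_zero).symm.le.trans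
          (ENNReal.tsum_le_tsum fun j => one_le_pow₀ ?_))
        exact_mod_cast Nat.one_le_pow _ _ (by omega)
      rw [this]; simp
  refine (lintegral_mono hpt).trans_lt ?_
  rw [lintegral_add_left measurable_const, lintegral_tsum fun j =>
    ((measurable_one.indicator (measurableSet_farEvent _)).const_mul _).aemeasurable]
  simp only [lintegral_const, measure_univ, mul_one]
  refine ENNReal.add_lt_top.2 ⟨by simp, ?_⟩
  have hLR : (4 : ℝ) ≤ L := by exact_mod_cast hL
  have hterm : ∀ j, ∫⁻ ω, a j * (farEvent d (L ^ j)).indicator 1 ω ∂P ≤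
      ENNReal.ofReal (((3 * (L : ℝ)) ^ d) ^ 2 * C * ((L : ℝ)⁻¹) ^ j) := by
    intro j
    rw [lintegral_const_mul _ (measurable_one.indicator (measurableSet_farEvent _)),
      lintegral_indicator_one (measurableSet_farEvent _)]
    have h1 : P (farEvent d (L ^ j)) = ENNReal.ofReal (radProb d q x (L ^ j)) := by
      rw [radProb, ofReal_measureReal]
    have h2 : a j = ENNReal.ofReal (((2 * (L : ℝ) ^ (j + 1) + 1) ^ d) ^ 2) := by
      simp only [ha]
      rw [ENNReal.ofReal_pow (by positivity), ← ENNReal.ofReal_natCast]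
      push_cast
      rfl
    change a j * P (farEvent d (L ^ j)) ≤ _
    rw [h1, h2, ← ENNReal.ofReal_mul (by positivity)]
    refine ENNReal.ofReal_le_ofReal ?_
    have h3 : (1 : ℝ) ≤ (L : ℝ) ^ (j + 1) := one_le_pow₀ (by linarith)
    have h4 := hC j
    rw [← le_div_iff₀ (by positivity)] at h4
    calc ((2 * (L : ℝ) ^ (j + 1) + 1) ^ d) ^ 2 * radProb d q x (L ^ j)
        ≤ ((3 * (L : ℝ) ^ (j + 1)) ^ d) ^ 2 * (C / ((L : ℝ) ^ (2 * d + 1)) ^ j) := by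
          gcongr
          · exact radProb_nonneg _ _
          · linarith
      _ = _ := by
          rw [inv_pow]
          field_simp
          ring
  refine (ENNReal.tsum_le_tsum hterm).trans_lt ?_
  rw [← ENNReal.ofReal_tsum_of_nonneg (fun j => by positivity)]
  · exact ENNReal.ofReal_lt_top
  · refine Summable.mul_left _ (summable_geometric_of_lt_one (by positivity) ?_)
    exact inv_lt_one_of_one_lt₀ (by linarith)

theorem one_le_csize (u : Site d) (ω : EdgeConfig d) : 1 ≤ csize u ω := by
  have : (1 : ℕ∞) ≤ (cluster ω u).encard :=
    Set.one_le_encard_iff_nonempty.2 ⟨u, SimpleGraph.Reachable.refl u⟩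
  unfold csize
  exact_mod_cast this

theorem lintegral_csize_lt_top {x : ℝ} (h : FastDecay d q x) :
    ∫⁻ ω, csize 0 ω ∂(rcInf d q x : Measure (EdgeConfig d)) < ∞ := by
  refine (lintegral_mono fun ω => ?_).trans_lt (lintegral_csize_sq_lt_top h)
  rw [sq]
  exact le_mul_of_one_le_left' (one_le_csize 0 ω)

/-- The series defining `chi` leaves out infinite clusters. It equals the expectation because
clusters are almost surely finite here. -/
theorem chi_eq {x : ℝ} (h : FastDecay d q x) :
    chi d (x / (1 + x)) q = ∫⁻ ω, csize 0 ω ∂(rcInf d q x : Measure (EdgeConfig d)) := by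
  have hae := ae_lt_top (measurable_csize 0) (lintegral_csize_lt_top h).ne
  have hk : ∀ (k : ℕ) (ω : EdgeConfig d), (cluster ω 0).encard = k ↔ csize 0 ω = k := by
    intro k ω
    unfold csize
    norm_cast
  have hmeas : ∀ k : ℕ, MeasurableSet {ω : EdgeConfig d | (cluster ω 0).encard = k} := by
    intro k
    simp only [hk]
    exact measurable_csize 0 (measurableSet_singleton _)
  unfold chi
  change ∑' k : ℕ, (k : ℝ≥0∞) * (rcInf d q x : Measure (EdgeConfig d)) _ = _
  calc _ = ∑' k : ℕ, ∫⁻ ω, (k : ℝ≥0∞) *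
        {ω : EdgeConfig d | (cluster ω 0).encard = k}.indicator 1 ω ∂(rcInf d q x : Measure _) := by
        refine tsum_congr fun k => ?_
        rw [lintegral_const_mul _ (measurable_one.indicator (hmeas k)),
          lintegral_indicator_one (hmeas k)]
    _ = ∫⁻ ω, ∑' k : ℕ, (k : ℝ≥0∞) *
        {ω : EdgeConfig d | (cluster ω 0).encard = k}.indicator 1 ω ∂(rcInf d q x : Measure _) :=
        (lintegral_tsum fun k =>
          ((measurable_one.indicator (hmeas k)).const_mul _).aemeasurable).symm
    _ = _ := by
        refine lintegral_congr_ae (hae.mono fun ω hω => ?_)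
        have hfin : (cluster ω 0).encard ≠ ⊤ := by
          intro htop
          simp [csize, htop] at hω
        obtain ⟨n, hn⟩ := ENat.ne_top_iff_exists.1 hfin
        simp only
        rw [tsum_eq_single n]
        · simp [csize, ← hn]
        · intro k hkn
          have : ω ∉ {ω : EdgeConfig d | (cluster ω 0).encard = k} := by
            simp only [Set.mem_ofPred_eq, ← hn]
            intro h'
            exact hkn (by exact_mod_cast h'.symm)
          simp [this]

variable [NeZero q]

theorem lintegral_csize {x : ℝ} (hx : 0 ≤ x) (u : Site d) (F : ℝ≥0∞ → ℝ≥0∞) (hF : Measurable F) :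
    ∫⁻ ω, F (csize u ω) ∂(rcInf d q x : Measure (EdgeConfig d)) =
      ∫⁻ ω, F (csize 0 ω) ∂(rcInf d q x : Measure (EdgeConfig d)) := by
  have := (measurePreserving_shift (q := q) hx u).lintegral_comp (hF.comp (measurable_csize 0))
  simpa only [Function.comp_apply, csize_shift] using this

theorem ae_csize_lt_top {x : ℝ} (hx : 0 ≤ x) (h : FastDecay d q x) (u : Site d) :
    ∀ᵐ ω ∂(rcInf d q x : Measure (EdgeConfig d)), csize u ω < ∞ := by
  refine ae_lt_top (measurable_csize u) ?_
  have := lintegral_csize (q := q) hx u id measurable_id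
  simp only [id] at this
  rw [this]
  exact (lintegral_csize_lt_top h).ne

theorem tendsto_exitEvent_box {x : ℝ} (hx : 0 ≤ x) (h : FastDecay d q x) (u : Site d) :
    Tendsto (fun r => (rcInf d q x : Measure (EdgeConfig d)).real (exitEvent (box d r) u)) atTop
      (𝓝 0) := by
  have h1 := tendsto_measure_iInter_atTop (μ := (rcInf d q x : Measure (EdgeConfig d)))
    (s := fun r => exitEvent (box d r) u)
    (fun r => (measurableSet_exitEvent _ _).nullMeasurableSet)
    (fun r s hrs ω ⟨y, hy, hr⟩ => ⟨y, fun h => hy (box_mono hrs h), hr⟩)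
    ⟨0, measure_ne_top _ _⟩
  have h0 : (rcInf d q x : Measure (EdgeConfig d)) (⋂ r, exitEvent (box d r) u) = 0 := by
    refine measure_mono_null (fun ω hω => ?_) (ae_iff.1 (ae_csize_lt_top hx h u))
    simp only [Set.mem_ofPred_eq, not_lt, top_le_iff]
    by_contra hcon
    have hfin : (cluster ω u).Finite := by
      rw [← Set.encard_ne_top_iff]
      intro htop
      exact hcon (by simp [csize, htop])
    obtain ⟨n, hn⟩ := exists_subset_box hfin.toFinset
    obtain ⟨y, hy, hr⟩ := Set.mem_iInter.1 hω n
    exact hy (hn n le_rfl (hfin.mem_toFinset.2 hr))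
  rw [h0] at h1
  exact (ENNReal.tendsto_toReal ENNReal.zero_ne_top).comp h1

end

/-! ### Random-cluster measures with spin boundary conditions, compared with the wired one -/

section

variable {d q : ℕ}

/-! ### The complement of a box is connected -/

theorem apply_eq_of_coord_eq {S : Type*} {t : ℕ} {f : Site d → S}
    (hf : ∀ u v, u ∉ box d t → v ∉ box d t → (lattice d).Adj u v → f u = f v)
    {u v : Site d} {i : Fin d} (hi : (t : ℤ) < |u i|) (huv : u i = v i) : f u = f v := by
  classical
  have hout : ∀ w : Site d, w i = u i → w ∉ box d t := fun w hw hb => by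
    have := mem_box.1 hb i
    rw [hw] at this
    omega
  have h : ∀ s : Finset (Fin d), i ∉ s → f (fun k => if k ∈ s then v k else u k) = f u := by
    intro s
    induction s using Finset.induction_on with
    | empty => simp
    | insert j s hj ih =>
      intro hi'
      rw [Finset.mem_insert, not_or] at hi'
      rw [← ih hi'.2]
      have h1 : (fun k => if k ∈ insert j s then v k else u k) =
          Function.update (fun k => if k ∈ s then v k else u k) j (v j) := by
        ext k
        by_cases hk : k = j
        · subst hk; simp
        · simp [hk]
      rw [h1, apply_update_eq (P := fun w => w ∉ box d t) hf (fun a => hout _ ?_) (v j) (u j)]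
      · congr 1
        ext k
        by_cases hk : k = j
        · subst hk; simp [hj]
        · simp [hk]
      · simp [hi'.1, hi'.2]
  rw [← h (Finset.univ.erase i) (by simp)]
  congr 1
  ext k
  by_cases hk : k = i
  · subst hk; simp [huv]
  · simp [hk]

/-- One large coordinate keeps a site outside the box while the others move freely. As `d ≥ 2`, a
second coordinate can be raised to `t + 1` before the first one is changed. This connectedness makes
the wired condition on a box the same as a constant boundary spin. -/
theorem apply_eq_off_box (hd : 2 ≤ d) {S : Type*} {t : ℕ} {f : Site d → S}
    (hf : ∀ u v, u ∉ box d t → v ∉ box d t → (lattice d).Adj u v → f u = f v)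
    {u v : Site d} (hu : u ∉ box d t) (hv : v ∉ box d t) : f u = f v := by
  have key : ∀ w, w ∉ box d t → f w = f fun _ => (t : ℤ) + 1 := by
    intro w hw
    rw [mem_box] at hw
    push Not at hw
    obtain ⟨i, hi⟩ := hw
    have : Nontrivial (Fin d) := Fin.nontrivial_iff_two_le.2 hd
    obtain ⟨j, hj⟩ := exists_ne i
    rw [apply_eq_of_coord_eq hf (v := Function.update w j ((t : ℤ) + 1)) hi (by simp [hj.symm])]
    refine apply_eq_of_coord_eq hf (i := j) ?_ (by simp)
    rw [Function.update_self, abs_of_nonneg (by positivity)]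
    omega
  rw [key u hu, key v hv]

/-! ### Spin configurations compatible with a boundary condition -/

theorem glueSpins_of_mem {Λ : Finset (Site d)} {η : Λ → Fin q} {τ : SpinConfig d q} {v : Site d}
    (h : v ∈ Λ) : glueSpins Λ η τ v = η ⟨v, h⟩ := by simp [glueSpins, h]

theorem glueSpins_of_not_mem {Λ : Finset (Site d)} {η : Λ → Fin q} {τ : SpinConfig d q}
    {v : Site d} (h : v ∉ Λ) : glueSpins Λ η τ v = τ v := by simp [glueSpins, h]

theorem glueSpins_restrict {Λ : Finset (Site d)} {σ τ : SpinConfig d q}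
    (h : ∀ v ∉ Λ, σ v = τ v) : glueSpins Λ (fun v => σ v) τ = σ := by
  funext v
  by_cases hv : v ∈ Λ
  · simp [glueSpins, hv]
  · simp [glueSpins, hv, h v hv]

variable [NeZero q]

open Classical in
/-- The spins in `Λ` which, together with the boundary condition `τ`, are constant along the open
edges touching `Λ`. -/
noncomputable def compatSpins (Λ : Finset (Site d)) (τ : SpinConfig d q) (ω : EdgeConfig d) :
    Finset (Λ → Fin q) :=
  Finset.univ.filter fun η => glueSpins Λ η τ ∈ invSpins q (cut (touchEdges Λ) ω)

theorem mem_compatSpins {Λ : Finset (Site d)} {τ : SpinConfig d q} {ω : EdgeConfig d}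
    {η : Λ → Fin q} :
    η ∈ compatSpins Λ τ ω ↔ glueSpins Λ η τ ∈ invSpins q (cut (touchEdges Λ) ω) := by
  simp [compatSpins]

theorem compatSpins_anti (Λ : Finset (Site d)) (τ : SpinConfig d q) {ω ω' : EdgeConfig d}
    (h : ω ≤ ω') : compatSpins Λ τ ω' ⊆ compatSpins Λ τ ω := fun _ hη =>
  mem_compatSpins.2 (invSpins_anti (cut_mono _ h) (mem_compatSpins.1 hη))

/-- The compatible spins for `τ` form a coset of the group of compatible spins for boundary
condition 0. -/
theorem card_compatSpins_of_nonempty {Λ : Finset (Site d)} {τ : SpinConfig d q}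
    {ω : EdgeConfig d} (h : (compatSpins Λ τ ω).Nonempty) :
    (compatSpins Λ τ ω).card = (compatSpins Λ (0 : SpinConfig d q) ω).card := by
  obtain ⟨η₀, hη₀⟩ := h
  have hglue : ∀ η η' : Λ → Fin q, glueSpins Λ (η - η') 0 = glueSpins Λ η τ - glueSpins Λ η' τ := by
    intro η η'
    funext v
    by_cases hv : v ∈ Λ <;> simp [glueSpins, hv]
  have hglue' : ∀ η η' : Λ → Fin q, glueSpins Λ (η + η') τ = glueSpins Λ η 0 + glueSpins Λ η' τ := by
    intro η η'
    funext v
    by_cases hv : v ∈ Λ <;> simp [glueSpins, hv]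
  refine Finset.card_nbij' (fun η => η - η₀) (fun η => η + η₀) ?_ ?_ ?_ ?_
  · intro η hη
    rw [Finset.mem_coe, mem_compatSpins] at *
    rw [hglue]
    exact AddSubgroup.sub_mem _ hη hη₀
  · intro η hη
    rw [Finset.mem_coe, mem_compatSpins] at *
    rw [hglue']
    exact AddSubgroup.add_mem _ hη hη₀
  · intro η _; simp
  · intro η _; simp

/-- If the complement of `Λ` is connected, the spins constant on the clusters are obtained from
those vanishing outside `Λ` by adding a constant. -/
theorem card_invSpins_of_connected {Λ : Finset (Site d)} {v₀ : Site d} (hv₀ : v₀ ∉ Λ)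
    (hconn : ∀ f : Site d → Fin q, (∀ u v, u ∉ Λ → v ∉ Λ → (lattice d).Adj u v → f u = f v) →
      ∀ u v, u ∉ Λ → v ∉ Λ → f u = f v) {ω : EdgeConfig d}
    (hω : ω ∈ wiredConfigs (touchEdges Λ)) :
    Nat.card (invSpins q ω) = q * (compatSpins Λ (0 : SpinConfig d q) ω).card := by
  have hopen : ∀ u v, u ∉ Λ → v ∉ Λ → (lattice d).Adj u v → (openGraph ω).Adj u v := by
    intro u v hu hv h
    refine openGraph_adj.2 ⟨h, mem_wiredConfigs.1 hω _ ?_⟩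
    rw [mk_mem_touchEdges]
    tauto
  have hoff : ∀ σ ∈ invSpins q ω, ∀ v, v ∉ Λ → σ v = σ v₀ := fun σ hσ v hv =>
    hconn σ (fun u v hu hv h => hσ _ _ (hopen u v hu hv h)) v v₀ hv hv₀
  have key : invSpins q ω ≃ Fin q × {η // η ∈ compatSpins Λ (0 : SpinConfig d q) ω} :=
    { toFun := fun σ => ⟨(σ : Site d → Fin q) v₀,
        ⟨fun v => (σ : Site d → Fin q) v - (σ : Site d → Fin q) v₀, by
          rw [mem_compatSpins]
          have : glueSpins Λ (fun v : Λ => (σ : Site d → Fin q) v - (σ : Site d → Fin q) v₀)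
              (0 : SpinConfig d q) =
              (fun v => (σ : Site d → Fin q) v - (σ : Site d → Fin q) v₀) := by
            refine glueSpins_restrict (σ := fun v => (σ : Site d → Fin q) v -
              (σ : Site d → Fin q) v₀) fun v hv => ?_
            rw [hoff σ σ.2 v hv]
            simp
          rw [this]
          intro u v huv
          simp only
          rw [σ.2 u v (openGraph_mono (cut_le _ _) huv)]⟩⟩
      invFun := fun p => ⟨fun v => p.1 + glueSpins Λ p.2.1 0 v, fun u v huv => by
        have hp := mem_compatSpins.1 p.2.2
        by_cases hu : u ∈ Λ
        · simp only [hp u v (cut_touchEdges_adj hu huv)]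
        by_cases hv : v ∈ Λ
        · simp only [hp v u (cut_touchEdges_adj hv huv.symm)]
        · simp [glueSpins, hu, hv]⟩
      left_inv := fun σ => by
        ext1
        funext v
        by_cases hv : v ∈ Λ
        · simp [glueSpins, hv]
        · simp only [glueSpins, hv, dite_false, Pi.zero_apply, add_zero]
          exact (hoff σ σ.2 v hv).symm
      right_inv := fun p => by
        have h0 : glueSpins Λ p.2.1 (0 : SpinConfig d q) v₀ = 0 := by simp [glueSpins, hv₀]
        refine Prod.ext ?_ (Subtype.ext (funext fun v => ?_))
        · simp [h0]
        · simp [glueSpins, hv₀] }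
  rw [Nat.card_congr key, Nat.card_prod, Nat.card_fin, Nat.card_eq_fintype_card,
    Fintype.card_coe]

theorem card_invSpins_box (hd : 2 ≤ d) {t : ℕ} {ω : EdgeConfig d}
    (hω : ω ∈ wiredConfigs (touchEdges (box d t))) :
    Nat.card (invSpins q ω) = q * (compatSpins (box d t) (0 : SpinConfig d q) ω).card := by
  have hv₀ : (fun _ => (t : ℤ) + 1 : Site d) ∉ box d t := by
    rw [mem_box]
    intro h
    have h1 := h ⟨0, by omega⟩
    rw [abs_of_nonneg (by positivity)] at h1
    omega
  exact card_invSpins_of_connected hv₀ (fun f hf u v hu hv => apply_eq_off_box hd hf hu hv) hω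

/-! ### Random-cluster weights with a spin boundary condition -/

/-- The random-cluster weight in `Λ` with spin boundary condition `τ`. -/
noncomputable def spinWeight (x : ℝ) (Λ : Finset (Site d)) (τ : SpinConfig d q)
    (ω : EdgeConfig d) : ℝ :=
  x ^ openCount (touchEdges Λ) ω * (compatSpins Λ τ ω).card

/-- The mean with respect to `spinWeight`. -/
noncomputable def spinMean (x : ℝ) (Λ : Finset (Site d)) (τ : SpinConfig d q)
    (f : EdgeConfig d → ℝ) : ℝ :=
  wmean (wiredConfigs (touchEdges Λ)) (spinWeight x Λ τ) f

theorem spinWeight_nonneg {x : ℝ} (hx : 0 ≤ x) (Λ : Finset (Site d)) (τ : SpinConfig d q)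
    (ω : EdgeConfig d) : 0 ≤ spinWeight x Λ τ ω := by
  unfold spinWeight; positivity

theorem mem_compatSpins_closedOn (Λ : Finset (Site d)) (τ : SpinConfig d q) (η : Λ → Fin q) :
    η ∈ compatSpins Λ τ (closedOn (touchEdges Λ)) := by
  rw [mem_compatSpins]
  intro u v huv
  obtain ⟨h, hmem, ho⟩ := openGraph_cut_adj.1 huv
  simp [closedOn, hmem] at ho

theorem spinWeight_closedOn_pos (x : ℝ) (Λ : Finset (Site d)) (τ : SpinConfig d q) :
    0 < spinWeight x Λ τ (closedOn (touchEdges Λ)) := by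
  have h : openCount (touchEdges Λ) (closedOn (touchEdges Λ)) = 0 := by
    simp only [openCount, Finset.card_eq_zero, Finset.filter_eq_empty_iff]
    intro e he
    simp [closedOn, he]
  have h2 : 0 < (compatSpins Λ τ (closedOn (touchEdges Λ))).card :=
    Finset.card_pos.2 ⟨0, mem_compatSpins_closedOn Λ τ 0⟩
  simp only [spinWeight, h, pow_zero, one_mul]
  exact_mod_cast h2

theorem sum_spinWeight_pos {x : ℝ} (hx : 0 ≤ x) (Λ : Finset (Site d)) (τ : SpinConfig d q) :
    0 < ∑ ω ∈ wiredConfigs (touchEdges Λ), spinWeight x Λ τ ω :=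
  Finset.sum_pos' (fun _ _ => spinWeight_nonneg hx _ _ _)
    ⟨_, closedOn_mem _, spinWeight_closedOn_pos x Λ τ⟩

theorem rcWeight_eq_spinWeight (hd : 2 ≤ d) (x : ℝ) {t : ℕ} {ω : EdgeConfig d}
    (hω : ω ∈ wiredConfigs (touchEdges (box d t))) :
    rcWeight q x (touchEdges (box d t)) ω = q * spinWeight x (box d t) (0 : SpinConfig d q) ω := by
  unfold rcWeight spinWeight
  rw [card_invSpins_box hd hω]
  push_cast
  ring

theorem rcMean_eq_spinMean (hd : 2 ≤ d) (x : ℝ) (t : ℕ) (f : EdgeConfig d → ℝ) :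
    rcMean q x (touchEdges (box d t)) f = spinMean x (box d t) (0 : SpinConfig d q) f := by
  have hq : (q : ℝ) ≠ 0 := NeZero.ne _
  unfold rcMean spinMean
  rw [wmean_weight_congr fun ω hω => rcWeight_eq_spinWeight hd x hω, wmean_const_mul_weight hq]

/-- A boundary condition `τ` conditions the measure with zero boundary on the existence of
compatible spins. That event is decreasing, because opening edges only adds constraints; hence the
domination by the wired measure on a box. -/
theorem spinWeight_eq_mul (x : ℝ) (Λ : Finset (Site d)) (τ : SpinConfig d q) (ω : EdgeConfig d) :
    spinWeight x Λ τ ω = spinWeight x Λ (0 : SpinConfig d q) ω *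
      {ω | (compatSpins Λ τ ω).Nonempty}.indicator 1 ω := by
  by_cases h : (compatSpins Λ τ ω).Nonempty
  · have hmem : ω ∈ {ω | (compatSpins Λ τ ω).Nonempty} := h
    rw [Set.indicator_of_mem hmem, spinWeight, spinWeight, card_compatSpins_of_nonempty h]
    simp
  · have hmem : ω ∉ {ω | (compatSpins Λ τ ω).Nonempty} := h
    rw [Set.indicator_of_notMem hmem, spinWeight, Finset.not_nonempty_iff_eq_empty.1 h]
    simp

/-- The wired measure dominates the random-cluster measures with spin boundary conditions. -/
theorem spinMean_le_rcMean (hd : 2 ≤ d) {x : ℝ} (hx : 0 ≤ x) {t : ℕ} (τ : SpinConfig d q)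
    {f : EdgeConfig d → ℝ} (hf : Monotone f) :
    spinMean x (box d t) τ f ≤ rcMean q x (touchEdges (box d t)) f := by
  have hq : (0 : ℝ) < q := by exact_mod_cast Nat.pos_of_ne_zero (NeZero.ne q)
  set g : EdgeConfig d → ℝ := {ω | (compatSpins (box d t) τ ω).Nonempty}.indicator 1
  have hw : ∀ ω ∈ wiredConfigs (touchEdges (box d t)),
      rcWeight q x (touchEdges (box d t)) ω * g ω = q * spinWeight x (box d t) τ ω := by
    intro ω hω
    rw [rcWeight_eq_spinWeight hd x hω, spinWeight_eq_mul x _ τ, mul_assoc]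
  have h := wmean_mul_le_rcMean (q := q) hx le_rfl (Finset.Subset.refl (touchEdges (box d t)))
    (g := g) (fun ω => Set.indicator_nonneg (fun _ _ => zero_le_one) _) (fun a _ b _ => ?_) ?_ hf
  · rwa [wmean_weight_congr hw, wmean_const_mul_weight hq.ne'] at h
  · by_cases ha : (compatSpins (box d t) τ a).Nonempty
    · have hmem : a ⊓ b ∈ {ω | (compatSpins (box d t) τ ω).Nonempty} :=
        ha.mono (compatSpins_anti _ _ inf_le_left)
      have hmem' : a ∈ {ω | (compatSpins (box d t) τ ω).Nonempty} := ha
      simp only [g]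
      rw [Set.indicator_of_mem hmem, Set.indicator_of_mem hmem']
      rfl
    · have hmem' : a ∉ {ω | (compatSpins (box d t) τ ω).Nonempty} := ha
      simp only [g]
      rw [Set.indicator_of_notMem hmem']
      exact Set.indicator_nonneg (fun _ _ => zero_le_one) _
  · rw [Finset.sum_congr rfl hw, ← Finset.mul_sum]
    exact mul_pos hq (sum_spinWeight_pos hx _ _)

end

section

variable {d q : ℕ}

/-! ### The domain Markov property -/

open Classical in
/-- The sites of `Λ` which are not joined to the complement of `Λ`. -/
noncomputable def interiorSites (Λ : Finset (Site d)) (ω : EdgeConfig d) : Finset (Site d) :=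
  Λ.filter fun v => ω ∉ exitEvent Λ v

theorem mem_interiorSites {Λ : Finset (Site d)} {ω : EdgeConfig d} {v : Site d} :
    v ∈ interiorSites Λ ω ↔ ω ∉ exitEvent Λ v := by
  simp only [interiorSites, Finset.mem_filter, and_iff_right_iff_imp]
  intro h
  by_contra hv
  exact h ⟨v, hv, SimpleGraph.Reachable.refl v⟩

theorem interiorSites_anti (Λ : Finset (Site d)) : Antitone (interiorSites Λ) := fun _ _ h _ hv =>
  mem_interiorSites.2 fun h' => mem_interiorSites.1 hv (isUpperSet_exitEvent Λ _ h h')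

theorem interiorSites_subset (Λ : Finset (Site d)) (ω : EdgeConfig d) : interiorSites Λ ω ⊆ Λ := by
  classical
  exact Finset.filter_subset _ _

theorem mem_interiorSites_of_adj {Λ : Finset (Site d)} {ω : EdgeConfig d} {u v : Site d}
    (hu : u ∈ interiorSites Λ ω) (h : (openGraph ω).Adj u v) : v ∈ interiorSites Λ ω := by
  rw [mem_interiorSites] at *
  rintro ⟨w, hw, hr⟩
  exact hu ⟨w, hw, h.reachable.trans hr⟩

theorem mk_mem_innerEdges {D : Finset (Site d)} {u v : Site d} (h : (lattice d).Adj u v) :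
    (⟨s(u, v), h⟩ : Edge d) ∈ innerEdges D ↔ u ∈ D ∧ v ∈ D := by
  simp [innerEdges]

theorem innerEdges_mono {D D' : Finset (Site d)} (h : D ⊆ D') : innerEdges D ⊆ innerEdges D' := by
  classical
  intro e he
  simp only [innerEdges, Finset.mem_subtype] at he ⊢
  exact Finset.sym2_mono h he

open Classical in
/-- The configuration equal to `b` on `S` and to `a` elsewhere. -/
noncomputable def mix (S : Finset (Edge d)) (a b : EdgeConfig d) : EdgeConfig d :=
  fun e => if e ∈ S then b e else a e

theorem mix_of_mem {S : Finset (Edge d)} {a b : EdgeConfig d} {e : Edge d} (h : e ∈ S) :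
    mix S a b e = b e := by simp [mix, h]

theorem mix_of_not_mem {S : Finset (Edge d)} {a b : EdgeConfig d} {e : Edge d} (h : e ∉ S) :
    mix S a b e = a e := by simp [mix, h]

theorem mix_mix (S : Finset (Edge d)) (a b : EdgeConfig d) : mix S (mix S a b) (mix S b a) = a := by
  funext e
  by_cases h : e ∈ S <;> simp [mix, h]

theorem mix_mem_wiredConfigs {S E : Finset (Edge d)} {a b : EdgeConfig d}
    (ha : a ∈ wiredConfigs E) (hb : b ∈ wiredConfigs E) : mix S a b ∈ wiredConfigs E :=
  mem_wiredConfigs.2 fun e he => by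
    by_cases h : e ∈ S
    · rw [mix_of_mem h, mem_wiredConfigs.1 hb e he]
    · rw [mix_of_not_mem h, mem_wiredConfigs.1 ha e he]

theorem openCount_mix (E S : Finset (Edge d)) (a b : EdgeConfig d) :
    openCount E (mix S a b) + openCount E (mix S b a) = openCount E a + openCount E b := by
  classical
  simp only [openCount, Finset.card_filter]
  rw [← Finset.sum_add_distrib, ← Finset.sum_add_distrib]
  refine Finset.sum_congr rfl fun e _ => ?_
  by_cases h : e ∈ S
  · rw [mix_of_mem h, mix_of_mem h, add_comm]
  · rw [mix_of_not_mem h, mix_of_not_mem h]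

/-- Changing the configuration inside the interior does not change the interior. -/
theorem interiorSites_mix (Λ : Finset (Site d)) (a b : EdgeConfig d) :
    interiorSites Λ (mix (innerEdges (interiorSites Λ a)) a b) = interiorSites Λ a := by
  set D := interiorSites Λ a with hD
  set c := mix (innerEdges D) a b with hc
  -- No open edge of `a` joins `D` to its complement, so paths outside `D` use no edge that the
  -- exchange alters.
  have hoff : ∀ u v, u ∉ D → (openGraph a).Adj u v → v ∉ D ∧ (openGraph c).Adj u v := by
    intro u v hu huv
    obtain ⟨hl, ho⟩ := openGraph_adj.1 huv
    refine ⟨fun hv => hu (mem_interiorSites_of_adj hv huv.symm), openGraph_adj.2 ⟨hl, ?_⟩⟩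
    rw [hc, mix_of_not_mem, ho]
    rw [mk_mem_innerEdges]
    exact fun h => hu h.1
  have hin : ∀ u v, u ∈ D → (openGraph c).Adj u v → v ∈ D := by
    intro u v hu huv
    obtain ⟨hl, ho⟩ := openGraph_adj.1 huv
    by_contra hv
    rw [hc, mix_of_not_mem (by rw [mk_mem_innerEdges]; exact fun h => hv h.2)] at ho
    exact hv (mem_interiorSites_of_adj hu (openGraph_adj.2 ⟨hl, ho⟩))
  ext v
  rw [mem_interiorSites]
  constructor
  · intro h
    by_contra hv
    have hv' := hv
    rw [hD, mem_interiorSites, not_not] at hv'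
    obtain ⟨w, hw, hr⟩ := hv'
    have := mem_of_reachable (W := {z | z ∉ D ∧ (openGraph c).Reachable v z}) (ω := a)
      (fun y z hy hyz => ?_) ⟨hv, SimpleGraph.Reachable.refl v⟩ hr
    · exact h ⟨w, hw, this.2⟩
    · exact ⟨(hoff y z hy.1 hyz).1,
        SimpleGraph.Reachable.trans hy.2 (hoff y z hy.1 hyz).2.reachable⟩
  · rintro hv ⟨w, hw, hr⟩
    exact hw (interiorSites_subset Λ a (mem_of_reachable (W := (D : Set (Site d)))
      (fun y z hy hyz => hin y z hy hyz) hv hr))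

variable [NeZero q]

open Classical in
/-- Exchanging the spins of two configurations inside the interior of the first one. -/
theorem card_compatSpins_mul_le {Λ : Finset (Site d)} (τ : SpinConfig d q) {a b : EdgeConfig d}
    (hb : ∀ e ∈ touchEdges Λ, e ∉ innerEdges (interiorSites Λ a) → b e = false) :
    (compatSpins Λ τ a).card * (compatSpins Λ (0 : SpinConfig d q) b).card ≤
      (compatSpins Λ τ (mix (innerEdges (interiorSites Λ a)) a b)).card *
        (compatSpins Λ (0 : SpinConfig d q) (mix (innerEdges (interiorSites Λ a)) b a)).card := by
  set D := interiorSites Λ a with hD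
  rw [← Finset.card_product, ← Finset.card_product]
  have hDΛ : D ⊆ Λ := interiorSites_subset Λ a
  have hval : ∀ (η ξ : Λ → Fin q) (τ : SpinConfig d q) (v : Site d),
      glueSpins Λ (fun w => if (w : Site d) ∈ D then ξ w else η w) τ v =
        if v ∈ D then glueSpins Λ ξ 0 v else glueSpins Λ η τ v := by
    intro η ξ τ v
    by_cases hv : v ∈ Λ
    · simp [glueSpins, hv]
    · have : v ∉ D := fun h => hv (hDΛ h)
      simp [glueSpins, hv, this]
  have hval' : ∀ (η : Λ → Fin q) (τ τ' : SpinConfig d q) (v : Site d), v ∈ D →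
      glueSpins Λ η τ v = glueSpins Λ η τ' v := by
    intro η τ τ' v hv
    simp [glueSpins, hDΛ hv]
  refine Finset.card_le_card_of_injOn (fun p => (fun w => if (w : Site d) ∈ D then p.2 w else p.1 w,
    fun w => if (w : Site d) ∈ D then p.1 w else p.2 w)) ?_ ?_
  · rintro ⟨η, ξ⟩ hp
    simp only [Finset.coe_product, Set.mem_prod, Finset.mem_coe, mem_compatSpins] at hp ⊢
    obtain ⟨hη, hξ⟩ := hp
    constructor
    · intro u v huv
      obtain ⟨hl, hmem, ho⟩ := openGraph_cut_adj.1 huv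
      rw [hval, hval]
      by_cases he : (⟨s(u, v), hl⟩ : Edge d) ∈ innerEdges D
      · have huD := (mk_mem_innerEdges hl).1 he
        rw [mix_of_mem he] at ho
        rw [if_pos huD.1, if_pos huD.2]
        exact hξ u v (openGraph_cut_adj.2 ⟨hl, hmem, ho⟩)
      · rw [mix_of_not_mem he] at ho
        have hadj := openGraph_adj.2 ⟨hl, ho⟩
        have hu : u ∉ D := fun h => he ((mk_mem_innerEdges hl).2
          ⟨h, mem_interiorSites_of_adj h hadj⟩)
        have hv : v ∉ D := fun h => hu (mem_interiorSites_of_adj h hadj.symm)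
        rw [if_neg hu, if_neg hv]
        exact hη u v (openGraph_cut_adj.2 ⟨hl, hmem, ho⟩)
    · intro u v huv
      obtain ⟨hl, hmem, ho⟩ := openGraph_cut_adj.1 huv
      rw [hval, hval]
      by_cases he : (⟨s(u, v), hl⟩ : Edge d) ∈ innerEdges D
      · have huD := (mk_mem_innerEdges hl).1 he
        rw [mix_of_mem he] at ho
        rw [if_pos huD.1, if_pos huD.2, hval' η 0 τ u huD.1, hval' η 0 τ v huD.2]
        exact hη u v (openGraph_cut_adj.2 ⟨hl, hmem, ho⟩)
      · rw [mix_of_not_mem he, hb _ hmem he] at ho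
        exact absurd ho Bool.false_ne_true
  · rintro ⟨η, ξ⟩ _ ⟨η', ξ'⟩ _ h
    simp only [Prod.mk.injEq] at h
    ext w
    · have h1 := congrFun h.1 w
      have h2 := congrFun h.2 w
      by_cases hw : (w : Site d) ∈ D
      · simp only [hw, if_true] at h2; exact congrArg Fin.val h2
      · simp only [hw, if_false] at h1; exact congrArg Fin.val h1
    · have h1 := congrFun h.1 w
      have h2 := congrFun h.2 w
      by_cases hw : (w : Site d) ∈ D
      · simp only [hw, if_true] at h1; exact congrArg Fin.val h1
      · simp only [hw, if_false] at h2; exact congrArg Fin.val h2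

open Classical in
/-- The configurations in which the edges touching `Λ` but not contained in `D` are closed. -/
noncomputable def freeConfigs (Λ D : Finset (Site d)) : Finset (EdgeConfig d) :=
  (wiredConfigs (touchEdges Λ)).filter fun ω =>
    ∀ e ∈ touchEdges Λ, e ∉ innerEdges D → ω e = false

theorem mem_freeConfigs {Λ D : Finset (Site d)} {ω : EdgeConfig d} :
    ω ∈ freeConfigs Λ D ↔ ω ∈ wiredConfigs (touchEdges Λ) ∧
      ∀ e ∈ touchEdges Λ, e ∉ innerEdges D → ω e = false := by
  simp [freeConfigs]

theorem closedOn_mem_freeConfigs (Λ D : Finset (Site d)) :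
    closedOn (touchEdges Λ) ∈ freeConfigs Λ D :=
  mem_freeConfigs.2 ⟨closedOn_mem _, fun e he _ => by simp [closedOn, he]⟩

theorem mix_mem_freeConfigs {Λ D : Finset (Site d)} {a b : EdgeConfig d}
    (ha : a ∈ wiredConfigs (touchEdges Λ)) (hb : b ∈ freeConfigs Λ D) :
    mix (innerEdges D) b a ∈ freeConfigs Λ D := by
  rw [mem_freeConfigs] at hb ⊢
  exact ⟨mix_mem_wiredConfigs hb.1 ha, fun e he he' => by rw [mix_of_not_mem he', hb.2 e he he']⟩

/-- The exchange preserves the interior and is its own inverse. The inequality between numbers of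
compatible spins can therefore be applied in both directions. -/
theorem spinWeight_mul_eq {Λ : Finset (Site d)} (x : ℝ) (τ : SpinConfig d q) {a b : EdgeConfig d}
    (hb : b ∈ freeConfigs Λ (interiorSites Λ a)) :
    spinWeight x Λ τ a * spinWeight x Λ (0 : SpinConfig d q) b =
      spinWeight x Λ τ (mix (innerEdges (interiorSites Λ a)) a b) *
        spinWeight x Λ (0 : SpinConfig d q) (mix (innerEdges (interiorSites Λ a)) b a) := by
  have h1 : (compatSpins Λ τ a).card * (compatSpins Λ (0 : SpinConfig d q) b).card =
      (compatSpins Λ τ (mix (innerEdges (interiorSites Λ a)) a b)).card *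
        (compatSpins Λ (0 : SpinConfig d q) (mix (innerEdges (interiorSites Λ a)) b a)).card := by
    refine le_antisymm (card_compatSpins_mul_le τ (mem_freeConfigs.1 hb).2) ?_
    have h := card_compatSpins_mul_le (Λ := Λ) τ
      (a := mix (innerEdges (interiorSites Λ a)) a b)
      (b := mix (innerEdges (interiorSites Λ a)) b a) ?_
    · rwa [interiorSites_mix, mix_mix, mix_mix] at h
    · rw [interiorSites_mix]
      intro e he he'
      rw [mix_of_not_mem he', (mem_freeConfigs.1 hb).2 e he he']
  have h2 := openCount_mix (touchEdges Λ) (innerEdges (interiorSites Λ a)) a b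
  have hcard : ((compatSpins Λ τ a).card : ℝ) * (compatSpins Λ (0 : SpinConfig d q) b).card =
      (compatSpins Λ τ (mix (innerEdges (interiorSites Λ a)) a b)).card *
        (compatSpins Λ (0 : SpinConfig d q) (mix (innerEdges (interiorSites Λ a)) b a)).card := by
    exact_mod_cast h1
  unfold spinWeight
  have h3 : ∀ m n k l : ℕ, ∀ a b c e : ℝ, k + l = m + n → a * b = c * e →
      x ^ m * a * (x ^ n * b) = x ^ k * c * (x ^ l * e) := by
    intro m n k l a b c e hk hab
    calc x ^ m * a * (x ^ n * b) = x ^ (m + n) * (a * b) := by ring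
      _ = x ^ k * c * (x ^ l * e) := by rw [← hk, hab]; ring
  exact h3 _ _ _ _ _ _ _ _ h2 hcard

/-- The mean in the domain `D` with free boundary condition. -/
noncomputable def freeMean (q : ℕ) [NeZero q] (x : ℝ) (Λ D : Finset (Site d))
    (f : EdgeConfig d → ℝ) : ℝ :=
  wmean (freeConfigs Λ D) (spinWeight x Λ (0 : SpinConfig d q)) f

theorem sum_free_pos {x : ℝ} (hx : 0 ≤ x) (Λ D : Finset (Site d)) :
    0 < ∑ ω ∈ freeConfigs Λ D, spinWeight x Λ (0 : SpinConfig d q) ω :=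
  Finset.sum_pos' (fun _ _ => spinWeight_nonneg hx _ _ _)
    ⟨_, closedOn_mem_freeConfigs Λ D, spinWeight_closedOn_pos x Λ 0⟩

open Classical in
/-- Conditionally on the interior being `D`, the configuration in `D` is random-cluster with free
boundary condition. -/
theorem sum_interior_eq {x : ℝ} (hx : 0 ≤ x) {Λ D : Finset (Site d)} (τ : SpinConfig d q)
    {f : EdgeConfig d → ℝ} (hf : DependsOn f (innerEdges D : Set (Edge d))) :
    ∑ ω ∈ (wiredConfigs (touchEdges Λ)).filter (fun ω => interiorSites Λ ω = D),
        spinWeight x Λ τ ω * f ω =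
      (∑ ω ∈ (wiredConfigs (touchEdges Λ)).filter (fun ω => interiorSites Λ ω = D),
        spinWeight x Λ τ ω) * freeMean q x Λ D f := by
  set A := (wiredConfigs (touchEdges Λ)).filter (fun ω => interiorSites Λ ω = D)
  unfold freeMean wmean
  rw [← mul_div_assoc, eq_div_iff (sum_free_pos hx Λ D).ne', Finset.sum_mul_sum,
    Finset.sum_mul_sum, ← Finset.sum_product', ← Finset.sum_product']
  have hmaps : ∀ p ∈ A ×ˢ freeConfigs Λ D,
      (mix (innerEdges D) p.1 p.2, mix (innerEdges D) p.2 p.1) ∈ A ×ˢ freeConfigs Λ D := by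
    rintro ⟨a, b⟩ hp
    simp only [A, Finset.mem_product, Finset.mem_filter] at hp ⊢
    obtain ⟨⟨ha, haD⟩, hb⟩ := hp
    refine ⟨⟨mix_mem_wiredConfigs ha (mem_freeConfigs.1 hb).1, ?_⟩, mix_mem_freeConfigs ha hb⟩
    rw [← haD]
    exact interiorSites_mix Λ a b
  -- Both sides have become sums over pairs. The exchange is an involution of the pairs that
  -- preserves the product of the weights and moves the state inside `D` from the first
  -- configuration to the second.
  refine Finset.sum_bij' (fun p _ => (mix (innerEdges D) p.1 p.2, mix (innerEdges D) p.2 p.1))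
    (fun p _ => (mix (innerEdges D) p.1 p.2, mix (innerEdges D) p.2 p.1)) hmaps hmaps ?_ ?_ ?_
  · rintro ⟨a, b⟩ _; simp [mix_mix]
  · rintro ⟨a, b⟩ _; simp [mix_mix]
  · rintro ⟨a, b⟩ hp
    simp only [A, Finset.mem_product, Finset.mem_filter] at hp
    obtain ⟨⟨ha, rfl⟩, hb⟩ := hp
    have h1 := spinWeight_mul_eq x τ hb
    have h2 : f (mix (innerEdges (interiorSites Λ a)) b a) = f a :=
      hf fun e he => mix_of_mem he
    simp only
    rw [h2, ← mul_assoc, ← h1]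
    ring

/-- A larger domain relaxes the constraint that edges be closed, and on a box the weight satisfies
the same lattice condition as the wired one. -/
theorem freeMean_mono (hd : 2 ≤ d) {x : ℝ} (hx : 0 ≤ x) {t : ℕ} {D D' : Finset (Site d)}
    (hD : D ⊆ D') {f : EdgeConfig d → ℝ} (hf : Monotone f) :
    freeMean q x (box d t) D f ≤ freeMean q x (box d t) D' f := by
  have hq : (0 : ℝ) < q := by exact_mod_cast Nat.pos_of_ne_zero (NeZero.ne q)
  refine wmean_le_wmean_of_holley ?_ ?_ (fun _ _ => spinWeight_nonneg hx _ _ _)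
    (fun _ _ => spinWeight_nonneg hx _ _ _) (sum_free_pos hx _ _) (sum_free_pos hx _ _) ?_ hf
  · intro a ha b hb
    rw [mem_freeConfigs] at *
    exact ⟨inf_mem_wiredConfigs ha.1 hb.1, fun e he he' => by simp [ha.2 e he he']⟩
  · intro a ha b hb
    rw [mem_freeConfigs] at *
    refine ⟨sup_mem_wiredConfigs a hb.1, fun e he he' => ?_⟩
    simp [hb.2 e he he', ha.2 e he fun h => he' (innerEdges_mono hD h)]
  · intro a ha b hb
    rw [mem_freeConfigs] at ha hb
    have h := rcWeight_mul_le (q := q) hx le_rfl (Finset.Subset.refl _) ha.1 hb.1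
    rw [rcWeight_eq_spinWeight hd x ha.1, rcWeight_eq_spinWeight hd x hb.1,
      rcWeight_eq_spinWeight hd x (inf_mem_wiredConfigs ha.1 hb.1),
      rcWeight_eq_spinWeight hd x (sup_mem_wiredConfigs a hb.1)] at h
    have hqq : (0 : ℝ) < q * q := by positivity
    refine le_of_mul_le_mul_left ?_ hqq
    linarith

open Classical in
/-- The part of the conditional probability that `e` is open, given the interior, which comes from
the event that `e` lies in the interior. -/
noncomputable def freeOpen (q : ℕ) [NeZero q] (x : ℝ) (Λ : Finset (Site d)) (e : Edge d)
    (D : Finset (Site d)) : ℝ :=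
  if e ∈ innerEdges D then freeMean q x Λ D (openInd e) else 0

open Classical in
/-- The indicator that `e` is open and contained in the interior. -/
noncomputable def interiorOpen (Λ : Finset (Site d)) (e : Edge d) (ω : EdgeConfig d) : ℝ :=
  if e ∈ innerEdges (interiorSites Λ ω) then openInd e ω else 0

-- Conditioning on the value of the interior: the free mean does not depend on `τ`, so `τ` enters
-- only through the law of the interior.
open Classical in
theorem spinMean_freeOpen {x : ℝ} (hx : 0 ≤ x) (Λ : Finset (Site d)) (e : Edge d)
    (τ : SpinConfig d q) :
    spinMean x Λ τ (fun ω => freeOpen q x Λ e (interiorSites Λ ω)) =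
      spinMean x Λ τ (interiorOpen Λ e) := by
  unfold spinMean wmean
  congr 1
  rw [← Finset.sum_fiberwise_of_maps_to (t := Λ.powerset)
    (g := interiorSites Λ) (fun ω _ => Finset.mem_powerset.2 (interiorSites_subset _ ω)),
    ← Finset.sum_fiberwise_of_maps_to (t := Λ.powerset)
    (g := interiorSites Λ) (fun ω _ => Finset.mem_powerset.2 (interiorSites_subset _ ω))]
  refine Finset.sum_congr rfl fun D _ => ?_
  have e1 : ∀ ω ∈ (wiredConfigs (touchEdges Λ)).filter (fun ω => interiorSites Λ ω = D),
      spinWeight x Λ τ ω * freeOpen q x Λ e (interiorSites Λ ω) =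
        spinWeight x Λ τ ω * freeOpen q x Λ e D := fun ω hω => by
    rw [(Finset.mem_filter.1 hω).2]
  rw [Finset.sum_congr rfl e1, ← Finset.sum_mul]
  by_cases hD : e ∈ innerEdges D
  · have e2 : ∀ ω ∈ (wiredConfigs (touchEdges Λ)).filter (fun ω => interiorSites Λ ω = D),
        spinWeight x Λ τ ω * interiorOpen Λ e ω = spinWeight x Λ τ ω * openInd e ω :=
      fun ω hω => by
        unfold interiorOpen
        rw [(Finset.mem_filter.1 hω).2, if_pos hD]
    rw [Finset.sum_congr rfl e2, sum_interior_eq hx τ (f := openInd e)]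
    · unfold freeOpen
      rw [if_pos hD]
    · intro a b hab
      unfold openInd
      rw [hab e hD]
  · have e2 : ∀ ω ∈ (wiredConfigs (touchEdges Λ)).filter (fun ω => interiorSites Λ ω = D),
        spinWeight x Λ τ ω * interiorOpen Λ e ω = 0 :=
      fun ω hω => by
        unfold interiorOpen
        rw [(Finset.mem_filter.1 hω).2, if_neg hD, mul_zero]
    rw [Finset.sum_eq_zero e2]
    unfold freeOpen
    rw [if_neg hD, mul_zero]

open Classical in
/-- The influence of the spin boundary condition on the state of an edge is bounded by the
probability that the edge is joined to the boundary. -/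
theorem rcMean_openInd_le (hd : 2 ≤ d) {x : ℝ} (hx : 0 ≤ x) (t : ℕ) (τ : SpinConfig d q)
    {u v : Site d} (h : (lattice d).Adj u v) :
    rcMean q x (touchEdges (box d t)) (openInd ⟨s(u, v), h⟩) -
        spinMean x (box d t) τ (openInd ⟨s(u, v), h⟩) ≤
      rcMean q x (touchEdges (box d t)) ((exitEvent (box d t) u).indicator 1) +
        rcMean q x (touchEdges (box d t)) ((exitEvent (box d t) v).indicator 1) := by
  set e : Edge d := ⟨s(u, v), h⟩ with he
  have hopen0 : ∀ ω, 0 ≤ openInd e ω := fun ω => by unfold openInd; split_ifs <;> norm_num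
  have hopen1 : ∀ ω, openInd e ω ≤ 1 := fun ω => by unfold openInd; split_ifs <;> norm_num
  have hgmono : ∀ D D', D ⊆ D' → freeOpen q x (box d t) e D ≤ freeOpen q x (box d t) e D' := by
    intro D D' hD
    unfold freeOpen
    by_cases h1 : e ∈ innerEdges D
    · rw [if_pos h1, if_pos (innerEdges_mono hD h1)]
      exact freeMean_mono hd hx hD (openInd_mono e)
    · rw [if_neg h1]
      split_ifs
      · exact wmean_nonneg (fun _ _ => spinWeight_nonneg hx _ _ _) fun ω _ => hopen0 ω
      · exact le_rfl
  -- The interior shrinks as edges open, and `freeOpen` grows with the domain. Its negative is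
  -- therefore increasing in the configuration, and domination applies to it.
  have h1 := spinMean_le_rcMean hd hx (t := t) τ
    (f := fun ω => 0 - freeOpen q x (box d t) e (interiorSites (box d t) ω)) fun a b hab => by
      simp only
      have := hgmono _ _ (interiorSites_anti (box d t) hab)
      linarith
  -- The boundary condition `τ` makes it more likely than the wired one that `e` is open in the
  -- interior. Only the event that `e` is not in the interior remains to be paid for.
  have h2 : rcMean q x (touchEdges (box d t)) (interiorOpen (box d t) e) ≤ spinMean x (box d t) τ (interiorOpen (box d t) e) := by
    rw [← spinMean_freeOpen hx _ e τ, rcMean_eq_spinMean hd, ← spinMean_freeOpen hx _ e 0, ← rcMean_eq_spinMean hd]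
    unfold rcMean spinMean at *
    rw [wmean_sub, wmean_sub, wmean_const (sum_rcWeight_pos hx _),
      wmean_const (sum_spinWeight_pos hx _ _)] at h1
    linarith
  have h3 : spinMean x (box d t) τ (interiorOpen (box d t) e) ≤ spinMean x (box d t) τ (openInd e) := by
    refine wmean_mono (fun _ _ => spinWeight_nonneg hx _ _ _) fun ω _ => ?_
    unfold interiorOpen
    split_ifs
    · exact le_rfl
    · exact hopen0 ω
  have h4 : rcMean q x (touchEdges (box d t)) (openInd e) ≤
      rcMean q x (touchEdges (box d t)) (fun ω => interiorOpen (box d t) e ω +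
        ((exitEvent (box d t) u).indicator 1 ω + (exitEvent (box d t) v).indicator 1 ω)) := by
    refine rcMean_mono hx fun ω => ?_
    have i0 : ∀ w, 0 ≤ (exitEvent (box d t) w).indicator (1 : EdgeConfig d → ℝ) ω := fun w =>
      Set.indicator_nonneg (fun _ _ => zero_le_one) _
    unfold interiorOpen
    split_ifs with hmem
    · linarith [i0 u, i0 v]
    · rw [he, mk_mem_innerEdges, mem_interiorSites, mem_interiorSites, not_and_or, not_not,
        not_not] at hmem
      rcases hmem with hm | hm
      · rw [Set.indicator_of_mem hm]
        linarith [i0 v, hopen1 ω, show (1 : EdgeConfig d → ℝ) ω = 1 from rfl]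
      · rw [Set.indicator_of_mem hm]
        linarith [i0 u, hopen1 ω, show (1 : EdgeConfig d → ℝ) ω = 1 from rfl]
  have h5 : rcMean q x (touchEdges (box d t)) (fun ω => interiorOpen (box d t) e ω +
        ((exitEvent (box d t) u).indicator 1 ω + (exitEvent (box d t) v).indicator 1 ω)) =
      rcMean q x (touchEdges (box d t)) (interiorOpen (box d t) e) +
      (rcMean q x (touchEdges (box d t)) ((exitEvent (box d t) u).indicator 1) +
        rcMean q x (touchEdges (box d t)) ((exitEvent (box d t) v).indicator 1)) := by
    unfold rcMean
    rw [wmean_add, wmean_add]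
  linarith

end

/-! ### From edges to spins: the Edwards–Sokal coupling and cluster colourings -/

section

variable {d q : ℕ}

/-! ### The Edwards–Sokal representation of the Gibbs kernel -/

open Classical in
theorem hamiltonian_eq (β : ℝ) (Λ : Finset (Site d)) (σ : SpinConfig d q) :
    hamiltonian β Λ σ = 2 * β * ∑ e ∈ touchEdges Λ,
      if ∃ u ∈ (e : Sym2 (Site d)), ∃ v ∈ (e : Sym2 (Site d)), σ u ≠ σ v then (1 : ℝ) else 0 := by
  have h : {e : Sym2 (Site d) | e ∈ (lattice d).edgeSet ∧ ∃ x ∈ e, x ∈ Λ} =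
      ((touchEdges Λ).map ⟨Subtype.val, Subtype.val_injective⟩ : Finset (Sym2 (Site d))) := by
    ext e
    simp only [Finset.coe_map, Function.Embedding.coeFn_mk, Set.mem_image, Finset.mem_coe]
    constructor
    · rintro ⟨he, hx⟩
      exact ⟨⟨e, he⟩, mem_touchEdges.2 hx, rfl⟩
    · rintro ⟨e, he, rfl⟩
      exact ⟨e.2, mem_touchEdges.1 he⟩
  unfold hamiltonian
  rw [h, finsum_mem_coe_finset, Finset.sum_map]
  rfl

variable [NeZero q]

open Classical in
theorem prod_edges_eq (x : ℝ) (E : Finset (Edge d)) (ω : EdgeConfig d) (σ : SpinConfig d q) :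
    (∏ e ∈ E, if ω e = true then
        (if ∃ u ∈ (e : Sym2 (Site d)), ∃ v ∈ (e : Sym2 (Site d)), σ u ≠ σ v then 0 else x)
        else 1) =
      if σ ∈ invSpins q (cut E ω) then x ^ openCount E ω else 0 := by
  rw [← Finset.prod_filter]
  simp_rw [← ite_not (p := ∃ u ∈ _, ∃ v ∈ _, σ u ≠ σ v)]
  rw [Finset.prod_ite_zero, Finset.prod_const, openCount]
  refine if_congr ?_ rfl rfl
  rw [mem_invSpins]
  constructor
  · intro h u v huv
    obtain ⟨hl, hE, ho⟩ := openGraph_cut_adj.1 huv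
    have := h _ (Finset.mem_filter.2 ⟨hE, ho⟩)
    push Not at this
    exact this u (Sym2.mem_mk_left u v) v (Sym2.mem_mk_right u v)
  · rintro h ⟨e, he⟩ hE
    rw [Finset.mem_filter] at hE
    push Not
    induction e using Sym2.ind with | _ a b => ?_
    have hab := h a b (openGraph_cut_adj.2 ⟨he, hE⟩)
    intro u hu v hv
    simp only [Sym2.mem_iff] at hu hv
    rcases hu with rfl | rfl <;> rcases hv with rfl | rfl <;> simp [hab]

open Classical in
/-- The Boltzmann weight as a sum over edge configurations. -/
theorem exp_hamiltonian_eq (β : ℝ) (Λ : Finset (Site d)) (σ : SpinConfig d q) :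
    Real.exp (2 * β) ^ (touchEdges Λ).card * Real.exp (-hamiltonian β Λ σ) =
      ∑ ω ∈ wiredConfigs (touchEdges Λ),
        if σ ∈ invSpins q (cut (touchEdges Λ) ω) then
          (Real.exp (2 * β) - 1) ^ openCount (touchEdges Λ) ω else 0 := by
  set E := touchEdges Λ with hE
  set x := Real.exp (2 * β) - 1 with hx
  set g : Edge d → Bool → ℝ := fun e b => if b = true then
        (if ∃ u ∈ (e : Sym2 (Site d)), ∃ v ∈ (e : Sym2 (Site d)), σ u ≠ σ v then 0 else x)
        else 1 with hg
  -- After the rescaling an edge contributes `e^{2β} = 1 + x` when its ends agree and `1` when they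
  -- differ. The summand `1` stands for a closed edge and `x` for an open one.
  have h1 : Real.exp (2 * β) ^ E.card * Real.exp (-hamiltonian β Λ σ) =
      ∏ e ∈ E, ∑ b : Bool, g e b := by
    rw [hamiltonian_eq, ← mul_neg, ← Finset.sum_neg_distrib, Finset.mul_sum, Real.exp_sum,
      ← Finset.prod_const, ← Finset.prod_mul_distrib]
    refine Finset.prod_congr rfl fun e _ => ?_
    simp only [hg, Fintype.sum_bool, if_true, Bool.false_eq_true, if_false]
    split_ifs with h
    · rw [← Real.exp_add]
      simp
    · rw [hx]
      simp
  rw [h1, sum_wiredConfigs, ← Finset.prod_coe_sort, Finset.prod_univ_sum, Fintype.piFinset_univ]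
  refine Finset.sum_congr rfl fun ξ _ => ?_
  rw [← prod_edges_eq]
  refine Eq.trans ?_ (Finset.prod_coe_sort E _)
  refine Finset.prod_congr rfl fun e _ => ?_
  simp only [hg]
  have : glueEdges E ξ (fun _ => true) e = ξ e := by simp [glueEdges]
  rw [this]

open Classical in
/-- The average of `f` over the spin configurations compatible with `ω` and `τ`. -/
noncomputable def compatAvg (Λ : Finset (Site d)) (τ : SpinConfig d q) (f : SpinConfig d q → ℝ)
    (ω : EdgeConfig d) : ℝ :=
  (∑ η ∈ compatSpins Λ τ ω, f (glueSpins Λ η τ)) / (compatSpins Λ τ ω).card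

theorem spinWeight_mul_compatAvg (x : ℝ) (Λ : Finset (Site d)) (τ : SpinConfig d q)
    (f : SpinConfig d q → ℝ) (ω : EdgeConfig d) :
    spinWeight x Λ τ ω * compatAvg Λ τ f ω =
      x ^ openCount (touchEdges Λ) ω * ∑ η ∈ compatSpins Λ τ ω, f (glueSpins Λ η τ) := by
  unfold spinWeight compatAvg
  -- Without compatible spins the average is `0 / 0 = 0`; this default is harmless because the
  -- weight vanishes too.
  by_cases h : (compatSpins Λ τ ω).card = 0
  · rw [Finset.card_eq_zero] at h
    simp [h]
  · have : ((compatSpins Λ τ ω).card : ℝ) ≠ 0 := by exact_mod_cast h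
    field_simp

open Classical in
theorem sum_exp_hamiltonian (β : ℝ) (Λ : Finset (Site d)) (τ : SpinConfig d q)
    (f : SpinConfig d q → ℝ) :
    Real.exp (2 * β) ^ (touchEdges Λ).card *
      ∑ η : Λ → Fin q, Real.exp (-hamiltonian β Λ (glueSpins Λ η τ)) * f (glueSpins Λ η τ) =
    ∑ ω ∈ wiredConfigs (touchEdges Λ), (Real.exp (2 * β) - 1) ^ openCount (touchEdges Λ) ω *
      ∑ η ∈ compatSpins Λ τ ω, f (glueSpins Λ η τ) := by
  rw [Finset.mul_sum]
  simp_rw [← mul_assoc, exp_hamiltonian_eq, Finset.sum_mul]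
  rw [Finset.sum_comm]
  refine Finset.sum_congr rfl fun ω _ => ?_
  rw [compatSpins, Finset.sum_filter, Finset.mul_sum]
  refine Finset.sum_congr rfl fun η _ => ?_
  split_ifs <;> simp

/-- In the joint weight of spins and edges, summing out the spins leaves the random-cluster weight,
and given the edges the spins are uniform on the compatible ones. -/
theorem gibbsKernel_eq_spinMean (β : ℝ) (Λ : Finset (Site d)) (τ : SpinConfig d q)
    (f : SpinConfig d q → ℝ) :
    gibbsKernel β Λ f τ = spinMean (Real.exp (2 * β) - 1) Λ τ (compatAvg Λ τ f) := by
  classical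
  have hpos : Real.exp (2 * β) ^ (touchEdges Λ).card ≠ 0 := (pow_pos (Real.exp_pos _) _).ne'
  unfold gibbsKernel spinMean wmean
  rw [← mul_div_mul_left _ _ hpos, sum_exp_hamiltonian]
  have h1 := sum_exp_hamiltonian β Λ τ fun _ => 1
  simp only [mul_one, Finset.sum_const, nsmul_eq_mul] at h1
  rw [h1, Finset.sum_congr rfl fun ω _ => (spinWeight_mul_compatAvg _ _ _ _ ω).symm]
  rfl

theorem abs_compatAvg_le {Λ : Finset (Site d)} {τ : SpinConfig d q} {f : SpinConfig d q → ℝ}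
    {M : ℝ} (hf : ∀ σ, |f σ| ≤ M) (ω : EdgeConfig d) : |compatAvg Λ τ f ω| ≤ M := by
  have hM : 0 ≤ M := (abs_nonneg _).trans (hf 0)
  unfold compatAvg
  rw [abs_div, Nat.abs_cast]
  refine div_le_of_le_mul₀ (Nat.cast_nonneg _) hM ?_
  calc |∑ η ∈ compatSpins Λ τ ω, f (glueSpins Λ η τ)|
      ≤ ∑ η ∈ compatSpins Λ τ ω, |f (glueSpins Λ η τ)| := Finset.abs_sum_le_sum_abs _ _
    _ ≤ ∑ η ∈ compatSpins Λ τ ω, M := Finset.sum_le_sum fun _ _ => hf _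
    _ = M * (compatSpins Λ τ ω).card := by rw [Finset.sum_const, nsmul_eq_mul, mul_comm]

/-! ### Colouring the clusters -/

/-- Connectivity in `ω`, as an equivalence relation on `Δ`. -/
def reachSetoid (Δ : Finset (Site d)) (ω : EdgeConfig d) : Setoid Δ where
  r u v := (openGraph ω).Reachable u v
  iseqv := ⟨fun _ => SimpleGraph.Reachable.refl _, fun h => h.symm, fun h h' => h.trans h'⟩

noncomputable instance (Δ : Finset (Site d)) (s : Setoid Δ) : Fintype (Quotient s) :=
  Fintype.ofFinite _

open Classical in
/-- The average of `F` over independent uniform colours of the classes of `s`. -/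
noncomputable def classAvg {E : Type*} [AddCommGroup E] [Module ℝ E] {Δ : Finset (Site d)}
    (F : (Δ → Fin q) → E) (s : Setoid Δ) : E :=
  (Fintype.card (Quotient s → Fin q) : ℝ)⁻¹ • ∑ c : Quotient s → Fin q, F fun u => c ⟦u⟧

/-- The average of `F` over independent uniform colours of the clusters of `ω`. -/
noncomputable def colAvg {E : Type*} [AddCommGroup E] [Module ℝ E] {Δ : Finset (Site d)}
    (F : (Δ → Fin q) → E) (ω : EdgeConfig d) : E :=
  classAvg F (reachSetoid Δ ω)

open Classical in
/-- If no site of `Δ` is joined to the complement of `Λ`, the compatible spins give independent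
uniform colours to the clusters meeting `Δ`. -/
theorem compatAvg_eq_colAvg {Λ Δ : Finset (Site d)} {τ : SpinConfig d q} {ω : EdgeConfig d}
    (hω : ∀ u ∈ Δ, ω ∉ exitEvent Λ u) (hne : (compatSpins Λ τ ω).Nonempty)
    (F : (Δ → Fin q) → ℝ) :
    compatAvg Λ τ (fun σ => F fun u => σ u) ω = colAvg F ω := by
  set s := reachSetoid Δ ω with hs
  set T := cut (touchEdges Λ) ω with hT
  have hin : ∀ u ∈ Δ, ∀ v, (openGraph ω).Reachable u v → v ∈ Λ := by
    intro u hu v huv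
    by_contra hv
    exact hω u hu ⟨v, hv, huv⟩
  have hcut : ∀ u ∈ Δ, ∀ v, (openGraph ω).Reachable u v → (openGraph T).Reachable u v := by
    intro u hu v huv
    exact reachable_cut_of_forall_mem
      (fun z hz => hin u hu z (reachable_mono (cut_le _ _) hz)) huv
  -- the spin configuration which equals `c` on the clusters meeting `Δ`
  let bump : (Quotient s → Fin q) → Site d → Fin q := fun c v =>
    if h : ∃ u : Δ, (openGraph ω).Reachable u v then c ⟦h.choose⟧ else 0
  have hbump : ∀ (c : Quotient s → Fin q) (u : Δ), bump c u = c ⟦u⟧ := by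
    intro c u
    have h : ∃ w : Δ, (openGraph ω).Reachable w u := ⟨u, SimpleGraph.Reachable.refl _⟩
    simp only [bump, dif_pos h]
    congr 1
    exact Quotient.sound h.choose_spec
  have hbinv : ∀ c, bump c ∈ invSpins q T := by
    intro c u v huv
    have huv' := openGraph_mono (cut_le _ _) huv
    by_cases h : ∃ w : Δ, (openGraph ω).Reachable w u
    · have h' : ∃ w : Δ, (openGraph ω).Reachable w v :=
        ⟨h.choose, h.choose_spec.trans huv'.reachable⟩
      simp only [bump, dif_pos h, dif_pos h']
      congr 1
      exact Quotient.sound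
        ((h.choose_spec.trans huv'.reachable).trans h'.choose_spec.symm)
    · have h' : ¬ ∃ w : Δ, (openGraph ω).Reachable w v := fun ⟨w, hw⟩ =>
        h ⟨w, hw.trans huv'.symm.reachable⟩
      simp only [bump, dif_neg h, dif_neg h']
  have hb0 : ∀ c v, v ∉ Λ → bump c v = 0 := by
    intro c v hv
    have h : ¬ ∃ w : Δ, (openGraph ω).Reachable w v := fun ⟨w, hw⟩ => hv (hin w w.2 v hw)
    simp only [bump, dif_neg h]
  have hglue : ∀ (η : Λ → Fin q) c, glueSpins Λ (η + fun v : Λ => bump c v) τ =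
      glueSpins Λ η τ + bump c := by
    intro η c
    funext v
    by_cases hv : v ∈ Λ
    · simp [glueSpins, hv]
    · simp [glueSpins, hv, hb0 c v hv]
  have hglue' : ∀ (η : Λ → Fin q) c, glueSpins Λ (η - fun v : Λ => bump c v) τ =
      glueSpins Λ η τ - bump c := by
    intro η c
    funext v
    by_cases hv : v ∈ Λ
    · simp [glueSpins, hv]
    · simp [glueSpins, hv, hb0 c v hv]
  -- the colours of the clusters
  have hcol : ∀ η : {η // η ∈ compatSpins Λ τ ω}, ∃ c : Quotient s → Fin q,
      ∀ u : Δ, glueSpins Λ η.1 τ u = c ⟦u⟧ := by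
    intro η
    refine ⟨Quotient.lift (fun u : Δ => glueSpins Λ η.1 τ u) fun u v huv => ?_, fun u => rfl⟩
    exact eq_of_reachable (mem_compatSpins.1 η.2) (hcut u u.2 v huv)
  choose col hcol using hcol
  -- Adding `bump c` permutes the compatible spins, since it vanishes off `Λ` and is constant on
  -- clusters. Averaging over `c` then makes the colours on `Δ` independent and uniform.
  have hshift : ∀ c : Quotient s → Fin q,
      ∑ η ∈ compatSpins Λ τ ω, F (fun u => glueSpins Λ η τ u) =
        ∑ η ∈ compatSpins Λ τ ω, F (fun u => glueSpins Λ η τ u + c ⟦u⟧) := by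
    intro c
    symm
    refine Finset.sum_bij' (fun η _ => η + fun v : Λ => bump c v)
      (fun η _ => η - fun v : Λ => bump c v) ?_ ?_ ?_ ?_ ?_
    · intro η hη
      rw [mem_compatSpins] at *
      rw [hglue]
      exact AddSubgroup.add_mem _ hη (hbinv c)
    · intro η hη
      rw [mem_compatSpins] at *
      rw [hglue']
      exact AddSubgroup.sub_mem _ hη (hbinv c)
    · intro η _; simp
    · intro η _; simp
    · intro η _
      rw [hglue]
      congr 1
      funext u
      rw [Pi.add_apply, hbump]
  have hsum : (Fintype.card (Quotient s → Fin q) : ℝ) *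
      ∑ η ∈ compatSpins Λ τ ω, F (fun u => glueSpins Λ η τ u) =
      (compatSpins Λ τ ω).card * ∑ c : Quotient s → Fin q, F fun u => c ⟦u⟧ := by
    calc (Fintype.card (Quotient s → Fin q) : ℝ) *
        ∑ η ∈ compatSpins Λ τ ω, F (fun u => glueSpins Λ η τ u)
        = ∑ c : Quotient s → Fin q, ∑ η ∈ compatSpins Λ τ ω,
            F (fun u => glueSpins Λ η τ u + c ⟦u⟧) := by
          rw [← Finset.sum_congr rfl fun c _ => hshift c, Finset.sum_const, nsmul_eq_mul,
            Finset.card_univ]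
      _ = ∑ η ∈ compatSpins Λ τ ω, ∑ c : Quotient s → Fin q, F fun u => c ⟦u⟧ := by
          rw [Finset.sum_comm]
          refine Finset.sum_congr rfl fun η hη => ?_
          refine Fintype.sum_equiv (Equiv.addLeft (col ⟨η, hη⟩)) _ _ fun c => ?_
          congr 1
          funext u
          rw [hcol ⟨η, hη⟩]
          rfl
      _ = _ := by rw [Finset.sum_const, nsmul_eq_mul]
  have hN : ((compatSpins Λ τ ω).card : ℝ) ≠ 0 := by exact_mod_cast hne.card_pos.ne'
  have hQ : (Fintype.card (Quotient s → Fin q) : ℝ) ≠ 0 := by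
    exact_mod_cast Fintype.card_ne_zero
  unfold compatAvg colAvg classAvg
  rw [smul_eq_mul, div_eq_iff hN, ← hs]
  field_simp
  linarith [hsum]

theorem abs_colAvg_le {Δ : Finset (Site d)} {F : (Δ → Fin q) → ℝ} {M : ℝ} (hF : ∀ s, |F s| ≤ M)
    (ω : EdgeConfig d) : |colAvg F ω| ≤ M := by
  classical
  unfold colAvg classAvg
  rw [smul_eq_mul, abs_mul, abs_inv, Nat.abs_cast, inv_mul_le_iff₀
    (by exact_mod_cast Fintype.card_pos)]
  calc |∑ c : Quotient (reachSetoid Δ ω) → Fin q, F fun u => c ⟦u⟧|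
      ≤ ∑ c : Quotient (reachSetoid Δ ω) → Fin q, |F fun u => c ⟦u⟧| :=
        Finset.abs_sum_le_sum_abs _ _
    _ ≤ ∑ c : Quotient (reachSetoid Δ ω) → Fin q, M := Finset.sum_le_sum fun _ _ => hF _
    _ = _ := by rw [Finset.sum_const, nsmul_eq_mul, Finset.card_univ]

/-- The cluster average, with the clusters explored only inside the box of radius `r`. -/
noncomputable def localColAvg {Δ : Finset (Site d)} (F : (Δ → Fin q) → ℝ) (r : ℕ)
    (ω : EdgeConfig d) : ℝ :=
  colAvg F (cut (touchEdges (box d r)) ω)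

theorem dependsOn_localColAvg {Δ : Finset (Site d)} (F : (Δ → Fin q) → ℝ) (r : ℕ) :
    DependsOn (localColAvg F r) (touchEdges (box d r) : Set (Edge d)) :=
  dependsOn_cut _ (colAvg F)

theorem reachSetoid_cut {Λ Δ : Finset (Site d)} {ω : EdgeConfig d}
    (hω : ∀ u ∈ Δ, ω ∉ exitEvent Λ u) :
    reachSetoid Δ (cut (touchEdges Λ) ω) = reachSetoid Δ ω := by
  ext u v
  refine ⟨fun h => reachable_mono (cut_le _ _) h, fun h => reachable_cut_of_forall_mem
    (fun z hz => ?_) h⟩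
  by_contra hzΛ
  exact hω u u.2 ⟨z, hzΛ, reachable_mono (cut_le _ _) hz⟩

theorem eventually_reachSetoid_cut (Δ : Finset (Site d)) (ω : EdgeConfig d) :
    ∀ᶠ r in atTop, reachSetoid Δ (cut (touchEdges (box d r)) ω) = reachSetoid Δ ω := by
  have h : ∀ u v : Δ, ∀ᶠ r in atTop,
      ((openGraph (cut (touchEdges (box d r)) ω)).Reachable (u : Site d) v ↔
        (openGraph ω).Reachable (u : Site d) v) := by
    intro u v
    by_cases huv : (openGraph ω).Reachable (u : Site d) v
    · obtain ⟨n, hn⟩ := reachable_iff_exists_cut.1 huv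
      filter_upwards [eventually_ge_atTop n] with r hr
      simp only [huv, iff_true]
      exact reachable_mono (cut_mono_left (touchEdges_mono (box_mono hr)) ω) hn
    · refine Eventually.of_forall fun r => ?_
      simp only [huv, iff_false]
      exact fun h => huv (reachable_mono (cut_le _ _) h)
  have h2 := eventually_all.2 fun u : Δ => eventually_all.2 fun v : Δ => h u v
  filter_upwards [h2] with r hr
  ext u v
  exact hr u v

theorem tendsto_localColAvg {Δ : Finset (Site d)} (F : (Δ → Fin q) → ℝ) (ω : EdgeConfig d) :
    Tendsto (fun r => localColAvg F r ω) atTop (𝓝 (colAvg F ω)) := by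
  refine tendsto_const_nhds.congr' ?_
  filter_upwards [eventually_reachSetoid_cut Δ ω] with r hr
  unfold localColAvg colAvg
  rw [hr]

theorem measurable_colAvg {Δ : Finset (Site d)} (F : (Δ → Fin q) → ℝ) :
    Measurable (colAvg (d := d) F) :=
  measurable_of_tendsto_metrizable (fun r => measurable_of_dependsOn (dependsOn_localColAvg F r))
    (tendsto_pi_nhds.2 (tendsto_localColAvg F))

end

section

variable {d q : ℕ}

/-! ### Uniform convergence of the Gibbs kernels -/

/-- The number of sites of `Δ` which are joined to the complement of `Λ`. -/
noncomputable def exitSum (Λ Δ : Finset (Site d)) (ω : EdgeConfig d) : ℝ :=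
  ∑ u ∈ Δ, (exitEvent Λ u).indicator 1 ω

theorem exitSum_nonneg (Λ Δ : Finset (Site d)) (ω : EdgeConfig d) : 0 ≤ exitSum Λ Δ ω :=
  Finset.sum_nonneg fun _ _ => Set.indicator_nonneg (fun _ _ => zero_le_one) _

theorem one_le_exitSum {Λ Δ : Finset (Site d)} {ω : EdgeConfig d} {u : Site d} (hu : u ∈ Δ)
    (h : ω ∈ exitEvent Λ u) : 1 ≤ exitSum Λ Δ ω := by
  have h1 : (exitEvent Λ u).indicator (1 : EdgeConfig d → ℝ) ω = 1 := by
    rw [Set.indicator_of_mem h]; rfl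
  rw [← h1]
  exact Finset.single_le_sum
    (f := fun u => (exitEvent Λ u).indicator (1 : EdgeConfig d → ℝ) ω)
    (fun _ _ => Set.indicator_nonneg (fun _ _ => zero_le_one) _) hu

theorem exitSum_mono (Λ Δ : Finset (Site d)) : Monotone (exitSum Λ Δ) := fun _ _ h =>
  Finset.sum_le_sum fun u _ => monotone_indicator (isUpperSet_exitEvent Λ u) h

theorem dependsOn_exitSum (Λ Δ : Finset (Site d)) :
    DependsOn (exitSum Λ Δ) (touchEdges Λ : Set (Edge d)) := fun _ _ h =>
  Finset.sum_congr rfl fun u _ => dependsOn_indicator (dependsOn_exitEvent Λ u) h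

theorem exitEvent_anti {Λ Λ' : Finset (Site d)} (h : Λ ⊆ Λ') (u : Site d) :
    exitEvent Λ' u ⊆ exitEvent Λ u := fun _ ⟨y, hy, hr⟩ => ⟨y, fun hy' => hy (h hy'), hr⟩

theorem exists_abs_le_of_finite {α : Type*} [Fintype α] (F : α → ℝ) : ∃ M, 0 ≤ M ∧ ∀ s, |F s| ≤ M :=
  ⟨∑ s, |F s|, Finset.sum_nonneg fun _ _ => abs_nonneg _, fun s =>
    Finset.single_le_sum (f := fun s => |F s|) (fun _ _ => abs_nonneg _) (Finset.mem_univ s)⟩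

variable [NeZero q]

theorem integral_exitSum (x : ℝ) (Λ Δ : Finset (Site d)) :
    ∫ ω, exitSum Λ Δ ω ∂(rcInf d q x : Measure (EdgeConfig d)) =
      ∑ u ∈ Δ, (rcInf d q x : Measure (EdgeConfig d)).real (exitEvent Λ u) := by
  unfold exitSum
  rw [integral_finsetSum]
  · exact Finset.sum_congr rfl fun u _ => integral_indicator_one (measurableSet_exitEvent Λ u)
  · exact fun u _ => integrable_of_dependsOn (dependsOn_indicator (dependsOn_exitEvent Λ u)) _

theorem tendsto_integral_exitSum {x : ℝ} (hx : 0 ≤ x) (h : FastDecay d q x)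
    (Δ : Finset (Site d)) :
    Tendsto (fun r => ∫ ω, exitSum (box d r) Δ ω ∂(rcInf d q x : Measure (EdgeConfig d))) atTop
      (𝓝 0) := by
  simp_rw [integral_exitSum]
  rw [← Finset.sum_const_zero (s := Δ)]
  exact tendsto_finsetSum _ fun u _ => tendsto_exitEvent_box hx h u

/-- The event varies with the volume, so weak convergence alone is not enough. Leaving the box of
radius `t` implies leaving a fixed box of radius `m`, and `m` is chosen before `t` grows. -/
theorem tendsto_rcMean_exit {x : ℝ} (hx : 0 ≤ x) (h : FastDecay d q x) (u : Site d) :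
    Tendsto (fun t => rcMean q x (touchEdges (box d t)) ((exitEvent (box d t) u).indicator 1))
      atTop (𝓝 0) := by
  rw [Metric.tendsto_atTop]
  intro ε hε
  obtain ⟨m, hm⟩ := ((tendsto_exitEvent_box hx h u).eventually (gt_mem_nhds hε)).exists
  have h1 := (tendsto_rcMean (q := q) hx
    (dependsOn_indicator (dependsOn_exitEvent (box d m) u))).comp (tendsto_touchEdges_box (d := d))
  rw [integral_indicator_one (measurableSet_exitEvent (box d m) u)] at h1
  obtain ⟨N, hN⟩ := eventually_atTop.1 (h1.eventually (gt_mem_nhds hm))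
  refine ⟨max N m, fun t ht => ?_⟩
  have h0 : 0 ≤ rcMean q x (touchEdges (box d t)) ((exitEvent (box d t) u).indicator 1) :=
    rcMean_nonneg hx fun ω => Set.indicator_nonneg (fun _ _ => zero_le_one) _
  rw [Real.dist_eq, sub_zero, abs_of_nonneg h0]
  refine lt_of_le_of_lt (rcMean_mono hx fun ω => ?_) (hN t (le_of_max_le_left ht))
  exact Set.indicator_le_indicator_of_subset
    (exitEvent_anti (box_mono (le_of_max_le_right ht)) u) (fun _ => zero_le_one) ω

theorem exists_edge_bound (hd : 2 ≤ d) {x : ℝ} (hx : 0 ≤ x) (h : FastDecay d q x) (e : Edge d) :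
    ∃ δ : ℕ → ℝ, Tendsto δ atTop (𝓝 0) ∧ ∀ t (τ : SpinConfig d q),
      rcMean q x (touchEdges (box d t)) (openInd e) - spinMean x (box d t) τ (openInd e) ≤ δ t := by
  obtain ⟨e, he⟩ := e
  induction e using Sym2.ind with | _ u v => ?_
  refine ⟨_, ?_, fun t τ => rcMean_openInd_le hd hx t τ he⟩
  simpa using (tendsto_rcMean_exit hx h u).add (tendsto_rcMean_exit hx h v)

/-- Adding `C` times the number of open edges of `J` makes both `f` and `-f` increasing. Domination
then bounds the influence of `τ` on `f` by its influence on single edges. -/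
theorem abs_rcMean_sub_spinMean_le (hd : 2 ≤ d) {x : ℝ} (hx : 0 ≤ x) (t : ℕ) (τ : SpinConfig d q)
    {J : Finset (Edge d)} {f : EdgeConfig d → ℝ} (hf : DependsOn f (J : Set (Edge d))) {C : ℝ}
    (hC : ∀ a b, f a - f b ≤ C) :
    |rcMean q x (touchEdges (box d t)) f - spinMean x (box d t) τ f| ≤
      C * ∑ e ∈ J, (rcMean q x (touchEdges (box d t)) (openInd e) -
        spinMean x (box d t) τ (openInd e)) := by
  have key : ∀ g : EdgeConfig d → ℝ, DependsOn g (J : Set (Edge d)) → (∀ a b, g a - g b ≤ C) →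
      spinMean x (box d t) τ g - rcMean q x (touchEdges (box d t)) g ≤
      C * ∑ e ∈ J, (rcMean q x (touchEdges (box d t)) (openInd e) -
        spinMean x (box d t) τ (openInd e)) := by
    intro g hg hgC
    have h := spinMean_le_rcMean hd hx (t := t) τ (monotone_add_sum_openInd hg hgC)
    rw [Finset.sum_sub_distrib, mul_sub]
    unfold spinMean rcMean at *
    rw [wmean_add, wmean_add, wmean_const_mul, wmean_const_mul, wmean_sum, wmean_sum] at h
    linarith
  have h1 := key f hf hC
  have h2 := key (fun ω => (-1) * f ω) (fun a b hab => by simp only [hf hab]) fun a b => by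
    have := hC b a
    linarith
  unfold spinMean rcMean at h2 h1 ⊢
  rw [wmean_const_mul, wmean_const_mul] at h2
  rw [abs_le]
  constructor <;> linarith

theorem abs_localColAvg_sub_le {Δ : Finset (Site d)} {F : (Δ → Fin q) → ℝ} {M : ℝ} (hM : 0 ≤ M)
    (hF : ∀ s, |F s| ≤ M) (r : ℕ) (ω : EdgeConfig d) :
    |localColAvg F r ω - colAvg F ω| ≤ 2 * M * exitSum (box d r) Δ ω := by
  by_cases h : ∀ u ∈ Δ, ω ∉ exitEvent (box d r) u
  · unfold localColAvg colAvg
    rw [reachSetoid_cut h, sub_self, abs_zero]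
    exact mul_nonneg (by positivity) (exitSum_nonneg _ _ _)
  · push Not at h
    obtain ⟨u, hu, h⟩ := h
    have h1 := one_le_exitSum hu h
    have h2 : |localColAvg F r ω - colAvg F ω| ≤ M + M :=
      (abs_sub _ _).trans (add_le_add (abs_colAvg_le hF _) (abs_colAvg_le hF _))
    nlinarith

/-- Unless some site of `Δ` leaves the box of radius `r`, the two averages are the same colouring of
the same clusters. Otherwise `exitSum` is at least 1 and `2 * M` is a trivial bound. -/
theorem abs_compatAvg_sub_le {Δ : Finset (Site d)} {F : (Δ → Fin q) → ℝ} {M : ℝ} (hM : 0 ≤ M)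
    (hF : ∀ s, |F s| ≤ M) {r t : ℕ} (hrt : r ≤ t) (τ : SpinConfig d q) (ω : EdgeConfig d)
    (hne : (compatSpins (box d t) τ ω).Nonempty) :
    |compatAvg (box d t) τ (fun σ => F fun u => σ u) ω - localColAvg F r ω| ≤
      2 * M * exitSum (box d r) Δ ω := by
  by_cases h : ∀ u ∈ Δ, ω ∉ exitEvent (box d r) u
  · rw [compatAvg_eq_colAvg (fun u hu h' => h u hu (exitEvent_anti (box_mono hrt) u h')) hne]
    unfold localColAvg colAvg
    rw [reachSetoid_cut h, sub_self, abs_zero]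
    exact mul_nonneg (by positivity) (exitSum_nonneg _ _ _)
  · push Not at h
    obtain ⟨u, hu, h⟩ := h
    have h1 := one_le_exitSum hu h
    have h2 : |compatAvg (box d t) τ (fun σ => F fun u => σ u) ω - localColAvg F r ω| ≤ M + M :=
      (abs_sub _ _).trans (add_le_add (abs_compatAvg_le (fun _ => hF _) _) (abs_colAvg_le hF _))
    nlinarith

open Classical in
/-- Configurations without compatible spins do not contribute to `spinMean`. -/
theorem spinMean_eq_ite (x : ℝ) (Λ : Finset (Site d)) (τ : SpinConfig d q)
    (f : EdgeConfig d → ℝ) :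
    spinMean x Λ τ f =
      spinMean x Λ τ (fun ω => if (compatSpins Λ τ ω).Nonempty then f ω else 0) := by
  unfold spinMean wmean
  congr 1
  refine Finset.sum_congr rfl fun ω _ => ?_
  beta_reduce
  by_cases h : (compatSpins Λ τ ω).Nonempty
  · rw [if_pos h]
  · rw [if_neg h, spinWeight, Finset.not_nonempty_iff_eq_empty.1 h]
    simp

theorem abs_spinMean_sub_le {x : ℝ} (hx : 0 ≤ x) {Λ : Finset (Site d)} {τ : SpinConfig d q}
    {f g k : EdgeConfig d → ℝ} (hk : ∀ ω, 0 ≤ k ω)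
    (hfg : ∀ ω, (compatSpins Λ τ ω).Nonempty → |f ω - g ω| ≤ k ω) :
    |spinMean x Λ τ f - spinMean x Λ τ g| ≤ spinMean x Λ τ k := by
  classical
  rw [spinMean_eq_ite x Λ τ f, spinMean_eq_ite x Λ τ g]
  refine abs_wmean_sub_le (fun _ _ => spinWeight_nonneg hx _ _ _) fun ω _ => ?_
  split_ifs with h
  · exact hfg ω h
  · rw [sub_self, abs_zero]
    exact hk ω

theorem abs_spinMean_compatAvg_sub_le (hd : 2 ≤ d) {x : ℝ} (hx : 0 ≤ x) {Δ : Finset (Site d)}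
    {F : (Δ → Fin q) → ℝ} {M : ℝ} (hM : 0 ≤ M)
    (hF : ∀ s, |F s| ≤ M) {r t : ℕ} (hrt : r ≤ t) (τ : SpinConfig d q) :
    |spinMean x (box d t) τ (compatAvg (box d t) τ (fun σ => F fun u => σ u)) -
      spinMean x (box d t) τ (localColAvg F r)| ≤
        2 * M * rcMean q x (touchEdges (box d t)) (exitSum (box d r) Δ) := by
  have h1 : |spinMean x (box d t) τ (compatAvg (box d t) τ (fun σ => F fun u => σ u)) -
      spinMean x (box d t) τ (localColAvg F r)| ≤
      spinMean x (box d t) τ (fun ω => 2 * M * exitSum (box d r) Δ ω) := by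
    exact abs_spinMean_sub_le hx (fun ω => mul_nonneg (by positivity) (exitSum_nonneg _ _ _))
      fun ω hω => abs_compatAvg_sub_le hM hF hrt τ ω hω
  refine h1.trans ?_
  have h2 := spinMean_le_rcMean hd hx (t := t) τ (exitSum_mono (box d r) Δ)
  have h3 : spinMean x (box d t) τ (fun ω => 2 * M * exitSum (box d r) Δ ω) =
      2 * M * spinMean x (box d t) τ (exitSum (box d r) Δ) := wmean_const_mul _ _ _ _
  have hM2 : 0 ≤ 2 * M := by linarith
  rw [h3]
  exact mul_le_mul_of_nonneg_left h2 hM2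

theorem abs_integral_localColAvg_sub_le {x : ℝ} {Δ : Finset (Site d)}
    {F : (Δ → Fin q) → ℝ} {M : ℝ} (hM : 0 ≤ M) (hF : ∀ s, |F s| ≤ M) (r : ℕ) :
    |∫ ω, localColAvg F r ω ∂(rcInf d q x : Measure (EdgeConfig d)) -
      ∫ ω, colAvg F ω ∂(rcInf d q x : Measure (EdgeConfig d))| ≤
        2 * M * ∫ ω, exitSum (box d r) Δ ω ∂(rcInf d q x : Measure (EdgeConfig d)) := by
  have hi : Integrable (colAvg (d := d) F) (rcInf d q x : Measure (EdgeConfig d)) :=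
    Integrable.of_bound (measurable_colAvg F).aestronglyMeasurable M
      (Eventually.of_forall fun ω => abs_colAvg_le hF ω)
  have hi' := integrable_of_dependsOn (dependsOn_localColAvg F r)
    (rcInf d q x : Measure (EdgeConfig d))
  have hi'' := integrable_of_dependsOn (dependsOn_exitSum (box d r) Δ)
    (rcInf d q x : Measure (EdgeConfig d))
  rw [← integral_sub hi' hi, ← integral_const_mul]
  refine (abs_integral_le_integral_abs).trans (integral_mono (hi'.sub hi).abs
    (hi''.const_mul _) fun ω => abs_localColAvg_sub_le hM hF r ω)

/-- The Gibbs kernels converge, uniformly in the boundary condition. -/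
theorem tendstoUniformly_gibbsKernel (hd : 2 ≤ d) {β : ℝ} (hβ : 0 ≤ β)
    (h : FastDecay d q (Real.exp (2 * β) - 1)) {Δ : Finset (Site d)} (F : (Δ → Fin q) → ℝ) :
    TendstoUniformly
      (fun t (τ : SpinConfig d q) => gibbsKernel β (box d t) (fun σ => F fun u => σ u) τ)
      (fun _ => ∫ ω, colAvg F ω ∂(rcInf d q (Real.exp (2 * β) - 1) : Measure (EdgeConfig d)))
      atTop := by
  have hx : 0 ≤ Real.exp (2 * β) - 1 := by
    have := Real.one_le_exp (x := 2 * β) (by positivity)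
    linarith
  have hES : ∀ t (τ : SpinConfig d q), gibbsKernel β (box d t) (fun σ => F fun u => σ u) τ =
      spinMean (Real.exp (2 * β) - 1) (box d t) τ
        (compatAvg (box d t) τ fun σ => F fun u => σ u) := fun t τ => gibbsKernel_eq_spinMean _ _ _ _
  simp_rw [hES]
  generalize Real.exp (2 * β) - 1 = x at *
  obtain ⟨M, hM, hF⟩ := exists_abs_le_of_finite F
  rw [Metric.tendstoUniformly_iff]
  intro ε hε
  -- Cluster exploration is truncated to radius `r` twice, in the box and in infinite volume, each
  -- at a cost of `2 * M` times the mean of `exitSum`. So `r` is fixed first and `t` is sent to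
  -- infinity afterwards.
  have hA : Tendsto (fun r => 4 * M *
      ∫ ω, exitSum (box d r) Δ ω ∂(rcInf d q x : Measure (EdgeConfig d))) atTop (𝓝 0) := by
    simpa using (tendsto_integral_exitSum hx h Δ).const_mul (4 * M)
  obtain ⟨r, hr⟩ := (hA.eventually (gt_mem_nhds hε)).exists
  choose δ hδ hδ' using exists_edge_bound (q := q) hd hx h
  have hB : Tendsto (fun t =>
      2 * M * rcMean q x (touchEdges (box d t)) (exitSum (box d r) Δ) +
      2 * M * ∑ e ∈ touchEdges (box d r), δ e t +
      |rcMean q x (touchEdges (box d t)) (localColAvg F r) -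
        ∫ ω, localColAvg F r ω ∂(rcInf d q x : Measure (EdgeConfig d))| +
      2 * M * ∫ ω, exitSum (box d r) Δ ω ∂(rcInf d q x : Measure (EdgeConfig d))) atTop
      (𝓝 (2 * M * ∫ ω, exitSum (box d r) Δ ω ∂(rcInf d q x : Measure (EdgeConfig d)) +
        2 * M * ∑ e ∈ touchEdges (box d r), 0 + |(0 : ℝ)| +
        2 * M * ∫ ω, exitSum (box d r) Δ ω ∂(rcInf d q x : Measure (EdgeConfig d)))) := by
    refine ((Tendsto.add ?_ ?_).add ?_).add tendsto_const_nhds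
    · exact ((tendsto_rcMean hx (dependsOn_exitSum (box d r) Δ)).comp
        tendsto_touchEdges_box).const_mul _
    · exact (tendsto_finsetSum _ fun e _ => hδ e).const_mul _
    · refine Tendsto.abs ?_
      rw [← sub_self (∫ ω, localColAvg F r ω ∂(rcInf d q x : Measure (EdgeConfig d)))]
      exact ((tendsto_rcMean hx (dependsOn_localColAvg F r)).comp
        tendsto_touchEdges_box).sub tendsto_const_nhds
  have hlim : 2 * M * ∫ ω, exitSum (box d r) Δ ω ∂(rcInf d q x : Measure (EdgeConfig d)) +
        2 * M * ∑ e ∈ touchEdges (box d r), 0 + |(0 : ℝ)| +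
        2 * M * ∫ ω, exitSum (box d r) Δ ω ∂(rcInf d q x : Measure (EdgeConfig d)) < ε := by
    rw [Finset.sum_const_zero, abs_zero]
    linarith
  filter_upwards [hB.eventually (gt_mem_nhds hlim), eventually_ge_atTop r] with t ht hrt τ
  refine lt_of_le_of_lt ?_ ht
  rw [dist_comm, Real.dist_eq]
  have b1 := abs_spinMean_compatAvg_sub_le hd hx hM hF hrt τ
  have b2 := abs_rcMean_sub_spinMean_le hd hx t τ (dependsOn_localColAvg F r) (C := 2 * M)
    fun a b => by
      have h1 : |localColAvg F r a| ≤ M := abs_colAvg_le hF _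
      have h2 : |localColAvg F r b| ≤ M := abs_colAvg_le hF _
      rw [abs_le] at h1 h2
      linarith
  have b3 : 2 * M * ∑ e ∈ touchEdges (box d r),
      (rcMean q x (touchEdges (box d t)) (openInd e) - spinMean x (box d t) τ (openInd e)) ≤
      2 * M * ∑ e ∈ touchEdges (box d r), δ e t :=
    mul_le_mul_of_nonneg_left (Finset.sum_le_sum fun e _ => hδ' e t τ) (by positivity)
  have b4 := abs_integral_localColAvg_sub_le (x := x) hM hF r
  have b2' := b2.trans b3
  clear b2 b3 ht hlim hB hA
  generalize spinMean x (box d t) τ (compatAvg (box d t) τ fun σ => F fun u => σ u) = a1 at *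
  generalize spinMean x (box d t) τ (localColAvg F r) = a2 at *
  generalize rcMean q x (touchEdges (box d t)) (localColAvg F r) = a3 at *
  generalize ∫ ω, localColAvg F r ω ∂(rcInf d q x : Measure (EdgeConfig d)) = a4 at *
  generalize ∫ ω, colAvg F ω ∂(rcInf d q x : Measure (EdgeConfig d)) = a5 at *
  have t1 : |a1 - a5| ≤ |a1 - a2| + |a3 - a2| + |a3 - a4| + |a4 - a5| := by
    rw [abs_sub_comm a3 a2]
    have := abs_add_le (a1 - a2 + (a2 - a3) + (a3 - a4)) (a4 - a5)
    have := abs_add_three (a1 - a2) (a2 - a3) (a3 - a4)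
    have : a1 - a5 = a1 - a2 + (a2 - a3) + (a3 - a4) + (a4 - a5) := by ring
    rw [this]
    linarith
  linarith

end

section

variable {d q : ℕ}

/-! ### Gibbs measures -/

theorem glueSpins_glueSpins (Λ : Finset (Site d)) (η ξ : Λ → Fin q) (σ : SpinConfig d q) :
    glueSpins Λ η (glueSpins Λ ξ σ) = glueSpins Λ η σ := by
  funext v
  by_cases hv : v ∈ Λ <;> simp [glueSpins, hv]

theorem glueSpins_congr {Λ : Finset (Site d)} (η : Λ → Fin q) {σ σ' : SpinConfig d q}
    (h : ∀ v ∉ Λ, σ v = σ' v) : glueSpins Λ η σ = glueSpins Λ η σ' := by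
  funext v
  by_cases hv : v ∈ Λ
  · simp [glueSpins, hv]
  · simp [glueSpins, hv, h v hv]

/-- The sites whose spins enter the Hamiltonian in `Λ`. -/
noncomputable def touchSites (Λ : Finset (Site d)) : Finset (Site d) :=
  (finite_endpoints (touchEdges Λ)).toFinset

theorem dependsOn_hamiltonian (β : ℝ) (Λ : Finset (Site d)) :
    DependsOn (hamiltonian (q := q) β Λ) (touchSites Λ : Set (Site d)) := by
  classical
  intro σ σ' h
  rw [hamiltonian_eq, hamiltonian_eq]
  congr 1
  refine Finset.sum_congr rfl fun e he => ?_
  have h' : ∀ u ∈ (e : Sym2 (Site d)), σ u = σ' u := fun u hu =>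
    h u (by rw [touchSites, Set.Finite.coe_toFinset]; exact ⟨e, he, hu⟩)
  refine if_congr ?_ rfl rfl
  constructor
  · rintro ⟨u, hu, v, hv, huv⟩
    exact ⟨u, hu, v, hv, by rwa [← h' u hu, ← h' v hv]⟩
  · rintro ⟨u, hu, v, hv, huv⟩
    exact ⟨u, hu, v, hv, by rwa [h' u hu, h' v hv]⟩

/-- For `Λ ⊆ Γ`, the difference of the Hamiltonians does not depend on the spins in `Λ`. -/
theorem hamiltonian_sub_congr (β : ℝ) {Λ Γ : Finset (Site d)} (hΛ : Λ ⊆ Γ)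
    {σ σ' : SpinConfig d q} (h : ∀ v ∉ Λ, σ v = σ' v) :
    hamiltonian β Γ σ - hamiltonian β Λ σ = hamiltonian β Γ σ' - hamiltonian β Λ σ' := by
  classical
  simp only [hamiltonian_eq]
  rw [← mul_sub, ← mul_sub, ← Finset.sum_sdiff (touchEdges_mono hΛ),
    ← Finset.sum_sdiff (touchEdges_mono hΛ), add_sub_cancel_right, add_sub_cancel_right]
  congr 1
  refine Finset.sum_congr rfl fun e he => ?_
  rw [Finset.mem_sdiff, mem_touchEdges (Λ := Λ)] at he
  have h' : ∀ u ∈ (e : Sym2 (Site d)), σ u = σ' u := fun u hu =>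
    h u fun huΛ => he.2 ⟨u, hu, huΛ⟩
  refine if_congr ?_ rfl rfl
  constructor
  · rintro ⟨u, hu, v, hv, huv⟩
    exact ⟨u, hu, v, hv, by rwa [← h' u hu, ← h' v hv]⟩
  · rintro ⟨u, hu, v, hv, huv⟩
    exact ⟨u, hu, v, hv, by rwa [h' u hu, h' v hv]⟩

variable [NeZero q]

/-- The partition function. -/
noncomputable def gibbsZ (β : ℝ) (Λ : Finset (Site d)) (τ : SpinConfig d q) : ℝ :=
  ∑ η : Λ → Fin q, Real.exp (-hamiltonian β Λ (glueSpins Λ η τ))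

theorem gibbsZ_pos (β : ℝ) (Λ : Finset (Site d)) (τ : SpinConfig d q) : 0 < gibbsZ β Λ τ :=
  Finset.sum_pos (fun _ _ => Real.exp_pos _) Finset.univ_nonempty

theorem gibbsZ_congr (β : ℝ) {Λ : Finset (Site d)} {τ τ' : SpinConfig d q}
    (h : ∀ v ∉ Λ, τ v = τ' v) : gibbsZ β Λ τ = gibbsZ β Λ τ' := by
  unfold gibbsZ
  exact Finset.sum_congr rfl fun η _ => by rw [glueSpins_congr η h]

/-- The probability of the spins `η` given the boundary condition `τ`. -/
noncomputable def gibbsWeight (β : ℝ) (Λ : Finset (Site d)) (η : Λ → Fin q)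
    (τ : SpinConfig d q) : ℝ :=
  Real.exp (-hamiltonian β Λ (glueSpins Λ η τ)) / gibbsZ β Λ τ

theorem gibbsWeight_nonneg (β : ℝ) (Λ : Finset (Site d)) (η : Λ → Fin q) (τ : SpinConfig d q) :
    0 ≤ gibbsWeight β Λ η τ := div_nonneg (Real.exp_pos _).le (gibbsZ_pos _ _ _).le

theorem sum_gibbsWeight (β : ℝ) (Λ : Finset (Site d)) (τ : SpinConfig d q) :
    ∑ η, gibbsWeight β Λ η τ = 1 := by
  unfold gibbsWeight
  rw [← Finset.sum_div]
  exact div_self (gibbsZ_pos β Λ τ).ne'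

theorem gibbsWeight_le_one (β : ℝ) (Λ : Finset (Site d)) (η : Λ → Fin q) (τ : SpinConfig d q) :
    gibbsWeight β Λ η τ ≤ 1 := by
  rw [← sum_gibbsWeight β Λ τ]
  exact Finset.single_le_sum (fun η _ => gibbsWeight_nonneg β Λ η τ) (Finset.mem_univ η)

theorem gibbsKernel_eq_sum (β : ℝ) (Λ : Finset (Site d)) (f : SpinConfig d q → ℝ)
    (τ : SpinConfig d q) :
    gibbsKernel β Λ f τ = ∑ η, gibbsWeight β Λ η τ * f (glueSpins Λ η τ) := by
  classical
  unfold gibbsKernel gibbsWeight gibbsZ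
  rw [Finset.sum_div]
  refine Finset.sum_congr (by congr!) fun η _ => ?_
  rw [div_mul_eq_mul_div]

theorem abs_gibbsKernel_le {β : ℝ} {Λ : Finset (Site d)} {f : SpinConfig d q → ℝ} {M : ℝ}
    (hf : ∀ σ, |f σ| ≤ M) (τ : SpinConfig d q) : |gibbsKernel β Λ f τ| ≤ M := by
  rw [gibbsKernel_eq_sum]
  calc |∑ η, gibbsWeight β Λ η τ * f (glueSpins Λ η τ)|
      ≤ ∑ η, |gibbsWeight β Λ η τ * f (glueSpins Λ η τ)| := Finset.abs_sum_le_sum_abs _ _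
    _ ≤ ∑ η, gibbsWeight β Λ η τ * M := Finset.sum_le_sum fun η _ => by
        rw [abs_mul, abs_of_nonneg (gibbsWeight_nonneg β Λ η τ)]
        exact mul_le_mul_of_nonneg_left (hf _) (gibbsWeight_nonneg β Λ η τ)
    _ = M := by rw [← Finset.sum_mul, sum_gibbsWeight, one_mul]

theorem dependsOn_gibbsWeight (β : ℝ) (Λ : Finset (Site d)) (η : Λ → Fin q) :
    DependsOn (gibbsWeight β Λ η) (touchSites Λ : Set (Site d)) := by
  intro τ τ' h
  have h' : ∀ η : Λ → Fin q, hamiltonian β Λ (glueSpins Λ η τ) =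
      hamiltonian β Λ (glueSpins Λ η τ') := fun η =>
    dependsOn_hamiltonian β Λ fun v hv => by
      by_cases hv' : v ∈ Λ
      · simp [glueSpins, hv']
      · simp [glueSpins, hv', h v hv]
  unfold gibbsWeight gibbsZ
  simp only [h']

theorem gibbsWeight_congr (β : ℝ) {Λ : Finset (Site d)} (η : Λ → Fin q) {τ τ' : SpinConfig d q}
    (h : ∀ v ∉ Λ, τ v = τ' v) : gibbsWeight β Λ η τ = gibbsWeight β Λ η τ' := by
  unfold gibbsWeight
  rw [gibbsZ_congr β h, glueSpins_congr η h]

open Classical in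
theorem dependsOn_gibbsKernel (β : ℝ) (Λ : Finset (Site d)) {J : Finset (Site d)}
    {f : SpinConfig d q → ℝ} (hf : DependsOn f (J : Set (Site d))) :
    DependsOn (gibbsKernel β Λ f) ((touchSites Λ ∪ J : Finset (Site d)) : Set (Site d)) := by
  intro τ τ' h
  rw [gibbsKernel_eq_sum, gibbsKernel_eq_sum]
  refine Finset.sum_congr rfl fun η _ => ?_
  rw [dependsOn_gibbsWeight β Λ η fun v hv => h v (by simp [Finset.mem_coe.1 hv]),
    hf fun v hv => ?_]
  by_cases hv' : v ∈ Λ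
  · simp [glueSpins, hv']
  · simp [glueSpins, hv', h v (by simp [Finset.mem_coe.1 hv])]

/-- The Gibbs kernels are consistent. -/
theorem gibbsKernel_gibbsKernel (β : ℝ) {Λ Γ : Finset (Site d)} (hΛ : Λ ⊆ Γ)
    (f : SpinConfig d q → ℝ) (τ : SpinConfig d q) :
    gibbsKernel β Γ (gibbsKernel β Λ f) τ = gibbsKernel β Γ f τ := by
  classical
  -- exchange the spins in `Λ`
  let T : (Γ → Fin q) × (Λ → Fin q) → (Γ → Fin q) × (Λ → Fin q) := fun p =>
    (fun v => glueSpins Λ p.2 (glueSpins Γ p.1 τ) v, fun v => p.1 ⟨v, hΛ v.2⟩)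
  have hT1 : ∀ p, glueSpins Γ (T p).1 τ = glueSpins Λ p.2 (glueSpins Γ p.1 τ) := fun p =>
    glueSpins_restrict (σ := glueSpins Λ p.2 (glueSpins Γ p.1 τ)) fun v hv => by
      rw [glueSpins_of_not_mem fun h => hv (hΛ h), glueSpins_of_not_mem hv]
  have hT2 : ∀ p, glueSpins Λ (T p).2 (glueSpins Γ (T p).1 τ) = glueSpins Γ p.1 τ := by
    intro p
    rw [hT1, glueSpins_glueSpins]
    funext v
    by_cases hv : v ∈ Λ
    · rw [glueSpins_of_mem hv, glueSpins_of_mem (hΛ hv)]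
    · rw [glueSpins_of_not_mem hv]
  have hTinv : Function.Involutive T := by
    intro p
    refine Prod.ext ?_ ?_
    · funext v
      change glueSpins Λ (T p).2 (glueSpins Γ (T p).1 τ) v = p.1 v
      rw [hT2, glueSpins_of_mem v.2]
    · funext v
      change glueSpins Λ p.2 (glueSpins Γ p.1 τ) v = p.2 v
      rw [glueSpins_of_mem v.2]
  have hoff : ∀ p v, v ∉ Λ → glueSpins Γ (T p).1 τ v = glueSpins Γ p.1 τ v := by
    intro p v hv
    rw [hT1, glueSpins_of_not_mem hv]
  -- Reversibility of the exchange: `H_Γ - H_Λ` is the same for both spin configurations because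
  -- they agree off `Λ`, and so is the partition function in `Λ`.
  have hw : ∀ p, gibbsWeight β Γ (T p).1 τ * gibbsWeight β Λ (T p).2 (glueSpins Γ (T p).1 τ) =
      gibbsWeight β Γ p.1 τ * gibbsWeight β Λ p.2 (glueSpins Γ p.1 τ) := by
    intro p
    have h1 := hamiltonian_sub_congr β hΛ (hoff p)
    unfold gibbsWeight
    rw [hT2, gibbsZ_congr β (hoff p), div_mul_div_comm, div_mul_div_comm, ← Real.exp_add,
      ← Real.exp_add, ← hT1 p]
    congr 2
    linarith
  rw [gibbsKernel_eq_sum, gibbsKernel_eq_sum]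
  simp_rw [gibbsKernel_eq_sum, Finset.mul_sum]
  rw [← Finset.sum_product' (f := fun (η : Γ → Fin q) (ξ : Λ → Fin q) => gibbsWeight β Γ η τ *
      (gibbsWeight β Λ ξ (glueSpins Γ η τ) * f (glueSpins Λ ξ (glueSpins Γ η τ)))),
    Finset.univ_product_univ, ← Equiv.sum_comp (hTinv.toPerm T)]
  have : ∀ p, gibbsWeight β Γ (hTinv.toPerm T p).1 τ *
      (gibbsWeight β Λ (hTinv.toPerm T p).2 (glueSpins Γ (hTinv.toPerm T p).1 τ) *
        f (glueSpins Λ (hTinv.toPerm T p).2 (glueSpins Γ (hTinv.toPerm T p).1 τ))) =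
      gibbsWeight β Γ p.1 τ * f (glueSpins Γ p.1 τ) * gibbsWeight β Λ p.2 (glueSpins Γ p.1 τ) := by
    intro p
    simp only [Function.Involutive.coe_toPerm]
    rw [hT2, ← mul_assoc, hw]
    ring
  rw [Finset.sum_congr rfl fun p _ => this p, ← Finset.univ_product_univ, Finset.sum_product]
  refine Finset.sum_congr rfl fun η _ => ?_
  dsimp only
  rw [← Finset.mul_sum, sum_gibbsWeight, mul_one]

/-! ### Measurability -/

theorem measurable_glueSpins (Λ : Finset (Site d)) (η : Λ → Fin q) :
    Measurable[cylinderEvents ((Λ : Set (Site d))ᶜ)] (glueSpins Λ η) := by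
  refine @measurable_pi_lambda _ _ _ (cylinderEvents ((Λ : Set (Site d))ᶜ)) _ _ fun v => ?_
  by_cases hv : v ∈ Λ
  · simp only [glueSpins_of_mem hv]
    exact measurable_const
  · simp only [glueSpins_of_not_mem hv]
    exact measurable_cylinderEvent_apply (by simpa using hv)

theorem measurable_gibbsWeight (β : ℝ) (Λ : Finset (Site d)) (η : Λ → Fin q) :
    Measurable[cylinderEvents ((Λ : Set (Site d))ᶜ)] (gibbsWeight β Λ η) := by
  have h : gibbsWeight β Λ η = gibbsWeight β Λ η ∘ glueSpins Λ η := by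
    funext τ
    exact gibbsWeight_congr β η fun v hv => (glueSpins_of_not_mem hv).symm
  rw [h]
  exact (measurable_of_dependsOn (dependsOn_gibbsWeight β Λ η)).comp (measurable_glueSpins Λ η)

theorem measurable_gibbsKernel (β : ℝ) (Λ : Finset (Site d)) {f : SpinConfig d q → ℝ}
    (hf : Measurable f) :
    Measurable[cylinderEvents ((Λ : Set (Site d))ᶜ)] (gibbsKernel β Λ f) := by
  have h : gibbsKernel β Λ f = fun τ => ∑ η, gibbsWeight β Λ η τ * f (glueSpins Λ η τ) :=
    funext fun τ => gibbsKernel_eq_sum β Λ f τ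
  rw [h]
  refine @Finset.measurable_fun_sum _ _ _ _ _ _ (cylinderEvents ((Λ : Set (Site d))ᶜ)) _ _
    fun η _ => ?_
  exact (measurable_gibbsWeight β Λ η).mul (hf.comp (measurable_glueSpins Λ η))

theorem mem_congr_of_cylinderEvents {Δ : Set (Site d)} {A : Set (SpinConfig d q)}
    (hA : MeasurableSet[cylinderEvents Δ] A) {σ σ' : SpinConfig d q} (h : ∀ v ∈ Δ, σ v = σ' v) :
    σ ∈ A ↔ σ' ∈ A := by
  -- Comparison with the preimage of the full power set under restriction to `Δ`, whose members
  -- visibly depend only on `Δ`.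
  have hle : cylinderEvents (X := fun _ : Site d => Fin q) Δ ≤
      MeasurableSpace.comap (fun (σ : SpinConfig d q) (v : Δ) => σ v) ⊤ := by
    refine iSup₂_le fun v hv => ?_
    rintro _ ⟨B, -, rfl⟩
    exact ⟨{f | f ⟨v, hv⟩ ∈ B}, trivial, rfl⟩
  obtain ⟨B, -, rfl⟩ := hle A hA
  have : (fun v : Δ => σ v) = fun v : Δ => σ' v := funext fun v => h v v.2
  simp only [Set.mem_preimage, this]

end

section

variable {d q : ℕ} [NeZero q]

/-! ### Existence and uniqueness of the Gibbs measure -/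

/-- The Gibbs measure in `Λ` with boundary condition `τ`. -/
noncomputable def gibbsMeasure (β : ℝ) (Λ : Finset (Site d)) (τ : SpinConfig d q) :
    Measure (SpinConfig d q) :=
  ∑ η, ENNReal.ofReal (gibbsWeight β Λ η τ) • Measure.dirac (glueSpins Λ η τ)

instance (β : ℝ) (Λ : Finset (Site d)) (τ : SpinConfig d q) :
    IsProbabilityMeasure (gibbsMeasure β Λ τ) := by
  constructor
  simp only [gibbsMeasure, Measure.coe_finsetSum, Finset.sum_apply, Measure.smul_apply,
    measure_univ, smul_eq_mul, mul_one]
  rw [← ENNReal.ofReal_sum_of_nonneg fun η _ => gibbsWeight_nonneg β Λ η τ, sum_gibbsWeight,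
    ENNReal.ofReal_one]

theorem integral_gibbsMeasure (β : ℝ) (Λ : Finset (Site d)) (τ : SpinConfig d q)
    (f : SpinConfig d q → ℝ) : ∫ σ, f σ ∂gibbsMeasure β Λ τ = gibbsKernel β Λ f τ := by
  rw [gibbsKernel_eq_sum, gibbsMeasure, integral_finsetSum_measure]
  · refine Finset.sum_congr rfl fun η _ => ?_
    rw [integral_smul_measure, integral_dirac, ENNReal.toReal_ofReal (gibbsWeight_nonneg _ _ _ _),
      smul_eq_mul]
  · intro η _
    exact (integrable_dirac (by simp)).smul_measure ENNReal.ofReal_ne_top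

/-- The Gibbs measure in `Λ` with boundary condition `τ`, as a probability measure. -/
noncomputable def gibbsProb (β : ℝ) (Λ : Finset (Site d)) (τ : SpinConfig d q) :
    ProbabilityMeasure (SpinConfig d q) :=
  ⟨gibbsMeasure β Λ τ, inferInstance⟩

theorem integral_gibbsProb (β : ℝ) (Λ : Finset (Site d)) (τ : SpinConfig d q)
    (f : SpinConfig d q → ℝ) :
    ∫ σ, f σ ∂(gibbsProb β Λ τ : Measure (SpinConfig d q)) = gibbsKernel β Λ f τ :=
  integral_gibbsMeasure β Λ τ f

/-- The average of the Gibbs measures in `Λ` over boundary conditions of law `μ`. -/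
noncomputable def averagedGibbs (β : ℝ) (Λ : Finset (Site d)) (μ : Measure (SpinConfig d q)) :
    Measure (SpinConfig d q) :=
  ∑ η, (μ.withDensity fun τ => ENNReal.ofReal (gibbsWeight β Λ η τ)).map (glueSpins Λ η)

theorem measurable_gibbsWeight_pi (β : ℝ) (Λ : Finset (Site d)) (η : Λ → Fin q) :
    Measurable (gibbsWeight β Λ η) :=
  measurable_of_dependsOn (dependsOn_gibbsWeight β Λ η)

theorem measurable_glueSpins_pi (Λ : Finset (Site d)) (η : Λ → Fin q) :
    Measurable (glueSpins Λ η) :=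
  (measurable_glueSpins Λ η).mono cylinderEvents_le_pi le_rfl

theorem isProbabilityMeasure_averagedGibbs (β : ℝ) (Λ : Finset (Site d))
    (μ : Measure (SpinConfig d q)) [IsProbabilityMeasure μ] :
    IsProbabilityMeasure (averagedGibbs β Λ μ) := by
  constructor
  simp only [averagedGibbs, Measure.coe_finsetSum, Finset.sum_apply]
  rw [Finset.sum_congr rfl fun η _ => by
    rw [Measure.map_apply (measurable_glueSpins_pi Λ η) MeasurableSet.univ, Set.preimage_univ,
      withDensity_apply _ MeasurableSet.univ, Measure.restrict_univ],
    ← lintegral_finsetSum _ fun η _ => (measurable_gibbsWeight_pi β Λ η).ennreal_ofReal]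
  simp_rw [← ENNReal.ofReal_sum_of_nonneg fun η _ => gibbsWeight_nonneg β Λ η _, sum_gibbsWeight]
  simp

theorem integral_averagedGibbs (β : ℝ) (Λ : Finset (Site d)) (μ : Measure (SpinConfig d q))
    [IsProbabilityMeasure μ] {f : SpinConfig d q → ℝ} (hf : Measurable f) {M : ℝ}
    (hM : ∀ σ, |f σ| ≤ M) :
    ∫ σ, f σ ∂averagedGibbs β Λ μ = ∫ τ, gibbsKernel β Λ f τ ∂μ := by
  have := isProbabilityMeasure_averagedGibbs β Λ μ
  have hw : ∀ η, Integrable (fun τ => gibbsWeight β Λ η τ * f (glueSpins Λ η τ)) μ := by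
    intro η
    refine Integrable.of_bound ((measurable_gibbsWeight_pi β Λ η).mul
      (hf.comp (measurable_glueSpins_pi Λ η))).aestronglyMeasurable M
      (Eventually.of_forall fun τ => ?_)
    rw [Real.norm_eq_abs, abs_mul, abs_of_nonneg (gibbsWeight_nonneg _ _ _ _)]
    calc gibbsWeight β Λ η τ * |f (glueSpins Λ η τ)| ≤ 1 * |f (glueSpins Λ η τ)| :=
          mul_le_mul_of_nonneg_right (gibbsWeight_le_one β Λ η τ) (abs_nonneg _)
      _ ≤ M := by rw [one_mul]; exact hM _
  simp_rw [gibbsKernel_eq_sum]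
  rw [integral_finsetSum _ fun η _ => hw η, averagedGibbs, integral_finsetSum_measure]
  · refine Finset.sum_congr rfl fun η _ => ?_
    rw [integral_map (measurable_glueSpins_pi Λ η).aemeasurable hf.aestronglyMeasurable,
      integral_withDensity_eq_integral_toReal_smul
        (measurable_gibbsWeight_pi β Λ η).ennreal_ofReal (by simp)]
    refine integral_congr_ae (Eventually.of_forall fun τ => ?_)
    simp [ENNReal.toReal_ofReal (gibbsWeight_nonneg _ _ _ _)]
  · intro η hη
    have hle : (μ.withDensity fun τ => ENNReal.ofReal (gibbsWeight β Λ η τ)).map (glueSpins Λ η) ≤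
        averagedGibbs β Λ μ := by
      rw [averagedGibbs]
      exact Finset.single_le_sum
        (f := fun η => (μ.withDensity fun τ => ENNReal.ofReal (gibbsWeight β Λ η τ)).map
          (glueSpins Λ η)) (fun _ _ => Measure.zero_le _) hη
    exact (Integrable.of_bound (μ := averagedGibbs β Λ μ) hf.aestronglyMeasurable M
      (Eventually.of_forall hM)).mono_measure hle

/-- A measure whose local averages are invariant under the Gibbs kernels is a Gibbs measure. -/
theorem isPottsGibbs_of_local {β : ℝ} {μ : ProbabilityMeasure (SpinConfig d q)}
    (h : ∀ (Λ J : Finset (Site d)) (f : SpinConfig d q → ℝ), DependsOn f (J : Set (Site d)) →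
      ∫ σ, gibbsKernel β Λ f σ ∂(μ : Measure (SpinConfig d q)) =
        ∫ σ, f σ ∂(μ : Measure (SpinConfig d q))) : IsPottsGibbs β μ := by
  -- Invariance tested on local events determines the averaged measure, and so extends to all
  -- bounded measurable functions.
  have hav : ∀ Λ, averagedGibbs β Λ (μ : Measure (SpinConfig d q)) = μ := by
    intro Λ
    have := isProbabilityMeasure_averagedGibbs β Λ (μ : Measure (SpinConfig d q))
    refine measure_ext_of_local fun J A hA => ?_
    have hAm := measurableSet_of_dependsOn hA
    have h1 := integral_averagedGibbs β Λ (μ : Measure (SpinConfig d q))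
      (f := A.indicator 1) (measurable_one.indicator hAm) (M := 1) fun σ => by
        by_cases hσ : σ ∈ A
        · simp [hσ]
        · simp [hσ]
    rw [h Λ J _ (dependsOn_indicator hA), integral_indicator_one hAm,
      integral_indicator_one hAm] at h1
    exact (measureReal_eq_measureReal_iff).1 h1
  have hint : ∀ Λ (f : SpinConfig d q → ℝ), Measurable f → ∀ M, (∀ σ, |f σ| ≤ M) →
      ∫ σ, gibbsKernel β Λ f σ ∂(μ : Measure (SpinConfig d q)) =
        ∫ σ, f σ ∂(μ : Measure (SpinConfig d q)) := by
    intro Λ f hf M hM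
    rw [← integral_averagedGibbs β Λ (μ : Measure (SpinConfig d q)) hf hM, hav]
  rintro Λ f hf ⟨M, hM⟩
  have hK : Integrable (gibbsKernel β Λ f) (μ : Measure (SpinConfig d q)) :=
    Integrable.of_bound ((measurable_gibbsKernel β Λ hf).mono cylinderEvents_le_pi
      le_rfl).aestronglyMeasurable M (Eventually.of_forall fun τ => abs_gibbsKernel_le hM τ)
  refine (ae_eq_condExp_of_forall_setIntegral_eq cylinderEvents_le_pi
    (Integrable.of_bound hf.aestronglyMeasurable M (Eventually.of_forall hM))
    (fun s _ _ => hK.integrableOn) (fun A hA _ => ?_)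
    (measurable_gibbsKernel β Λ hf).stronglyMeasurable.aestronglyMeasurable).symm
  have hA' : MeasurableSet A := cylinderEvents_le_pi _ hA
  rw [← integral_indicator hA', ← integral_indicator hA',
    ← hint Λ (A.indicator f) (hf.indicator hA') M fun σ => ?_]
  -- The kernel leaves the spins off `Λ` unchanged, so the indicator of an event generated by those
  -- spins can be taken out of it.
  · refine integral_congr_ae (Eventually.of_forall fun τ => ?_)
    have hmem : ∀ η, glueSpins Λ η τ ∈ A ↔ τ ∈ A := fun η =>
      mem_congr_of_cylinderEvents hA fun v hv => glueSpins_of_not_mem (by simpa using hv)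
    rw [gibbsKernel_eq_sum]
    by_cases hτ : τ ∈ A
    · rw [Set.indicator_of_mem hτ, gibbsKernel_eq_sum]
      exact Finset.sum_congr rfl fun η _ => by rw [Set.indicator_of_mem ((hmem η).2 hτ)]
    · rw [Set.indicator_of_notMem hτ]
      exact (Finset.sum_eq_zero fun η _ => by
        rw [Set.indicator_of_notMem fun hm => hτ ((hmem η).1 hm), mul_zero]).symm
  · by_cases hσ : σ ∈ A
    · rw [Set.indicator_of_mem hσ]; exact hM σ
    · rw [Set.indicator_of_notMem hσ, abs_zero]; exact (abs_nonneg _).trans (hM σ)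

theorem eq_comp_restrict_of_dependsOn {E : Type*} {J : Finset (Site d)} {f : SpinConfig d q → E}
    (hf : DependsOn f (J : Set (Site d))) :
    f = fun σ => (fun s : J → Fin q => f (glueSpins J s 0)) fun u => σ u := by
  funext σ
  exact hf fun v hv => (glueSpins_of_mem (η := fun u : J => σ u) (Finset.mem_coe.1 hv)).symm

/-- The state obtained by colouring the clusters of the wired random-cluster measure. -/
def IsColouring (x : ℝ) (μ : ProbabilityMeasure (SpinConfig d q)) : Prop :=
  ∀ (Δ : Finset (Site d)) (F : (Δ → Fin q) → ℝ),
    ∫ σ, F (fun u => σ u) ∂(μ : Measure (SpinConfig d q)) =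
      ∫ ω, colAvg F ω ∂(rcInf d q x : Measure (EdgeConfig d))

theorem dependsOn_comp_restrict {E : Type*} {Δ : Finset (Site d)} (F : (Δ → Fin q) → E) :
    DependsOn (fun σ : SpinConfig d q => F fun u => σ u) (Δ : Set (Site d)) := fun σ σ' h => by
  simp only
  congr 1
  funext u
  exact h u u.2

/-- Any boundary condition would do: the Gibbs measures in growing boxes converge on local functions
because their kernels do. -/
theorem exists_isColouring (hd : 2 ≤ d) {β : ℝ} (hβ : 0 ≤ β)
    (h : FastDecay d q (Real.exp (2 * β) - 1)) :
    ∃ μ : ProbabilityMeasure (SpinConfig d q), IsColouring (Real.exp (2 * β) - 1) μ := by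
  have hconv : ∀ (Δ : Finset (Site d)) (F : (Δ → Fin q) → ℝ),
      Tendsto (fun t => ∫ σ, F (fun u => σ u)
          ∂(gibbsProb β (box d t) (0 : SpinConfig d q) : Measure (SpinConfig d q))) atTop
        (𝓝 (∫ ω, colAvg F ω ∂(rcInf d q (Real.exp (2 * β) - 1) : Measure (EdgeConfig d)))) := by
    intro Δ F
    simp_rw [integral_gibbsProb]
    exact (tendstoUniformly_gibbsKernel hd hβ h F).tendsto_at 0
  have hconv' : ∀ (J : Finset (Site d)) (f : SpinConfig d q → ℝ), DependsOn f (J : Set (Site d)) →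
      ∃ l, Tendsto (fun t => ∫ σ, f σ
          ∂(gibbsProb β (box d t) (0 : SpinConfig d q) : Measure (SpinConfig d q))) atTop
        (𝓝 l) := by
    intro J f hf
    have := hconv J fun s : J → Fin q => f (glueSpins J s 0)
    rw [← eq_comp_restrict_of_dependsOn hf] at this
    exact ⟨_, this⟩
  obtain ⟨μ, hμ⟩ := exists_tendsto_of_local hconv'
  refine ⟨μ, fun Δ F => tendsto_nhds_unique ?_ (hconv Δ F)⟩
  exact ((continuous_integral_of_dependsOn (dependsOn_comp_restrict F)).tendsto μ).comp hμ

theorem IsColouring.tendstoUniformly (hd : 2 ≤ d) {β : ℝ} (hβ : 0 ≤ β)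
    (h : FastDecay d q (Real.exp (2 * β) - 1)) {μ : ProbabilityMeasure (SpinConfig d q)}
    (hμ : IsColouring (Real.exp (2 * β) - 1) μ) {J : Finset (Site d)} {f : SpinConfig d q → ℝ}
    (hf : DependsOn f (J : Set (Site d))) :
    TendstoUniformly (fun t (τ : SpinConfig d q) => gibbsKernel β (box d t) f τ)
      (fun _ => ∫ σ, f σ ∂(μ : Measure (SpinConfig d q))) atTop := by
  rw [eq_comp_restrict_of_dependsOn hf, hμ]
  exact tendstoUniformly_gibbsKernel hd hβ h _

/-- The kernel of a local function is local, so letting the box grow in the consistency relation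
gives invariance of the limit. -/
theorem IsColouring.isPottsGibbs (hd : 2 ≤ d) {β : ℝ} (hβ : 0 ≤ β)
    (h : FastDecay d q (Real.exp (2 * β) - 1)) {μ : ProbabilityMeasure (SpinConfig d q)}
    (hμ : IsColouring (Real.exp (2 * β) - 1) μ) : IsPottsGibbs β μ := by
  refine isPottsGibbs_of_local fun Λ J f hf => ?_
  refine tendsto_nhds_unique
    ((hμ.tendstoUniformly hd hβ h (dependsOn_gibbsKernel β Λ hf)).tendsto_at 0) ?_
  refine ((hμ.tendstoUniformly hd hβ h hf).tendsto_at 0).congr' ?_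
  obtain ⟨n, hn⟩ := exists_subset_box Λ
  filter_upwards [eventually_ge_atTop n] with t ht
  exact (gibbsKernel_gibbsKernel β (hn t ht) f 0).symm

/-- Under any Gibbs measure the mean of a local function is the average of its kernels, and these
converge uniformly to a constant. -/
theorem IsColouring.eq_of_isPottsGibbs (hd : 2 ≤ d) {β : ℝ} (hβ : 0 ≤ β)
    (h : FastDecay d q (Real.exp (2 * β) - 1)) {μ μ' : ProbabilityMeasure (SpinConfig d q)}
    (hμ : IsColouring (Real.exp (2 * β) - 1) μ) (hμ' : IsPottsGibbs β μ') : μ' = μ := by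
  refine probabilityMeasure_ext_of_local fun J f hf => ?_
  have hu := hμ.tendstoUniformly hd hβ h hf
  obtain ⟨M, hM⟩ := exists_bound_of_dependsOn hf
  have hfm := measurable_of_dependsOn hf
  have h1 : ∀ t, ∫ σ, gibbsKernel β (box d t) f σ ∂(μ' : Measure (SpinConfig d q)) =
      ∫ σ, f σ ∂(μ' : Measure (SpinConfig d q)) := by
    intro t
    rw [← integral_congr_ae (hμ' (box d t) f hfm ⟨M, hM⟩), integral_condExp cylinderEvents_le_pi]
  by_contra hne
  rw [Metric.tendstoUniformly_iff] at hu
  have hpos := abs_pos.2 (sub_ne_zero.2 hne)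
  obtain ⟨t, ht⟩ := (hu _ (half_pos hpos)).exists
  have hK : Integrable (gibbsKernel β (box d t) f) (μ' : Measure (SpinConfig d q)) :=
    integrable_of_dependsOn (dependsOn_gibbsKernel β (box d t) hf) _
  set c := ∫ σ, f σ ∂(μ : Measure (SpinConfig d q)) with hc
  have h2 : |∫ σ, (gibbsKernel β (box d t) f σ - c) ∂(μ' : Measure (SpinConfig d q))| ≤
      |∫ σ, f σ ∂(μ' : Measure (SpinConfig d q)) - c| / 2 := by
    have := norm_integral_le_of_norm_le_const (μ := (μ' : Measure (SpinConfig d q)))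
      (f := fun σ => gibbsKernel β (box d t) f σ - c) (Eventually.of_forall fun σ => by
        have := ht σ
        rw [dist_comm, dist_eq_norm] at this
        exact this.le)
    simpa using this
  rw [integral_sub hK (integrable_const _), h1] at h2
  simp only [integral_const, probReal_univ, one_smul] at h2
  linarith

end

/-! ### Moments, truncation and decorrelation of cluster sizes -/

section

variable {d q : ℕ}

/-! ### Cluster sizes inside a box -/

/-- The number of sites of `Λ` in the cluster of `u`. -/
noncomputable def hits (Λ : Finset (Site d)) (u : Site d) (ω : EdgeConfig d) : ℝ :=
  ∑ v ∈ Λ, {ω : EdgeConfig d | (openGraph ω).Reachable u v}.indicator 1 ω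

theorem hits_nonneg (Λ : Finset (Site d)) (u : Site d) (ω : EdgeConfig d) : 0 ≤ hits Λ u ω :=
  Finset.sum_nonneg fun _ _ => Set.indicator_nonneg (fun _ _ => zero_le_one) _

theorem hits_le_card (Λ : Finset (Site d)) (u : Site d) (ω : EdgeConfig d) :
    hits Λ u ω ≤ Λ.card := by
  rw [← nsmul_one, ← Finset.sum_const]
  exact Finset.sum_le_sum fun _ _ => Set.indicator_le_self' (fun _ _ => zero_le_one) _

theorem measurable_hits (Λ : Finset (Site d)) (u : Site d) : Measurable (hits Λ u) :=
  Finset.measurable_fun_sum _ fun v _ => measurable_one.indicator (measurableSet_reachable u v)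

theorem ofReal_hits_le (Λ : Finset (Site d)) (u : Site d) (ω : EdgeConfig d) :
    ENNReal.ofReal (hits Λ u ω) ≤ csize u ω := by
  have h0 : ∀ v ∈ Λ, 0 ≤ {ω : EdgeConfig d | (openGraph ω).Reachable u v}.indicator
      (1 : EdgeConfig d → ℝ) ω := fun _ _ => Set.indicator_nonneg (fun _ _ => zero_le_one) _
  rw [csize_eq_tsum, hits, ENNReal.ofReal_sum_of_nonneg h0]
  refine le_trans (le_of_eq (Finset.sum_congr rfl fun v _ => ?_)) (ENNReal.sum_le_tsum Λ)
  by_cases h : ω ∈ {ω : EdgeConfig d | (openGraph ω).Reachable u v}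
  · rw [Set.indicator_of_mem h, Set.indicator_of_mem h]; simp
  · rw [Set.indicator_of_notMem h, Set.indicator_of_notMem h]; simp

theorem integrable_hits (Λ : Finset (Site d)) (u : Site d) (P : Measure (EdgeConfig d))
    [IsFiniteMeasure P] : Integrable (hits Λ u) P :=
  Integrable.of_bound (measurable_hits Λ u).aestronglyMeasurable Λ.card
    (Eventually.of_forall fun ω => by
      rw [Real.norm_eq_abs, abs_of_nonneg (hits_nonneg Λ u ω)]
      exact hits_le_card Λ u ω)

theorem integrable_hits_sq (Λ : Finset (Site d)) (u : Site d) (P : Measure (EdgeConfig d))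
    [IsFiniteMeasure P] : Integrable (fun ω => hits Λ u ω ^ 2) P :=
  Integrable.of_bound ((measurable_hits Λ u).pow_const 2).aestronglyMeasurable ((Λ.card : ℝ) ^ 2)
    (Eventually.of_forall fun ω => by
      rw [Real.norm_eq_abs, abs_of_nonneg (sq_nonneg _)]
      exact pow_le_pow_left₀ (hits_nonneg Λ u ω) (hits_le_card Λ u ω) 2)

/-- The size of the part of the cluster of the origin explored inside the box of radius `r`. -/
noncomputable def localSize (d r : ℕ) (ω : EdgeConfig d) : ℝ :=
  hits (box d r) 0 (cut (touchEdges (box d r)) ω)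

theorem dependsOn_localSize (d r : ℕ) :
    DependsOn (localSize d r) (touchEdges (box d r) : Set (Edge d)) := dependsOn_cut _ _

theorem hits_mono (Λ : Finset (Site d)) (u : Site d) : Monotone (hits Λ u) := fun _ _ h =>
  Finset.sum_le_sum fun _ _ => monotone_indicator (fun _ _ h h' => reachable_mono h h') h

theorem localSize_mono (d r : ℕ) : Monotone (localSize d r) := fun _ _ h =>
  hits_mono _ _ (cut_mono _ h)

theorem localSize_nonneg (d r : ℕ) (ω : EdgeConfig d) : 0 ≤ localSize d r ω := hits_nonneg _ _ _

theorem localSize_le_card (d r : ℕ) (ω : EdgeConfig d) : localSize d r ω ≤ (box d r).card :=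
  hits_le_card _ _ _

theorem ofReal_localSize_le (d r : ℕ) (ω : EdgeConfig d) :
    ENNReal.ofReal (localSize d r ω) ≤ csize 0 ω :=
  (ENNReal.ofReal_le_ofReal (hits_mono _ _ (cut_le _ ω))).trans (ofReal_hits_le _ _ ω)

theorem add_mem_box {r s : ℕ} {u v : Site d} (hu : u ∈ box d r) (hv : v ∈ box d s) :
    u + v ∈ box d (r + s) := by
  rw [mem_box] at *
  intro i
  have := abs_add_le (u i) (v i)
  have := hu i
  have := hv i
  push_cast
  simp only [Pi.add_apply]
  linarith

theorem localSize_shift_le_hits {r s : ℕ} {u : Site d} (hu : u ∈ box d s) (ω : EdgeConfig d) :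
    localSize d r (shift u ω) ≤ hits (box d (r + s)) u ω := by
  classical
  refine (hits_mono _ _ (cut_le _ (shift u ω))).trans ?_
  unfold hits
  have h1 : ∀ v, {ω : EdgeConfig d | (openGraph ω).Reachable 0 v}.indicator (1 : EdgeConfig d → ℝ)
      (shift u ω) = {ω : EdgeConfig d | (openGraph ω).Reachable u (v + u)}.indicator 1 ω := by
    intro v
    have h := reachable_shift (a := u) (ω := ω) (u := 0) (v := v)
    rw [zero_add] at h
    by_cases hr : (openGraph ω).Reachable u (v + u)
    · have m1 : shift u ω ∈ {ω : EdgeConfig d | (openGraph ω).Reachable 0 v} := h.2 hr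
      have m2 : ω ∈ {ω : EdgeConfig d | (openGraph ω).Reachable u (v + u)} := hr
      rw [Set.indicator_of_mem m1, Set.indicator_of_mem m2]
      rfl
    · have m1 : shift u ω ∉ {ω : EdgeConfig d | (openGraph ω).Reachable 0 v} := fun h' => hr (h.1 h')
      have m2 : ω ∉ {ω : EdgeConfig d | (openGraph ω).Reachable u (v + u)} := hr
      rw [Set.indicator_of_notMem m1, Set.indicator_of_notMem m2]
  rw [Finset.sum_congr rfl fun v _ => h1 v,
    ← Finset.sum_image (f := fun v => {ω : EdgeConfig d | (openGraph ω).Reachable u v}.indicator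
      (1 : EdgeConfig d → ℝ) ω) (g := fun v => v + u) (fun a _ b _ h => add_right_cancel h)]
  refine Finset.sum_le_sum_of_subset_of_nonneg ?_
    fun _ _ _ => Set.indicator_nonneg (fun _ _ => zero_le_one) _
  intro w hw
  obtain ⟨v, hv, rfl⟩ := Finset.mem_image.1 hw
  exact add_mem_box hv hu

variable [NeZero q]

/-- The mean cluster size. -/
noncomputable def meanSize (d q : ℕ) [NeZero q] (x : ℝ) : ℝ :=
  (∫⁻ ω, csize 0 ω ∂(rcInf d q x : Measure (EdgeConfig d))).toReal

/-- The second moment of the cluster size. -/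
noncomputable def meanSqSize (d q : ℕ) [NeZero q] (x : ℝ) : ℝ :=
  (∫⁻ ω, csize 0 ω ^ 2 ∂(rcInf d q x : Measure (EdgeConfig d))).toReal

theorem integral_hits_le {x : ℝ} (hx : 0 ≤ x) (h : FastDecay d q x) (Λ : Finset (Site d))
    (u : Site d) :
    ∫ ω, hits Λ u ω ∂(rcInf d q x : Measure (EdgeConfig d)) ≤ meanSize d q x := by
  rw [integral_eq_lintegral_of_nonneg_ae (Eventually.of_forall fun ω => hits_nonneg Λ u ω)
    (measurable_hits Λ u).aestronglyMeasurable, meanSize]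
  refine ENNReal.toReal_mono (lintegral_csize_lt_top h).ne ?_
  refine (lintegral_mono fun ω => ofReal_hits_le Λ u ω).trans ?_
  exact (lintegral_csize hx u id measurable_id).le

theorem integral_hits_sq_le {x : ℝ} (hx : 0 ≤ x) (h : FastDecay d q x) (Λ : Finset (Site d))
    (u : Site d) :
    ∫ ω, hits Λ u ω ^ 2 ∂(rcInf d q x : Measure (EdgeConfig d)) ≤ meanSqSize d q x := by
  rw [integral_eq_lintegral_of_nonneg_ae (Eventually.of_forall fun ω => sq_nonneg _)
    ((measurable_hits Λ u).pow_const 2).aestronglyMeasurable, meanSqSize]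
  refine ENNReal.toReal_mono (lintegral_csize_sq_lt_top h).ne ?_
  refine (lintegral_mono fun ω => ?_).trans
    (lintegral_csize hx u (fun y => y ^ 2) (measurable_id.pow_const 2)).le
  rw [ENNReal.ofReal_pow (hits_nonneg Λ u ω)]
  exact pow_le_pow_left₀ bot_le (ofReal_hits_le Λ u ω) 2

theorem integral_localSize_le {x : ℝ} (h : FastDecay d q x) (r : ℕ) :
    ∫ ω, localSize d r ω ∂(rcInf d q x : Measure (EdgeConfig d)) ≤ meanSize d q x := by
  rw [integral_eq_lintegral_of_nonneg_ae (Eventually.of_forall fun ω => localSize_nonneg d r ω)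
    (measurable_of_dependsOn (dependsOn_localSize d r)).aestronglyMeasurable, meanSize]
  exact ENNReal.toReal_mono (lintegral_csize_lt_top h).ne
    (lintegral_mono fun ω => ofReal_localSize_le d r ω)

theorem tendsto_localSize {ω : EdgeConfig d} (hω : csize 0 ω < ∞) :
    Tendsto (fun r => localSize d r ω) atTop (𝓝 (csize 0 ω).toReal) := by
  classical
  have hfin : (cluster ω 0).Finite := by
    rw [← Set.encard_lt_top_iff]
    by_contra hcon
    rw [not_lt, top_le_iff] at hcon
    simp [csize, hcon] at hω
  obtain ⟨n, hn⟩ := exists_subset_box hfin.toFinset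
  refine tendsto_const_nhds.congr' ?_
  filter_upwards [eventually_ge_atTop n] with r hr
  have hsub : ∀ v, (openGraph ω).Reachable 0 v → v ∈ box d r := fun v hv =>
    hn r hr (by rw [Set.Finite.mem_toFinset]; exact hv)
  have hcut : ∀ v, (openGraph (cut (touchEdges (box d r)) ω)).Reachable 0 v ↔
      v ∈ hfin.toFinset := by
    intro v
    rw [Set.Finite.mem_toFinset]
    refine ⟨fun h => reachable_mono (cut_le _ _) h, fun h => reachable_cut_of_forall_mem
      (fun z hz => hsub z (reachable_mono (cut_le _ _) hz)) h⟩
  have h1 : ∀ v, {ω : EdgeConfig d | (openGraph ω).Reachable 0 v}.indicator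
      (1 : EdgeConfig d → ℝ) (cut (touchEdges (box d r)) ω) =
      if v ∈ hfin.toFinset then 1 else 0 := by
    intro v
    by_cases hv : v ∈ hfin.toFinset
    · have m1 : cut (touchEdges (box d r)) ω ∈
        {ω : EdgeConfig d | (openGraph ω).Reachable 0 v} := (hcut v).2 hv
      rw [Set.indicator_of_mem m1, if_pos hv]
      rfl
    · have m1 : cut (touchEdges (box d r)) ω ∉
        {ω : EdgeConfig d | (openGraph ω).Reachable 0 v} := fun h => hv ((hcut v).1 h)
      rw [Set.indicator_of_notMem m1, if_neg hv]
  unfold localSize hits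
  rw [Finset.sum_congr rfl fun v _ => h1 v, Finset.sum_ite_mem,
    Finset.inter_eq_right.2 (hn r hr), Finset.sum_const, nsmul_one, csize,
    hfin.encard_eq_coe_toFinset_card]
  simp

theorem tendsto_integral_localSize {x : ℝ} (hx : 0 ≤ x) (h : FastDecay d q x) :
    Tendsto (fun r => ∫ ω, localSize d r ω ∂(rcInf d q x : Measure (EdgeConfig d))) atTop
      (𝓝 (meanSize d q x)) := by
  have hae := ae_csize_lt_top hx h 0
  have hint : Integrable (fun ω => (csize 0 ω).toReal) (rcInf d q x : Measure (EdgeConfig d)) :=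
    integrable_toReal_of_lintegral_ne_top (measurable_csize 0).aemeasurable
      (lintegral_csize_lt_top h).ne
  have hmean : meanSize d q x =
      ∫ ω, (csize 0 ω).toReal ∂(rcInf d q x : Measure (EdgeConfig d)) :=
    (integral_toReal (measurable_csize 0).aemeasurable hae).symm
  rw [hmean]
  refine tendsto_integral_of_dominated_convergence (fun ω => (csize 0 ω).toReal)
    (fun r => (measurable_of_dependsOn (dependsOn_localSize d r)).aestronglyMeasurable) hint
    (fun r => ?_) ?_
  · filter_upwards [hae] with ω hω
    rw [Real.norm_eq_abs, abs_of_nonneg (localSize_nonneg d r ω)]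
    exact (ENNReal.ofReal_le_iff_le_toReal hω.ne).1 (ofReal_localSize_le d r ω)
  · filter_upwards [hae] with ω hω
    exact tendsto_localSize hω

/-! ### Decorrelation -/

/-- The extra 1 in the radius accounts for a common edge: it has an endpoint in each translated box,
and its endpoints differ by at most 1 in every coordinate. -/
theorem disjoint_shift_touchEdges {r R : ℕ} {u v : Site d} (h : v - u ∉ box d (r + R + 1)) :
    Disjoint ((touchEdges (box d r)).map (shiftEdge v).toEmbedding)
      ((touchEdges (box d R)).map (shiftEdge u).toEmbedding) := by
  rw [Finset.disjoint_left]
  intro e h1 h2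
  obtain ⟨e1, he1, rfl⟩ := Finset.mem_map.1 h1
  obtain ⟨e2, he2, he⟩ := Finset.mem_map.1 h2
  obtain ⟨y, hy, hyr⟩ := mem_touchEdges.1 he1
  obtain ⟨z, hz, hzR⟩ := mem_touchEdges.1 he2
  have hy' : y + v ∈ ((shiftEdge v e1 : Edge d) : Sym2 (Site d)) := Sym2.mem_map.2 ⟨y, hy, rfl⟩
  have hz' : z + u ∈ ((shiftEdge v e1 : Edge d) : Sym2 (Site d)) := by
    have : z + u ∈ ((shiftEdge u e2 : Edge d) : Sym2 (Site d)) := Sym2.mem_map.2 ⟨z, hz, rfl⟩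
    have he' : shiftEdge u e2 = shiftEdge v e1 := he
    rwa [he'] at this
  have hclose : ∀ (e : Edge d) (a b : Site d), a ∈ (e : Sym2 (Site d)) → b ∈ (e : Sym2 (Site d)) →
      ∀ i, |a i - b i| ≤ 1 := by
    rintro ⟨e, he⟩ a b ha hb i
    induction e using Sym2.ind with | _ m n => ?_
    have hmn : norm1 (m - n) = 1 := he
    have h1 := abs_apply_le_norm1 (m - n) i
    rw [hmn, Pi.sub_apply] at h1
    simp only [Sym2.mem_iff] at ha hb
    rcases ha with rfl | rfl <;> rcases hb with rfl | rfl
    · simp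
    · exact h1
    · rwa [abs_sub_comm]
    · simp
  refine h (mem_box.2 fun i => ?_)
  have a1 := hclose _ _ _ hy' hz' i
  have a2 := mem_box.1 hyr i
  have a3 := mem_box.1 hzR i
  simp only [Pi.add_apply, Pi.sub_apply] at *
  push_cast
  rw [abs_le] at *
  constructor <;> linarith [a1.1, a1.2, a2.1, a2.2, a3.1, a3.2]

variable {x : ℝ}

theorem integral_comp_shift (hx : 0 ≤ x) {f : EdgeConfig d → ℝ} (hf : Measurable f)
    (a : Site d) :
    ∫ ω, f (shift a ω) ∂(rcInf d q x : Measure (EdgeConfig d)) =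
      ∫ ω, f ω ∂(rcInf d q x : Measure (EdgeConfig d)) := by
  conv_rhs => rw [← map_shift_rcInf hx a]
  rw [integral_map (measurable_shift a).aemeasurable hf.aestronglyMeasurable]

/-- The factor at `v` uses only edges outside the set touching the box of radius `R` around `u`.
Hence the mean of the factor at `u`, weighted by it, is at most the wired mean in that box. -/
theorem integral_localSize_mul_le (hx : 0 ≤ x) {r R : ℕ} {u v : Site d}
    (h : v - u ∉ box d (r + R + 1)) :
    ∫ ω, localSize d r (shift u ω) * localSize d r (shift v ω)
        ∂(rcInf d q x : Measure (EdgeConfig d)) ≤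
      rcMean q x (touchEdges (box d R)) (localSize d r) *
        ∫ ω, localSize d r ω ∂(rcInf d q x : Measure (EdgeConfig d)) := by
  have h1 := integral_rcInf_mul_le (q := q) hx (dependsOn_shift (dependsOn_localSize d r) u)
    (fun a b hab => localSize_mono d r fun e => hab _)
    (dependsOn_shift (dependsOn_localSize d r) v) (fun ω => localSize_nonneg d r _)
    (disjoint_shift_touchEdges h)
  rwa [rcMean_shift, integral_comp_shift hx (measurable_of_dependsOn (dependsOn_localSize d r))]
    at h1

end

section

variable {d q : ℕ} [NeZero q] {x : ℝ}

/-! ### The law of large numbers for the cluster sizes -/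

theorem card_box_pos (d t : ℕ) : (0 : ℝ) < (box d t).card := by
  rw [card_box]; positivity

theorem integrable_localSize_shift (x : ℝ) (r : ℕ) (u : Site d) :
    Integrable (fun ω => localSize d r (shift u ω)) (rcInf d q x : Measure (EdgeConfig d)) :=
  integrable_of_dependsOn (dependsOn_shift (dependsOn_localSize d r) u) _

theorem integrable_localSize_mul (x : ℝ) (r : ℕ) (u v : Site d) :
    Integrable (fun ω => localSize d r (shift u ω) * localSize d r (shift v ω))
      (rcInf d q x : Measure (EdgeConfig d)) := by
  have hm : ∀ u : Site d, Measurable fun ω => localSize d r (shift u ω) := fun u =>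
    measurable_of_dependsOn (dependsOn_shift (dependsOn_localSize d r) u)
  refine Integrable.of_bound ((hm u).mul (hm v)).aestronglyMeasurable
    ((box d r).card * (box d r).card : ℝ) (Eventually.of_forall fun ω => ?_)
  rw [Real.norm_eq_abs, abs_of_nonneg (mul_nonneg (localSize_nonneg _ _ _) (localSize_nonneg _ _ _))]
  exact mul_le_mul (localSize_le_card _ _ _) (localSize_le_card _ _ _) (localSize_nonneg _ _ _)
    (Nat.cast_nonneg _)

/-- Only an upper bound on the covariance is needed. Distant pairs contribute at most the excess of
the wired mean at radius `R` over its limit, times the mean size; close pairs are bounded trivially.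
-/
theorem integral_localSize_cov_le (hx : 0 ≤ x) (r R : ℕ) (u v : Site d) :
    ∫ ω, (localSize d r (shift u ω) -
          ∫ ω, localSize d r ω ∂(rcInf d q x : Measure (EdgeConfig d))) *
        (localSize d r (shift v ω) -
          ∫ ω, localSize d r ω ∂(rcInf d q x : Measure (EdgeConfig d)))
        ∂(rcInf d q x : Measure (EdgeConfig d)) ≤
      (rcMean q x (touchEdges (box d R)) (localSize d r) -
          ∫ ω, localSize d r ω ∂(rcInf d q x : Measure (EdgeConfig d))) * (box d r).card +
        ((box d r).card : ℝ) ^ 2 * if v - u ∈ box d (r + R + 1) then 1 else 0 := by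
  set e := ∫ ω, localSize d r ω ∂(rcInf d q x : Measure (EdgeConfig d)) with he
  have hm := measurable_of_dependsOn (dependsOn_localSize d r)
  have he0 : 0 ≤ e := integral_nonneg fun ω => localSize_nonneg d r ω
  have heB : e ≤ (box d r).card := by
    have := integral_mono (integrable_of_dependsOn (dependsOn_localSize d r)
      (rcInf d q x : Measure (EdgeConfig d))) (integrable_const ((box d r).card : ℝ))
      (fun ω => localSize_le_card d r ω)
    simpa using this
  have hδ : 0 ≤ rcMean q x (touchEdges (box d R)) (localSize d r) - e :=
    sub_nonneg.2 (integral_rcInf_le_rcMean hx (dependsOn_localSize d r) (localSize_mono d r) _)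
  have hexp : ∫ ω, (localSize d r (shift u ω) - e) * (localSize d r (shift v ω) - e)
      ∂(rcInf d q x : Measure (EdgeConfig d)) =
      ∫ ω, localSize d r (shift u ω) * localSize d r (shift v ω)
        ∂(rcInf d q x : Measure (EdgeConfig d)) - e ^ 2 := by
    have h1 : ∀ ω, (localSize d r (shift u ω) - e) * (localSize d r (shift v ω) - e) =
        localSize d r (shift u ω) * localSize d r (shift v ω) -
          e * localSize d r (shift u ω) - e * localSize d r (shift v ω) + e ^ 2 := fun ω => by ring
    simp_rw [h1]
    have i1 := integrable_localSize_mul (q := q) x r u v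
    have i2 := (integrable_localSize_shift (q := q) x r u).const_mul e
    have i3 := (integrable_localSize_shift (q := q) x r v).const_mul e
    have j1 : Integrable (fun ω => localSize d r (shift u ω) * localSize d r (shift v ω) -
        e * localSize d r (shift u ω)) (rcInf d q x : Measure (EdgeConfig d)) := i1.sub i2
    have j2 : Integrable (fun ω => localSize d r (shift u ω) * localSize d r (shift v ω) -
        e * localSize d r (shift u ω) - e * localSize d r (shift v ω))
        (rcInf d q x : Measure (EdgeConfig d)) := j1.sub i3
    rw [integral_add j2 (integrable_const _), integral_sub j1 i3,
      integral_sub i1 i2, integral_const_mul, integral_const_mul, integral_comp_shift hx hm,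
      integral_comp_shift hx hm, ← he]
    simp only [integral_const, probReal_univ, one_smul]
    ring
  rw [hexp]
  split_ifs with h
  · have h2 : ∫ ω, localSize d r (shift u ω) * localSize d r (shift v ω)
        ∂(rcInf d q x : Measure (EdgeConfig d)) ≤ ((box d r).card : ℝ) ^ 2 := by
      have := integral_mono (integrable_localSize_mul (q := q) x r u v)
        (integrable_const (((box d r).card : ℝ) ^ 2)) (fun ω => by
          rw [sq]
          exact mul_le_mul (localSize_le_card _ _ _) (localSize_le_card _ _ _)
            (localSize_nonneg _ _ _) (Nat.cast_nonneg _))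
      simpa using this
    have h3 := mul_nonneg hδ (card_box_pos d r).le
    nlinarith [sq_nonneg e]
  · have h2 := integral_localSize_mul_le (q := q) hx h
    rw [← he] at h2
    rw [mul_zero, add_zero]
    have h3 := mul_le_mul_of_nonneg_left heB hδ
    nlinarith

theorem card_filter_sub_mem_le (s : Finset (Site d)) (D : ℕ) (u : Site d) :
    ((s.filter fun v => v - u ∈ box d D).card : ℝ) ≤ (box d D).card := by
  exact_mod_cast Finset.card_le_card_of_injOn (fun v => v - u)
    (fun v hv => (Finset.mem_filter.1 hv).2) fun a _ b _ h => sub_left_injective h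

theorem variance_localSize_le (hx : 0 ≤ x) (r R s : ℕ) :
    ∫ ω, (∑ u ∈ box d s, (localSize d r (shift u ω) -
          ∫ ω, localSize d r ω ∂(rcInf d q x : Measure (EdgeConfig d)))) ^ 2
        ∂(rcInf d q x : Measure (EdgeConfig d)) ≤
      ((box d s).card : ℝ) ^ 2 * ((rcMean q x (touchEdges (box d R)) (localSize d r) -
          ∫ ω, localSize d r ω ∂(rcInf d q x : Measure (EdgeConfig d))) * (box d r).card) +
        (box d s).card * (((box d r).card : ℝ) ^ 2 * (box d (r + R + 1)).card) := by
  classical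
  have hcov := integral_localSize_cov_le (d := d) (q := q) hx r R
  generalize he : ∫ ω, localSize d r ω ∂(rcInf d q x : Measure (EdgeConfig d)) = e at *
  have hint : ∀ u v : Site d, Integrable (fun ω => (localSize d r (shift u ω) - e) *
      (localSize d r (shift v ω) - e)) (rcInf d q x : Measure (EdgeConfig d)) := by
    intro u v
    have i1 := integrable_localSize_mul (q := q) x r u v
    have i2 := (integrable_localSize_shift (q := q) x r u).const_mul e
    have i3 := (integrable_localSize_shift (q := q) x r v).const_mul e
    refine (((i1.sub i2).sub i3).add (integrable_const (e ^ 2))).congr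
      (Eventually.of_forall fun ω => ?_)
    simp only [Pi.add_apply, Pi.sub_apply]
    ring
  generalize hδ : (rcMean q x (touchEdges (box d R)) (localSize d r) - e) * (box d r).card = δ at *
  generalize hB : (box d r).card = B at *
  simp_rw [sq (∑ u ∈ box d s, _), Finset.sum_mul_sum]
  rw [integral_finsetSum _ fun u _ => integrable_finsetSum _ fun v _ => hint u v]
  simp_rw [integral_finsetSum (box d s) fun v _ => hint _ v]
  calc ∑ u ∈ box d s, ∑ v ∈ box d s, ∫ ω, (localSize d r (shift u ω) - e) *
        (localSize d r (shift v ω) - e) ∂(rcInf d q x : Measure (EdgeConfig d))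
      ≤ ∑ u ∈ box d s, ∑ v ∈ box d s,
          (δ + (B : ℝ) ^ 2 * if v - u ∈ box d (r + R + 1) then 1 else 0) :=
        Finset.sum_le_sum fun u _ => Finset.sum_le_sum fun v _ => hcov u v
    _ ≤ ∑ u ∈ box d s, ((box d s).card * δ + (B : ℝ) ^ 2 * (box d (r + R + 1)).card) := by
        refine Finset.sum_le_sum fun u _ => ?_
        rw [Finset.sum_add_distrib, Finset.sum_const, nsmul_eq_mul, ← Finset.mul_sum,
          Finset.sum_boole]
        have := mul_le_mul_of_nonneg_left (card_filter_sub_mem_le (box d s) (r + R + 1) u)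
          (sq_nonneg (B : ℝ))
        linarith
    _ = _ := by
        rw [Finset.sum_const, nsmul_eq_mul]
        ring

/-- The mean number of sites of the box in the cluster of a site of the box. -/
noncomputable def avgHits (d t : ℕ) (ω : EdgeConfig d) : ℝ :=
  (∑ u ∈ box d t, hits (box d t) u ω) / (box d t).card

theorem avgHits_nonneg (d t : ℕ) (ω : EdgeConfig d) : 0 ≤ avgHits d t ω :=
  div_nonneg (Finset.sum_nonneg fun _ _ => hits_nonneg _ _ _) (Nat.cast_nonneg _)

theorem integrable_avgHits (d t : ℕ) (P : Measure (EdgeConfig d)) [IsFiniteMeasure P] :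
    Integrable (avgHits d t) P :=
  (integrable_finsetSum _ fun u _ => integrable_hits _ u P).div_const _

theorem integral_avgHits_le (hx : 0 ≤ x) (h : FastDecay d q x) (t : ℕ) :
    ∫ ω, avgHits d t ω ∂(rcInf d q x : Measure (EdgeConfig d)) ≤ meanSize d q x := by
  unfold avgHits
  rw [integral_div, integral_finsetSum _ fun u _ => integrable_hits _ u _,
    div_le_iff₀ (card_box_pos d t)]
  calc _ ≤ ∑ u ∈ box d t, meanSize d q x := Finset.sum_le_sum fun u _ => integral_hits_le hx h _ u
    _ = _ := by rw [Finset.sum_const, nsmul_eq_mul, mul_comm]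

/-- The mean of `avgHits` is at most `χ`, so its `L¹` distance to `χ` is controlled by its negative
deviation alone. From below, `avgHits` is bounded by a sum of truncated local sizes over a smaller
box, and that sum has a small variance. -/
theorem integral_abs_avgHits_sub_le (hx : 0 ≤ x) (h : FastDecay d q x) (r R s : ℕ) {η : ℝ}
    (hη : 0 < η) :
    ∫ ω, |avgHits d (r + s) ω - meanSize d q x| ∂(rcInf d q x : Measure (EdgeConfig d)) ≤
      2 * (meanSize d q x - (box d s).card / (box d (r + s)).card *
        ∫ ω, localSize d r ω ∂(rcInf d q x : Measure (EdgeConfig d))) + 2 * η +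
      2 / η * ((rcMean q x (touchEdges (box d R)) (localSize d r) -
          ∫ ω, localSize d r ω ∂(rcInf d q x : Measure (EdgeConfig d))) * (box d r).card +
        ((box d r).card : ℝ) ^ 2 * (box d (r + R + 1)).card / (box d (r + s)).card) := by
  have hvar := variance_localSize_le (d := d) (q := q) hx r R s
  have hle := integral_localSize_le (q := q) h r
  have he0 : 0 ≤ ∫ ω, localSize d r ω ∂(rcInf d q x : Measure (EdgeConfig d)) :=
    integral_nonneg fun ω => localSize_nonneg d r ω
  have hδ0 : 0 ≤ rcMean q x (touchEdges (box d R)) (localSize d r) -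
      ∫ ω, localSize d r ω ∂(rcInf d q x : Measure (EdgeConfig d)) :=
    sub_nonneg.2 (integral_rcInf_le_rcMean hx (dependsOn_localSize d r) (localSize_mono d r) _)
  have hN : ((box d s).card : ℝ) ≤ (box d (r + s)).card := by
    exact_mod_cast Finset.card_le_card (box_mono (by omega))
  have hT := card_box_pos d (r + s)
  have hN0 := card_box_pos d s
  have hB0 := card_box_pos d r
  have hK0 := card_box_pos d (r + R + 1)
  have hEX := integral_avgHits_le hx h (r + s)
  generalize ∫ ω, localSize d r ω ∂(rcInf d q x : Measure (EdgeConfig d)) = e at *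
  set Z : EdgeConfig d → ℝ := fun ω => ∑ u ∈ box d s, (localSize d r (shift u ω) - e) with hZ
  have hlow : ∀ ω, ((box d s).card * e + Z ω) / (box d (r + s)).card ≤ avgHits d (r + s) ω := by
    intro ω
    unfold avgHits
    refine div_le_div_of_nonneg_right ?_ hT.le
    simp only [hZ, Finset.sum_sub_distrib, Finset.sum_const, nsmul_eq_mul]
    calc _ = ∑ u ∈ box d s, localSize d r (shift u ω) := by ring
      _ ≤ ∑ u ∈ box d s, hits (box d (r + s)) u ω :=
          Finset.sum_le_sum fun u hu => localSize_shift_le_hits hu ω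
      _ ≤ _ := Finset.sum_le_sum_of_subset_of_nonneg (box_mono (by omega))
          fun _ _ _ => hits_nonneg _ _ _
  have hZint : Integrable (fun ω => Z ω ^ 2) (rcInf d q x : Measure (EdgeConfig d)) := by
    have hZm : Measurable Z := Finset.measurable_fun_sum _ fun u _ =>
      (measurable_of_dependsOn (dependsOn_shift (dependsOn_localSize d r) u)).sub_const _
    refine Integrable.of_bound (hZm.pow_const 2).aestronglyMeasurable
      ((∑ u ∈ box d s, ((box d r).card + e)) ^ 2) (Eventually.of_forall fun ω => ?_)
    rw [Real.norm_eq_abs, abs_pow]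
    refine pow_le_pow_left₀ (abs_nonneg _) ((Finset.abs_sum_le_sum_abs _ _).trans
      (Finset.sum_le_sum fun u _ => ?_)) 2
    have b1 := localSize_nonneg d r (shift u ω)
    have b2 := localSize_le_card d r (shift u ω)
    rw [abs_le]
    constructor <;> linarith
  generalize rcMean q x (touchEdges (box d R)) (localSize d r) - e = δ at *
  generalize meanSize d q x = χ at *
  generalize ((box d (r + s)).card : ℝ) = T at *
  generalize ((box d s).card : ℝ) = N at *
  generalize ((box d r).card : ℝ) = B at *
  generalize ((box d (r + R + 1)).card : ℝ) = K at *
  have hratio : N / T ≤ 1 := (div_le_one hT).2 hN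
  have hχ : N / T * e ≤ χ := (mul_le_of_le_one_left he0 hratio).trans hle
  -- This is `|y| = y + 2 y⁻`, with `y⁻` bounded through the truncated sizes. The first term has
  -- nonpositive mean.
  have hpt : ∀ ω, |avgHits d (r + s) ω - χ| ≤ (avgHits d (r + s) ω - χ) +
      (2 * (χ - N / T * e) + 2 * η + 2 / η / T ^ 2 * Z ω ^ 2) := by
    intro ω
    have h1 := hlow ω
    -- Trades the first absolute moment for the second moment without taking a square root.
    have h2 : |Z ω / T| ≤ η + (Z ω / T) ^ 2 / η := by
      have h3 : 0 ≤ (|Z ω / T| - η) ^ 2 := sq_nonneg _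
      have h5 : 0 ≤ |Z ω / T| * η := by positivity
      have h4 : |Z ω / T| * η ≤ (η + (Z ω / T) ^ 2 / η) * η := by
        rw [add_mul, div_mul_cancel₀ _ hη.ne', ← sq_abs (Z ω / T)]
        nlinarith
      exact le_of_mul_le_mul_right h4 hη
    have h3 : 2 / η / T ^ 2 * Z ω ^ 2 = 2 * ((Z ω / T) ^ 2 / η) := by
      field_simp
    have h6 : (N * e + Z ω) / T = N / T * e + Z ω / T := by field_simp
    rw [h6] at h1
    have h7 := neg_abs_le (Z ω / T)
    have h8 : 0 ≤ (Z ω / T) ^ 2 / η := by positivity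
    rw [h3]
    rcases abs_cases (avgHits d (r + s) ω - χ) with ⟨h9, _⟩ | ⟨h9, _⟩ <;> rw [h9] <;> linarith
  have hX := integrable_avgHits d (r + s) (rcInf d q x : Measure (EdgeConfig d))
  have hmono := integral_mono ((hX.sub (integrable_const χ)).abs)
    ((hX.sub (integrable_const χ)).add
      ((integrable_const (2 * (χ - N / T * e) + 2 * η)).add (hZint.const_mul (2 / η / T ^ 2))))
    (fun ω => by
      have := hpt ω
      simp only [Pi.add_apply, Pi.sub_apply]
      linarith)
  have hrhs : ∫ ω, ((avgHits d (r + s) ω - χ) + ((2 * (χ - N / T * e) + 2 * η) +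
      2 / η / T ^ 2 * Z ω ^ 2)) ∂(rcInf d q x : Measure (EdgeConfig d)) =
      (∫ ω, avgHits d (r + s) ω ∂(rcInf d q x : Measure (EdgeConfig d)) - χ) +
      ((2 * (χ - N / T * e) + 2 * η) +
        2 / η / T ^ 2 * ∫ ω, Z ω ^ 2 ∂(rcInf d q x : Measure (EdgeConfig d))) := by
    have j1 : Integrable (fun ω => avgHits d (r + s) ω - χ)
        (rcInf d q x : Measure (EdgeConfig d)) := hX.sub (integrable_const χ)
    have j2 : Integrable (fun ω => (2 * (χ - N / T * e) + 2 * η) + 2 / η / T ^ 2 * Z ω ^ 2)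
        (rcInf d q x : Measure (EdgeConfig d)) :=
      (integrable_const _).add (hZint.const_mul (2 / η / T ^ 2))
    rw [integral_add j1 j2, integral_sub hX (integrable_const χ), integral_add (integrable_const _)
      (hZint.const_mul (2 / η / T ^ 2)), integral_const_mul]
    simp
  have hmono' : ∫ ω, |avgHits d (r + s) ω - χ| ∂(rcInf d q x : Measure (EdgeConfig d)) ≤
      ∫ ω, ((avgHits d (r + s) ω - χ) + ((2 * (χ - N / T * e) + 2 * η) +
      2 / η / T ^ 2 * Z ω ^ 2)) ∂(rcInf d q x : Measure (EdgeConfig d)) := hmono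
  rw [hrhs] at hmono'
  have hfin : 2 / η / T ^ 2 * ∫ ω, Z ω ^ 2 ∂(rcInf d q x : Measure (EdgeConfig d)) ≤
      2 / η * (δ * B + B ^ 2 * K / T) := by
    have h1 : 2 / η / T ^ 2 * ∫ ω, Z ω ^ 2 ∂(rcInf d q x : Measure (EdgeConfig d)) ≤
        2 / η / T ^ 2 * (N ^ 2 * (δ * B) + N * (B ^ 2 * K)) :=
      mul_le_mul_of_nonneg_left hvar (by positivity)
    refine h1.trans ?_
    have h2 : N ^ 2 * (δ * B) + N * (B ^ 2 * K) ≤ T ^ 2 * (δ * B) + T * (B ^ 2 * K) :=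
      add_le_add (mul_le_mul_of_nonneg_right (pow_le_pow_left₀ hN0.le hN 2) (by positivity))
        (mul_le_mul_of_nonneg_right hN (by positivity))
    refine (mul_le_mul_of_nonneg_left h2 (by positivity)).trans (le_of_eq ?_)
    field_simp
  linarith

theorem tendsto_card_box_atTop (hd : 1 ≤ d) :
    Tendsto (fun t => ((box d t).card : ℝ)) atTop atTop := by
  refine tendsto_atTop_mono (fun t => ?_) tendsto_natCast_atTop_atTop
  rw [card_box]
  have h1 : t ≤ 2 * t + 1 := by omega
  have h2 : 2 * t + 1 ≤ (2 * t + 1) ^ d := Nat.le_self_pow (by omega) _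
  exact_mod_cast h1.trans h2

theorem tendsto_card_box_ratio (d r : ℕ) :
    Tendsto (fun s => ((box d s).card : ℝ) / (box d (r + s)).card) atTop (𝓝 1) := by
  have h : ∀ s : ℕ, ((box d s).card : ℝ) / (box d (r + s)).card =
      (1 - 2 * r / ((2 * (r + s) + 1 : ℕ) : ℝ)) ^ d := by
    intro s
    rw [card_box, card_box]
    push_cast
    rw [← div_pow]
    congr 1
    have : (2 * ((r : ℝ) + s) + 1) ≠ 0 := by positivity
    field_simp
    ring
  simp_rw [h]
  have h1 : Tendsto (fun s : ℕ => ((2 * (r + s) + 1 : ℕ) : ℝ)) atTop atTop := by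
    refine tendsto_natCast_atTop_atTop.comp (tendsto_atTop_mono (fun s => ?_) tendsto_id)
    simp only [id]
    omega
  simpa using ((tendsto_const_nhds (x := (1 : ℝ))).sub
    (tendsto_const_nhds.div_atTop h1 (a := 2 * (r : ℝ)))).pow d

/-- The parameters are chosen in order: `r` so that the truncated mean is near `χ`, then `R` so that
the wired mean is near its limit, then `s` so that boundary and diagonal terms vanish. With `η = ε /
8` the three limiting terms add up to less than `3ε / 4`. -/
theorem tendsto_integral_abs_avgHits_sub (hd : 1 ≤ d) (hx : 0 ≤ x) (h : FastDecay d q x) :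
    Tendsto (fun t => ∫ ω, |avgHits d t ω - meanSize d q x|
      ∂(rcInf d q x : Measure (EdgeConfig d))) atTop (𝓝 0) := by
  rw [Metric.tendsto_atTop]
  intro ε hε
  have h1 : Tendsto (fun r => 2 * (meanSize d q x - 1 *
      ∫ ω, localSize d r ω ∂(rcInf d q x : Measure (EdgeConfig d)))) atTop (𝓝 0) := by
    have := (((tendsto_integral_localSize hx h).const_mul 1).const_sub
      (meanSize d q x)).const_mul 2
    simpa using this
  obtain ⟨r, hr⟩ := (h1.eventually (gt_mem_nhds (show 0 < ε / 4 by positivity))).exists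
  have h2 : Tendsto (fun R => 2 / (ε / 8) *
      ((rcMean q x (touchEdges (box d R)) (localSize d r) -
        ∫ ω, localSize d r ω ∂(rcInf d q x : Measure (EdgeConfig d))) * (box d r).card + 0)) atTop
      (𝓝 0) := by
    have := ((((tendsto_rcMean (q := q) hx (dependsOn_localSize d r)).comp
      (tendsto_touchEdges_box (d := d))).sub_const
      (∫ ω, localSize d r ω ∂(rcInf d q x : Measure (EdgeConfig d)))).mul_const
      ((box d r).card : ℝ)).const_mul (2 / (ε / 8))
    simpa using this
  obtain ⟨R, hR⟩ := (h2.eventually (gt_mem_nhds (show 0 < ε / 4 by positivity))).exists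
  have h3 : Tendsto (fun s : ℕ =>
      2 * (meanSize d q x - (box d s).card / (box d (r + s)).card *
        ∫ ω, localSize d r ω ∂(rcInf d q x : Measure (EdgeConfig d))) + 2 * (ε / 8) +
      2 / (ε / 8) * ((rcMean q x (touchEdges (box d R)) (localSize d r) -
          ∫ ω, localSize d r ω ∂(rcInf d q x : Measure (EdgeConfig d))) * (box d r).card +
        ((box d r).card : ℝ) ^ 2 * (box d (r + R + 1)).card / (box d (r + s)).card)) atTop
      (𝓝 (2 * (meanSize d q x - 1 *
        ∫ ω, localSize d r ω ∂(rcInf d q x : Measure (EdgeConfig d))) + 2 * (ε / 8) +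
      2 / (ε / 8) * ((rcMean q x (touchEdges (box d R)) (localSize d r) -
          ∫ ω, localSize d r ω ∂(rcInf d q x : Measure (EdgeConfig d))) * (box d r).card + 0))) := by
    have hT : Tendsto (fun s : ℕ => ((box d (r + s)).card : ℝ)) atTop atTop :=
      (tendsto_card_box_atTop hd).comp
        (tendsto_atTop_mono (fun s => Nat.le_add_left s r) tendsto_id)
    exact ((((tendsto_card_box_ratio d r).mul_const _).const_sub _).const_mul 2 |>.add_const _).add
      (((tendsto_const_nhds.div_atTop hT).const_add _).const_mul _)
  have hlt : 2 * (meanSize d q x - 1 *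
        ∫ ω, localSize d r ω ∂(rcInf d q x : Measure (EdgeConfig d))) + 2 * (ε / 8) +
      2 / (ε / 8) * ((rcMean q x (touchEdges (box d R)) (localSize d r) -
          ∫ ω, localSize d r ω ∂(rcInf d q x : Measure (EdgeConfig d))) * (box d r).card + 0) < ε := by
    linarith
  obtain ⟨N, hN⟩ := eventually_atTop.1 (h3.eventually (gt_mem_nhds hlt))
  refine ⟨r + N, fun t ht => ?_⟩
  obtain ⟨s, rfl⟩ := Nat.exists_eq_add_of_le (show r ≤ t by omega)
  rw [Real.dist_eq, sub_zero, abs_of_nonneg (integral_nonneg fun ω => abs_nonneg _)]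
  exact lt_of_le_of_lt (integral_abs_avgHits_sub_le hx h r R s (by positivity)) (hN s (by omega))

end

/-! ### Characteristic functions of independently coloured clusters -/

section

/-! ### Estimates for characteristic functions -/

theorem norm_prod_sub_prod_le {ι : Type*} (s : Finset ι) {z w : ι → ℂ} (hz : ∀ i ∈ s, ‖z i‖ ≤ 1)
    (hw : ∀ i ∈ s, ‖w i‖ ≤ 1) : ‖∏ i ∈ s, z i - ∏ i ∈ s, w i‖ ≤ ∑ i ∈ s, ‖z i - w i‖ := by
  classical
  induction s using Finset.induction_on with
  | empty => simp
  | insert j s hj ih =>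
    rw [Finset.prod_insert hj, Finset.prod_insert hj, Finset.sum_insert hj]
    have ih' := ih (fun i hi => hz i (Finset.mem_insert_of_mem hi))
      fun i hi => hw i (Finset.mem_insert_of_mem hi)
    have h1 : ‖∏ i ∈ s, w i‖ ≤ 1 := by
      rw [norm_prod]
      exact Finset.prod_le_one (fun _ _ => norm_nonneg _)
        fun i hi => hw i (Finset.mem_insert_of_mem hi)
    have h2 := hz j (Finset.mem_insert_self j s)
    calc ‖z j * ∏ i ∈ s, z i - w j * ∏ i ∈ s, w i‖
        = ‖z j * (∏ i ∈ s, z i - ∏ i ∈ s, w i) + (z j - w j) * ∏ i ∈ s, w i‖ := by ring_nf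
      _ ≤ ‖z j‖ * ‖∏ i ∈ s, z i - ∏ i ∈ s, w i‖ + ‖z j - w j‖ * ‖∏ i ∈ s, w i‖ := by
          rw [← norm_mul, ← norm_mul]; exact norm_add_le _ _
      _ ≤ 1 * ‖∏ i ∈ s, z i - ∏ i ∈ s, w i‖ + ‖z j - w j‖ * 1 :=
          add_le_add (mul_le_mul_of_nonneg_right h2 (norm_nonneg _))
            (mul_le_mul_of_nonneg_left h1 (norm_nonneg _))
      _ ≤ _ := by linarith

theorem abs_exp_neg_sub_exp_neg_le {a b : ℝ} (ha : 0 ≤ a) (hb : 0 ≤ b) :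
    |Real.exp (-a) - Real.exp (-b)| ≤ |a - b| := by
  have key : ∀ a b : ℝ, 0 ≤ a → Real.exp (-a) - Real.exp (-b) ≤ |a - b| := by
    intro a b ha
    have h1 : Real.exp (-b) = Real.exp (-a) * Real.exp (a - b) := by
      rw [← Real.exp_add]; ring_nf
    have h2 := Real.add_one_le_exp (a - b)
    have h3 : Real.exp (-a) ≤ 1 := Real.exp_le_one_iff.2 (by linarith)
    have h4 := (Real.exp_pos (-a)).le
    have h5 : -(a - b) ≤ |a - b| := neg_le_abs _
    have h6 := abs_nonneg (a - b)
    rw [h1]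
    calc Real.exp (-a) - Real.exp (-a) * Real.exp (a - b)
        = Real.exp (-a) * (1 - Real.exp (a - b)) := by ring
      _ ≤ Real.exp (-a) * |a - b| := mul_le_mul_of_nonneg_left (by linarith) h4
      _ ≤ 1 * |a - b| := mul_le_mul_of_nonneg_right h3 h6
      _ = _ := one_mul _
  rw [abs_le]
  have h1 := key a b ha
  have h2 := key b a hb
  rw [abs_sub_comm] at h2
  constructor <;> linarith

variable {q : ℕ}

/-- The characteristic function of a uniform element of the family `a`. -/
noncomputable def phaseMean (a : Fin q → ℝ) (s : ℝ) : ℂ :=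
  (q : ℂ)⁻¹ * ∑ k, Complex.exp (a k * s * Complex.I)

theorem norm_phaseMean_le (a : Fin q → ℝ) (s : ℝ) : ‖phaseMean a s‖ ≤ 1 := by
  unfold phaseMean
  have h : ‖∑ k, Complex.exp (a k * s * Complex.I)‖ ≤ q := by
    refine (norm_sum_le _ _).trans (le_of_eq ?_)
    have : ∀ k, ‖Complex.exp (a k * s * Complex.I)‖ = 1 := fun k => by
      rw [← Complex.ofReal_mul]; exact Complex.norm_exp_ofReal_mul_I _
    simp [this]
  rw [norm_mul, norm_inv, Complex.norm_natCast]
  exact inv_mul_le_one_of_le₀ h (Nat.cast_nonneg _)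

theorem norm_exp_I_sub_le {y : ℝ} (hy : |y| ≤ 1) :
    ‖Complex.exp (y * Complex.I) - (1 + y * Complex.I - (y ^ 2 / 2 : ℝ))‖ ≤ |y| ^ 3 := by
  have hn : ‖(y : ℂ) * Complex.I‖ = |y| := by simp
  have h := Complex.exp_bound (x := y * Complex.I) (by rw [hn]; exact hy) (n := 3) (by norm_num)
  rw [hn] at h
  have h1 : ∑ m ∈ Finset.range 3, ((y : ℂ) * Complex.I) ^ m / (m.factorial : ℂ) =
      1 + y * Complex.I - (y ^ 2 / 2 : ℝ) := by
    simp only [Finset.sum_range_succ, Finset.sum_range_zero, Nat.factorial, mul_pow]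
    push_cast
    rw [Complex.I_sq]
    ring
  rw [h1] at h
  refine h.trans (mul_le_of_le_one_right (by positivity) ?_)
  norm_num [Nat.factorial]

variable [NeZero q]

/-- For `A * s ≤ 1` both terms are expanded to second order, the linear term vanishing because `a`
has mean zero. For `A * s > 1` the trivial bound 2 is below the right side. -/
theorem norm_phaseMean_sub_le {a : Fin q → ℝ} (ha : ∑ k, a k = 0) {A : ℝ} (hA1 : 1 ≤ A)
    (hA : ∀ k, |a k| ≤ A) {s : ℝ} (hs : 0 ≤ s) :
    ‖phaseMean a s - (Real.exp (-((∑ k, a k ^ 2) / q / 2 * s ^ 2)) : ℝ)‖ ≤ 2 * A ^ 3 * s ^ 3 := by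
  have hq : (0 : ℝ) < q := by exact_mod_cast Nat.pos_of_ne_zero (NeZero.ne q)
  have hqc : (q : ℂ) ≠ 0 := by exact_mod_cast hq.ne'
  set v := (∑ k, a k ^ 2) / q with hv
  have hv0 : 0 ≤ v := div_nonneg (Finset.sum_nonneg fun _ _ => sq_nonneg _) hq.le
  have hvA : v ≤ A ^ 2 := by
    rw [hv, div_le_iff₀ hq]
    calc ∑ k, a k ^ 2 ≤ ∑ k : Fin q, A ^ 2 := Finset.sum_le_sum fun k _ => by
          rw [← sq_abs]; exact pow_le_pow_left₀ (abs_nonneg _) (hA k) 2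
      _ = A ^ 2 * q := by simp [mul_comm]
  have hy0 : 0 ≤ v / 2 * s ^ 2 := by positivity
  rcases le_or_gt (A * s) 1 with hAs | hAs
  · have h1 : ‖phaseMean a s - (1 - (v / 2 * s ^ 2 : ℝ))‖ ≤ A ^ 3 * s ^ 3 := by
      have e1 : phaseMean a s - (1 - (v / 2 * s ^ 2 : ℝ)) = (q : ℂ)⁻¹ * ∑ k,
          (Complex.exp ((a k * s : ℝ) * Complex.I) -
            (1 + (a k * s : ℝ) * Complex.I - ((a k * s) ^ 2 / 2 : ℝ))) := by
        have e2 : ∑ k, (1 + ((a k * s : ℝ) : ℂ) * Complex.I - ((a k * s) ^ 2 / 2 : ℝ)) =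
            q * (1 - (v / 2 * s ^ 2 : ℝ)) := by
          rw [Finset.sum_sub_distrib, Finset.sum_add_distrib, ← Finset.sum_mul,
            ← Complex.ofReal_sum, ← Complex.ofReal_sum, ← Finset.sum_mul, ha, ← Finset.sum_div]
          have : ∑ k, (a k * s) ^ 2 = q * v * s ^ 2 := by
            simp_rw [mul_pow]
            rw [← Finset.sum_mul, hv, mul_div_cancel₀ _ hq.ne']
          rw [this]
          simp
          ring
        rw [Finset.sum_sub_distrib, e2, mul_sub, inv_mul_cancel_left₀ hqc]
        unfold phaseMean
        simp only [Complex.ofReal_mul]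
      rw [e1, norm_mul, norm_inv, Complex.norm_natCast, inv_mul_le_iff₀ hq]
      calc _ ≤ ∑ k, ‖Complex.exp ((a k * s : ℝ) * Complex.I) -
            (1 + (a k * s : ℝ) * Complex.I - ((a k * s) ^ 2 / 2 : ℝ))‖ := norm_sum_le _ _
        _ ≤ ∑ k : Fin q, (A * s) ^ 3 := by
            refine Finset.sum_le_sum fun k _ => ?_
            have h2 : |a k * s| ≤ A * s := by
              rw [abs_mul, abs_of_nonneg hs]
              exact mul_le_mul_of_nonneg_right (hA k) hs
            exact (norm_exp_I_sub_le (h2.trans hAs)).trans (pow_le_pow_left₀ (abs_nonneg _) h2 3)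
        _ = _ := by simp [mul_pow]
    have hyA : v / 2 * s ^ 2 ≤ (A * s) ^ 2 / 2 := by
      rw [mul_pow]
      nlinarith [mul_le_mul_of_nonneg_right hvA (sq_nonneg s)]
    have hAs0 : 0 ≤ A * s := by positivity
    have hy1 : v / 2 * s ^ 2 ≤ 1 := by nlinarith
    have h2 : |Real.exp (-(v / 2 * s ^ 2)) - 1 - -(v / 2 * s ^ 2)| ≤ A ^ 3 * s ^ 3 := by
      refine (Real.abs_exp_sub_one_sub_id_le (by rw [abs_neg, abs_of_nonneg hy0]; exact hy1)).trans ?_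
      rw [neg_sq, ← mul_pow]
      calc (v / 2 * s ^ 2) ^ 2 ≤ ((A * s) ^ 2 / 2) ^ 2 := pow_le_pow_left₀ hy0 hyA 2
        _ = (A * s) ^ 3 * (A * s) / 4 := by ring
        _ ≤ (A * s) ^ 3 := by
          have : 0 ≤ (A * s) ^ 3 := by positivity
          nlinarith
    have h3 : phaseMean a s - (Real.exp (-(v / 2 * s ^ 2)) : ℝ) =
        (phaseMean a s - (1 - (v / 2 * s ^ 2 : ℝ))) -
          ((Real.exp (-(v / 2 * s ^ 2)) - 1 - -(v / 2 * s ^ 2) : ℝ) : ℂ) := by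
      push_cast
      ring
    rw [h3]
    refine (norm_sub_le _ _).trans ?_
    rw [Complex.norm_real, Real.norm_eq_abs]
    linarith
  · have h1 : ‖((Real.exp (-(v / 2 * s ^ 2)) : ℝ) : ℂ)‖ ≤ 1 := by
      rw [Complex.norm_real, Real.norm_eq_abs, abs_of_pos (Real.exp_pos _)]
      exact Real.exp_le_one_iff.2 (by linarith)
    have h2 := (norm_sub_le (phaseMean a s) ((Real.exp (-(v / 2 * s ^ 2)) : ℝ) : ℂ)).trans
      (add_le_add (norm_phaseMean_le a s) h1)
    have h3 : 1 ≤ (A * s) ^ 3 := one_le_pow₀ hAs.le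
    rw [mul_pow] at h3
    linarith

/-! ### Colour averages of products -/

variable {d : ℕ}

open Classical in
/-- The number of elements of a class. -/
noncomputable def classCard {Δ : Finset (Site d)} (s : Setoid Δ) (κ : Quotient s) : ℕ :=
  (Finset.univ.filter fun u : Δ => (⟦u⟧ : Quotient s) = κ).card

/-- Distinct classes have independent colours, and a class of size `n` contributes the `n`-th power
of the value at its colour. -/
theorem classAvg_prod {Δ : Finset (Site d)} (s : Setoid Δ) (g : Fin q → ℂ) :
    classAvg (fun η : Δ → Fin q => ∏ u, g (η u)) s =
      ∏ κ : Quotient s, ((q : ℂ)⁻¹ * ∑ k, g k ^ classCard s κ) := by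
  classical
  have h1 : ∀ c : Quotient s → Fin q, ∏ u : Δ, g (c ⟦u⟧) =
      ∏ κ : Quotient s, g (c κ) ^ classCard s κ := by
    intro c
    rw [← Finset.prod_fiberwise Finset.univ (fun u : Δ => (⟦u⟧ : Quotient s))]
    refine Finset.prod_congr rfl fun κ _ => ?_
    rw [classCard, ← Finset.prod_const]
    exact Finset.prod_congr (by congr!) fun u hu => by rw [(Finset.mem_filter.1 hu).2]
  unfold classAvg
  simp_rw [h1]
  rw [Finset.prod_mul_distrib, Finset.prod_univ_sum, Fintype.piFinset_univ, Finset.prod_const,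
    Finset.card_univ, Fintype.card_fun, Fintype.card_fin, Complex.real_smul]
  push_cast
  rw [inv_pow]

theorem classCard_mk (Δ : Finset (Site d)) (ω : EdgeConfig d) (u : Δ) :
    (classCard (reachSetoid Δ ω) ⟦u⟧ : ℝ) = hits Δ u ω := by
  classical
  have h1 : ∀ v : Δ, {ω : EdgeConfig d | (openGraph ω).Reachable (u : Site d) v}.indicator
      (1 : EdgeConfig d → ℝ) ω = if (⟦v⟧ : Quotient (reachSetoid Δ ω)) = ⟦u⟧ then 1 else 0 := by
    intro v
    have hiff : (⟦v⟧ : Quotient (reachSetoid Δ ω)) = ⟦u⟧ ↔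
        (openGraph ω).Reachable (u : Site d) v := by
      rw [Quotient.eq]
      exact ⟨fun h => SimpleGraph.Reachable.symm h, fun h => SimpleGraph.Reachable.symm h⟩
    by_cases hv : (openGraph ω).Reachable (u : Site d) v
    · have m : ω ∈ {ω : EdgeConfig d | (openGraph ω).Reachable (u : Site d) v} := hv
      rw [Set.indicator_of_mem m, if_pos (hiff.2 hv)]
      rfl
    · have m : ω ∉ {ω : EdgeConfig d | (openGraph ω).Reachable (u : Site d) v} := hv
      rw [Set.indicator_of_notMem m, if_neg fun h => hv (hiff.1 h)]
  unfold hits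
  rw [← Finset.sum_coe_sort Δ (fun v => {ω : EdgeConfig d |
    (openGraph ω).Reachable (u : Site d) v}.indicator (1 : EdgeConfig d → ℝ) ω),
    Finset.sum_congr rfl fun v _ => h1 v, Finset.sum_boole, classCard]

/-- Each class is counted once for each of its sites. The case `n = 1` is the limiting variance, and
`n = 2` is the third-order error. -/
theorem sum_classCard_pow_succ (Δ : Finset (Site d)) (ω : EdgeConfig d) (n : ℕ) :
    ∑ κ : Quotient (reachSetoid Δ ω), (classCard (reachSetoid Δ ω) κ : ℝ) ^ (n + 1) =
      ∑ u ∈ Δ, hits Δ u ω ^ n := by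
  classical
  rw [← Finset.sum_coe_sort Δ, Finset.sum_congr rfl fun (u : Δ) _ => by
      rw [← classCard_mk Δ ω u],
    ← Finset.sum_fiberwise Finset.univ (fun u : Δ => (⟦u⟧ : Quotient (reachSetoid Δ ω)))]
  refine Finset.sum_congr rfl fun κ _ => ?_
  rw [Finset.sum_congr rfl fun (u : Δ) hu => by rw [(Finset.mem_filter.1 hu).2], Finset.sum_const,
    nsmul_eq_mul, pow_succ', classCard]

theorem norm_colAvg_phase_sub_le {a : Fin q → ℝ} (ha : ∑ k, a k = 0) {A : ℝ} (hA1 : 1 ≤ A)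
    (hA : ∀ k, |a k| ≤ A) {b : ℝ} (hb : 0 ≤ b) (Δ : Finset (Site d)) (ω : EdgeConfig d) :
    ‖colAvg (fun η : Δ → Fin q => ∏ u, Complex.exp (a (η u) * b * Complex.I)) ω -
      (Real.exp (-((∑ k, a k ^ 2) / q / 2 * (b ^ 2 * ∑ u ∈ Δ, hits Δ u ω))) : ℝ)‖ ≤
      2 * A ^ 3 * (b ^ 3 * ∑ u ∈ Δ, hits Δ u ω ^ 2) := by
  have hq : (0 : ℝ) < q := by exact_mod_cast Nat.pos_of_ne_zero (NeZero.ne q)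
  have h1 : colAvg (fun η : Δ → Fin q => ∏ u, Complex.exp (a (η u) * b * Complex.I)) ω =
      ∏ κ : Quotient (reachSetoid Δ ω), phaseMean a (b * classCard (reachSetoid Δ ω) κ) := by
    unfold colAvg
    rw [classAvg_prod (reachSetoid Δ ω) fun k => Complex.exp (a k * b * Complex.I)]
    refine Finset.prod_congr rfl fun κ _ => ?_
    unfold phaseMean
    congr 1
    refine Finset.sum_congr rfl fun k _ => ?_
    rw [← Complex.exp_nat_mul]
    congr 1
    push_cast
    ring
  have h2 : ((Real.exp (-((∑ k, a k ^ 2) / q / 2 * (b ^ 2 * ∑ u ∈ Δ, hits Δ u ω))) : ℝ) : ℂ) =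
      ∏ κ : Quotient (reachSetoid Δ ω), ((Real.exp (-((∑ k, a k ^ 2) / q / 2 *
        (b * classCard (reachSetoid Δ ω) κ) ^ 2)) : ℝ) : ℂ) := by
    rw [← Complex.ofReal_prod, ← Real.exp_sum, Finset.sum_neg_distrib, ← Finset.mul_sum]
    simp_rw [mul_pow]
    rw [← Finset.mul_sum, sum_classCard_pow_succ Δ ω 1]
    simp only [pow_one]
  have hv0 : 0 ≤ (∑ k, a k ^ 2) / q / 2 := by
    have := Finset.sum_nonneg fun k (_ : k ∈ Finset.univ) => sq_nonneg (a k)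
    positivity
  rw [h1, h2]
  refine (norm_prod_sub_prod_le _ (fun κ _ => norm_phaseMean_le _ _) fun κ _ => ?_).trans ?_
  · rw [Complex.norm_real, Real.norm_eq_abs, abs_of_pos (Real.exp_pos _)]
    exact Real.exp_le_one_iff.2 (neg_nonpos.2 (mul_nonneg hv0 (sq_nonneg _)))
  · rw [← sum_classCard_pow_succ Δ ω 2, Finset.mul_sum, Finset.mul_sum]
    refine Finset.sum_le_sum fun κ _ => ?_
    refine (norm_phaseMean_sub_le ha hA1 hA (by positivity)).trans (le_of_eq ?_)
    ring

end

section

variable {d q : ℕ}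

/-! ### The characteristic function of the fluctuation -/

/-- The coordinates of `ξ`, centred. -/
noncomputable def centred (ξ : EuclideanSpace ℝ (Fin q)) (k : Fin q) : ℝ :=
  ξ k - (∑ l, ξ l) / q

theorem inner_fluctuation (t : ℕ) (σ : SpinConfig d q) (ξ : EuclideanSpace ℝ (Fin q)) :
    inner ℝ (fluctuation t σ) ξ =
      ∑ u ∈ box d t, centred ξ (σ u) * (√((box d t).card : ℝ))⁻¹ := by
  have h1 : ∑ k, ((box d t).filter fun x => σ x = k).card * ξ k = ∑ u ∈ box d t, ξ (σ u) := by
    rw [← Finset.sum_fiberwise (box d t) σ]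
    refine Finset.sum_congr rfl fun k _ => ?_
    rw [Finset.sum_congr rfl fun u hu => by rw [(Finset.mem_filter.1 hu).2], Finset.sum_const,
      nsmul_eq_mul]
  have h2 : ∀ k, fluctuation t σ k = (√((box d t).card : ℝ))⁻¹ *
      (((box d t).filter fun x => σ x = k).card - (box d t).card * (1 / (q : ℝ))) := fun k => rfl
  rw [PiLp.inner_apply]
  simp only [h2, RCLike.inner_apply, conj_trivial]
  rw [← Finset.sum_mul]
  have h3 : ∑ u ∈ box d t, centred ξ (σ u) =
      ∑ u ∈ box d t, ξ (σ u) - (box d t).card * ((∑ l, ξ l) / q) := by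
    unfold centred
    rw [Finset.sum_sub_distrib, Finset.sum_const, nsmul_eq_mul]
  rw [h3, ← h1, Finset.sum_div, Finset.mul_sum, ← Finset.sum_sub_distrib, Finset.sum_mul]
  exact Finset.sum_congr rfl fun k _ => by ring

theorem measurable_fluctuation (t : ℕ) : Measurable (fluctuation (d := d) (q := q) t) := by
  refine measurable_of_dependsOn (J := box d t) fun σ σ' h => ?_
  have : colourCount (box d t) σ = colourCount (box d t) σ' := by
    unfold colourCount
    congr 1
    funext k
    congr 2
    exact Finset.filter_congr fun u hu => by rw [h u hu]
  unfold fluctuation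
  rw [this]

variable [NeZero q] {x : ℝ}

theorem sum_centred (ξ : EuclideanSpace ℝ (Fin q)) : ∑ k, centred ξ k = 0 := by
  have hq : (q : ℝ) ≠ 0 := NeZero.ne _
  unfold centred
  rw [Finset.sum_sub_distrib, Finset.sum_const, Finset.card_univ, Fintype.card_fin, nsmul_eq_mul,
    mul_div_cancel₀ _ hq, sub_self]

theorem sum_centred_sq (ξ : EuclideanSpace ℝ (Fin q)) :
    ∑ k, centred ξ k ^ 2 = ∑ k, ξ k ^ 2 - (∑ k, ξ k) ^ 2 / q := by
  have hq : (q : ℝ) ≠ 0 := NeZero.ne _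
  unfold centred
  simp_rw [sub_sq]
  rw [Finset.sum_add_distrib, Finset.sum_sub_distrib, Finset.sum_const, Finset.card_univ,
    Fintype.card_fin, nsmul_eq_mul, ← Finset.sum_mul, ← Finset.mul_sum]
  field_simp
  ring

theorem colAvg_re_add_im {Δ : Finset (Site d)} (F : (Δ → Fin q) → ℂ) (ω : EdgeConfig d) :
    colAvg F ω = (colAvg (fun s => (F s).re) ω : ℝ) + (colAvg (fun s => (F s).im) ω : ℝ) *
      Complex.I := by
  unfold colAvg classAvg
  simp only [smul_eq_mul, Complex.real_smul]
  push_cast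
  rw [mul_assoc, ← mul_add, Finset.sum_mul, ← Finset.sum_add_distrib]
  simp only [Complex.re_add_im]

theorem integrable_colAvg_real {Δ : Finset (Site d)} (F : (Δ → Fin q) → ℝ)
    (P : Measure (EdgeConfig d)) [IsFiniteMeasure P] : Integrable (colAvg F) P := by
  obtain ⟨M, -, hF⟩ := exists_abs_le_of_finite F
  exact Integrable.of_bound (measurable_colAvg F).aestronglyMeasurable M
    (Eventually.of_forall fun ω => abs_colAvg_le hF ω)

theorem integrable_ofReal_comp {Ω : Type*} [MeasurableSpace Ω] {P : Measure Ω} {f : Ω → ℝ}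
    (hf : Integrable f P) : Integrable (fun ω => (f ω : ℂ)) P :=
  Complex.ofRealCLM.integrable_comp hf

theorem integrable_colAvg {Δ : Finset (Site d)} (F : (Δ → Fin q) → ℂ)
    (P : Measure (EdgeConfig d)) [IsFiniteMeasure P] : Integrable (colAvg F) P := by
  have h : colAvg (d := d) F = fun ω => ((colAvg (fun s => (F s).re) ω : ℝ) : ℂ) +
      (colAvg (fun s => (F s).im) ω : ℝ) * Complex.I := funext (colAvg_re_add_im F)
  rw [h]
  exact (integrable_ofReal_comp (integrable_colAvg_real (fun s => (F s).re) P)).add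
    ((integrable_ofReal_comp (integrable_colAvg_real (fun s => (F s).im) P)).mul_const _)

theorem IsColouring.integral_eq {μ : ProbabilityMeasure (SpinConfig d q)} (hμ : IsColouring x μ)
    {Δ : Finset (Site d)} (F : (Δ → Fin q) → ℂ) :
    ∫ σ, F (fun u => σ u) ∂(μ : Measure (SpinConfig d q)) =
      ∫ ω, colAvg F ω ∂(rcInf d q x : Measure (EdgeConfig d)) := by
  have hi : ∀ G : (Δ → Fin q) → ℝ, Integrable (fun σ : SpinConfig d q => G fun u => σ u)
      (μ : Measure (SpinConfig d q)) := fun G =>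
    integrable_of_dependsOn (dependsOn_comp_restrict G) _
  have h1 : ∫ σ, F (fun u => σ u) ∂(μ : Measure (SpinConfig d q)) =
      ∫ σ, (((F fun u => σ u).re : ℂ) + ((F fun u => σ u).im : ℂ) * Complex.I)
        ∂(μ : Measure (SpinConfig d q)) := by simp only [Complex.re_add_im]
  rw [h1, integral_add (integrable_ofReal_comp (hi fun s => (F s).re))
    ((integrable_ofReal_comp (hi fun s => (F s).im)).mul_const Complex.I), integral_mul_const,
    integral_complex_ofReal, integral_complex_ofReal, hμ Δ fun s => (F s).re,
    hμ Δ fun s => (F s).im]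
  simp_rw [colAvg_re_add_im F]
  rw [integral_add (integrable_ofReal_comp (integrable_colAvg_real (fun s => (F s).re) _))
    ((integrable_ofReal_comp (integrable_colAvg_real (fun s => (F s).im) _)).mul_const Complex.I), integral_mul_const,
    integral_complex_ofReal, integral_complex_ofReal]

theorem IsColouring.charFun_fluctuation {μ : ProbabilityMeasure (SpinConfig d q)}
    (hμ : IsColouring x μ) (t : ℕ) (ξ : EuclideanSpace ℝ (Fin q)) :
    charFun ((μ : Measure (SpinConfig d q)).map (fluctuation t)) ξ =
      ∫ ω, colAvg (fun η : box d t → Fin q => ∏ u, Complex.exp (centred ξ (η u) *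
        ((√((box d t).card : ℝ))⁻¹ : ℝ) * Complex.I)) ω
        ∂(rcInf d q x : Measure (EdgeConfig d)) := by
  rw [charFun_apply, integral_map (measurable_fluctuation t).aemeasurable, ← hμ.integral_eq]
  · refine integral_congr_ae (Eventually.of_forall fun σ => ?_)
    simp only
    rw [inner_fluctuation, ← Complex.exp_sum, Finset.sum_coe_sort (box d t) (fun u =>
      (centred ξ (σ u) : ℂ) * ((√((box d t).card : ℝ))⁻¹ : ℝ) * Complex.I)]
    push_cast
    rw [Finset.sum_mul]
  · exact Continuous.aestronglyMeasurable (by fun_prop)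

/-- Two errors vanish. The third-order error is at most a constant times `|Λ|^{-1/2}` by the second
moment of the cluster size. Replacing `avgHits` by its limit costs its `L¹` distance, since
`exp(-·)` is 1-Lipschitz on the nonnegative reals. -/
theorem tendsto_integral_colAvg_phase (hd : 1 ≤ d) (hx : 0 ≤ x) (h : FastDecay d q x)
    {a : Fin q → ℝ} (ha : ∑ k, a k = 0) :
    Tendsto (fun t => ∫ ω, colAvg (fun η : box d t → Fin q => ∏ u, Complex.exp (a (η u) *
        ((√((box d t).card : ℝ))⁻¹ : ℝ) * Complex.I)) ω
        ∂(rcInf d q x : Measure (EdgeConfig d))) atTop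
      (𝓝 (Real.exp (-((∑ k, a k ^ 2) / q / 2 * meanSize d q x)) : ℝ)) := by
  have hq : (0 : ℝ) < q := by exact_mod_cast Nat.pos_of_ne_zero (NeZero.ne q)
  obtain ⟨M, hM0, hM⟩ := exists_abs_le_of_finite a
  set A := M + 1 with hA
  have hA1 : 1 ≤ A := by linarith
  have hAa : ∀ k, |a k| ≤ A := fun k => (hM k).trans (by linarith)
  set v := (∑ k, a k ^ 2) / q / 2 with hv
  have hv0 : 0 ≤ v := by
    have := Finset.sum_nonneg fun k (_ : k ∈ Finset.univ) => sq_nonneg (a k)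
    positivity
  have hχ0 : 0 ≤ meanSize d q x := ENNReal.toReal_nonneg
  rw [tendsto_iff_norm_sub_tendsto_zero]
  have hbound : Tendsto (fun t => 2 * A ^ 3 * ((√((box d t).card : ℝ))⁻¹ * meanSqSize d q x) +
      v * ∫ ω, |avgHits d t ω - meanSize d q x| ∂(rcInf d q x : Measure (EdgeConfig d))) atTop
      (𝓝 (2 * A ^ 3 * (0 * meanSqSize d q x) + v * 0)) := by
    refine Tendsto.add (Tendsto.const_mul _ (Tendsto.mul_const _ ?_))
      ((tendsto_integral_abs_avgHits_sub hd hx h).const_mul _)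
    exact (Real.tendsto_sqrt_atTop.comp (tendsto_card_box_atTop hd)).inv_tendsto_atTop
  rw [zero_mul, mul_zero, mul_zero, add_zero] at hbound
  refine squeeze_zero (fun t => norm_nonneg _) (fun t => ?_) hbound
  have hT := card_box_pos d t
  set b := (√((box d t).card : ℝ))⁻¹ with hb
  have hb0 : 0 ≤ b := by positivity
  have hb2 : b ^ 2 = ((box d t).card : ℝ)⁻¹ := by rw [hb, inv_pow, Real.sq_sqrt hT.le]
  have hX : ∀ ω, b ^ 2 * ∑ u ∈ box d t, hits (box d t) u ω = avgHits d t ω := fun ω => by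
    rw [hb2, avgHits, div_eq_inv_mul]
  have hci := integrable_colAvg (fun η : box d t → Fin q => ∏ u, Complex.exp (a (η u) *
        (b : ℝ) * Complex.I)) (rcInf d q x : Measure (EdgeConfig d))
  have hXi := integrable_avgHits d t (rcInf d q x : Measure (EdgeConfig d))
  have hpt : ∀ ω, ‖colAvg (fun η : box d t → Fin q => ∏ u, Complex.exp (a (η u) * (b : ℝ) *
      Complex.I)) ω - (Real.exp (-(v * meanSize d q x)) : ℝ)‖ ≤
      2 * A ^ 3 * (b ^ 3 * ∑ u ∈ box d t, hits (box d t) u ω ^ 2) +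
        v * |avgHits d t ω - meanSize d q x| := by
    intro ω
    have h1 := norm_colAvg_phase_sub_le ha hA1 hAa hb0 (box d t) ω
    rw [hX] at h1
    have h2 : ‖((Real.exp (-(v * avgHits d t ω)) : ℝ) : ℂ) -
        (Real.exp (-(v * meanSize d q x)) : ℝ)‖ ≤ v * |avgHits d t ω - meanSize d q x| := by
      rw [← Complex.ofReal_sub, Complex.norm_real, Real.norm_eq_abs]
      refine (abs_exp_neg_sub_exp_neg_le (mul_nonneg hv0 (avgHits_nonneg d t ω))
        (mul_nonneg hv0 hχ0)).trans (le_of_eq ?_)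
      rw [← mul_sub, abs_mul, abs_of_nonneg hv0]
    exact (norm_sub_le_norm_sub_add_norm_sub _ _ _).trans (add_le_add h1 h2)
  have hsq : Integrable (fun ω => ∑ u ∈ box d t, hits (box d t) u ω ^ 2)
      (rcInf d q x : Measure (EdgeConfig d)) :=
    integrable_finsetSum _ fun u _ => integrable_hits_sq _ u _
  have hai : Integrable (fun ω => |avgHits d t ω - meanSize d q x|)
      (rcInf d q x : Measure (EdgeConfig d)) := (hXi.sub (integrable_const _)).abs
  have hconst : ((Real.exp (-(v * meanSize d q x)) : ℝ) : ℂ) =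
      ∫ _, ((Real.exp (-(v * meanSize d q x)) : ℝ) : ℂ)
        ∂(rcInf d q x : Measure (EdgeConfig d)) := by
    rw [integral_const, probReal_univ, one_smul]
  rw [hconst, ← integral_sub hci (integrable_const _)]
  refine (norm_integral_le_of_norm_le
    (((hsq.const_mul (b ^ 3)).const_mul (2 * A ^ 3)).add (hai.const_mul v))
    (Eventually.of_forall hpt)).trans ?_
  have hsum : ∫ ω, ∑ u ∈ box d t, hits (box d t) u ω ^ 2
      ∂(rcInf d q x : Measure (EdgeConfig d)) ≤ (box d t).card * meanSqSize d q x := by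
    rw [integral_finsetSum _ fun u _ => integrable_hits_sq _ u _, ← nsmul_eq_mul,
      ← Finset.sum_const]
    exact Finset.sum_le_sum fun u _ => integral_hits_sq_le hx h _ u
  have hbT : b ^ 3 * (box d t).card = b := by
    rw [pow_succ', hb2, mul_assoc, inv_mul_cancel₀ hT.ne', mul_one]
  have heq : ∫ ω, (2 * A ^ 3 * (b ^ 3 * ∑ u ∈ box d t, hits (box d t) u ω ^ 2) +
        v * |avgHits d t ω - meanSize d q x|) ∂(rcInf d q x : Measure (EdgeConfig d)) =
      2 * A ^ 3 * (b ^ 3 * ∫ ω, ∑ u ∈ box d t, hits (box d t) u ω ^ 2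
        ∂(rcInf d q x : Measure (EdgeConfig d))) +
      v * ∫ ω, |avgHits d t ω - meanSize d q x| ∂(rcInf d q x : Measure (EdgeConfig d)) := by
    rw [integral_add ((hsq.const_mul (b ^ 3)).const_mul (2 * A ^ 3)) (hai.const_mul v),
      integral_const_mul, integral_const_mul, integral_const_mul]
  refine le_of_eq_of_le heq ?_
  have h3 : b ^ 3 * ∫ ω, ∑ u ∈ box d t, hits (box d t) u ω ^ 2
      ∂(rcInf d q x : Measure (EdgeConfig d)) ≤ b * meanSqSize d q x := by
    calc _ ≤ b ^ 3 * ((box d t).card * meanSqSize d q x) :=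
          mul_le_mul_of_nonneg_left hsum (pow_nonneg hb0 3)
      _ = _ := by rw [← mul_assoc, hbT]
  have h4 : 0 ≤ 2 * A ^ 3 := by positivity
  linarith [mul_le_mul_of_nonneg_left h3 h4]

/-! ### The covariance matrix -/

theorem dotProduct_covariance (c : ℝ) (y : Fin q → ℝ) :
    y ⬝ᵥ Matrix.mulVec ((c / (q : ℝ) ^ 2) • ((q : ℝ) • (1 : Matrix (Fin q) (Fin q) ℝ) -
      Matrix.of fun _ _ => 1)) y = c / (q : ℝ) ^ 2 * (q * ∑ k, y k ^ 2 - (∑ k, y k) ^ 2) := by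
  have h1 : Matrix.mulVec (Matrix.of fun _ _ => (1 : ℝ)) y = fun _ : Fin q => ∑ k, y k := by
    funext k
    simp [Matrix.mulVec, dotProduct]
  rw [Matrix.smul_mulVec, Matrix.sub_mulVec, Matrix.smul_mulVec, Matrix.one_mulVec, h1]
  simp only [dotProduct, Pi.smul_apply, Pi.sub_apply, smul_eq_mul]
  rw [sq (∑ k, y k), Finset.sum_mul, Finset.mul_sum, ← Finset.sum_sub_distrib, Finset.mul_sum]
  exact Finset.sum_congr rfl fun k _ => by ring

theorem posSemidef_covariance {c : ℝ} (hc : 0 ≤ c) :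
    ((c / (q : ℝ) ^ 2) • ((q : ℝ) • (1 : Matrix (Fin q) (Fin q) ℝ) -
      Matrix.of fun _ _ => 1)).PosSemidef := by
  refine Matrix.PosSemidef.of_dotProduct_mulVec_nonneg ?_ fun y => ?_
  · ext i j
    simp [Matrix.one_apply, eq_comm]
  · rw [star_trivial, dotProduct_covariance]
    refine mul_nonneg (by positivity) (sub_nonneg.2 ?_)
    simpa using sq_sum_le_card_mul_sum_sq (s := Finset.univ) (f := y)

/-- The central limit theorem for the colour counts. -/
theorem IsColouring.tendstoInDistribution (hd : 1 ≤ d) (hx : 0 ≤ x) (h : FastDecay d q x)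
    {μ : ProbabilityMeasure (SpinConfig d q)} (hμ : IsColouring x μ) :
    TendstoInDistribution (fun t : ℕ => fluctuation (d := d) (q := q) t) atTop id
      (fun _ => (μ : Measure (SpinConfig d q)))
      (multivariateGaussian 0 ((meanSize d q x / (q : ℝ) ^ 2) •
        ((q : ℝ) • (1 : Matrix (Fin q) (Fin q) ℝ) - Matrix.of fun _ _ => 1))) where
  forall_aemeasurable t := (measurable_fluctuation t).aemeasurable
  aemeasurable_limit := aemeasurable_id
  tendsto := by
    have hχ0 : 0 ≤ meanSize d q x := ENNReal.toReal_nonneg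
    have hq : (q : ℝ) ≠ 0 := NeZero.ne _
    refine ProbabilityMeasure.tendsto_iff_tendsto_charFun.2 fun ξ => ?_
    have h1 := tendsto_integral_colAvg_phase hd hx h (sum_centred ξ)
    have h2 : charFun ((multivariateGaussian 0 ((meanSize d q x / (q : ℝ) ^ 2) •
        ((q : ℝ) • (1 : Matrix (Fin q) (Fin q) ℝ) - Matrix.of fun _ _ => 1))).map id) ξ =
        ((Real.exp (-((∑ k, centred ξ k ^ 2) / q / 2 * meanSize d q x)) : ℝ) : ℂ) := by
      rw [Measure.map_id, charFun_multivariateGaussian (posSemidef_covariance hχ0),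
        dotProduct_covariance, inner_zero_right, sum_centred_sq, Complex.ofReal_exp]
      congr 1
      push_cast
      have hqc : (q : ℂ) ≠ 0 := by exact_mod_cast hq
      field_simp
      ring
    simp only [ProbabilityMeasure.coe_mk]
    rw [h2]
    exact h1.congr fun t => (hμ.charFun_fluctuation t ξ).symm

end

section

variable {d q : ℕ}

/-! ### Below the critical inverse temperature -/

/-- Translates `β < β_g` into odds: `e^{2β} - 1` corresponds to `p`, and some strictly larger odds
still have a finite limsup. The gap is what the decay argument consumes. -/
theorem exists_radiusLimsup_lt_top {β : ℝ} (hβ : 0 ≤ β) (hβg : β < betaG d q) :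
    ∃ y, Real.exp (2 * β) - 1 < y ∧ radiusLimsup d (y / (1 + y)) q < ∞ := by
  have hbdd : BddAbove {p : ℝ | p ∈ Set.Icc 0 1 ∧ radiusLimsup d p q < ∞} := ⟨1, fun p hp => hp.1.2⟩
  have hle : pG d q ≤ 1 := Real.sSup_le (fun p hp => hp.1.2) zero_le_one
  have hlt : pG d q < 1 := by
    -- If `p_g = 1`, the convention `Real.log 0 = 0` makes `betaG` equal to 0, which no `β ≥ 0` lies
    -- below.
    refine lt_of_le_of_ne hle fun h => ?_
    unfold betaG at hβg
    rw [h, sub_self, Real.log_zero, mul_zero] at hβg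
    linarith
  have hp : 1 - Real.exp (-(2 * β)) < pG d q := by
    have h1 : Real.log (1 - pG d q) < -(2 * β) := by
      unfold betaG at hβg
      linarith
    have := (Real.log_lt_iff_lt_exp (by linarith)).1 h1
    linarith
  have hp0 : 0 ≤ 1 - Real.exp (-(2 * β)) := by
    have : Real.exp (-(2 * β)) ≤ 1 := Real.exp_le_one_iff.2 (by linarith)
    linarith
  -- An empty set would have supremum 0 by convention, contradicting `0 ≤ 1 - e^{-2β} < p_g`.
  have hne : {p : ℝ | p ∈ Set.Icc 0 1 ∧ radiusLimsup d p q < ∞}.Nonempty := by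
    by_contra hemp
    rw [Set.not_nonempty_iff_eq_empty] at hemp
    unfold pG at hp
    rw [hemp, Real.sSup_empty] at hp
    linarith
  obtain ⟨p', hp', hlt'⟩ := exists_lt_of_lt_csSup hne hp
  have hp1 : p' < 1 := (le_csSup hbdd hp').trans_lt hlt
  refine ⟨p' / (1 - p'), ?_, ?_⟩
  · rw [sub_lt_iff_lt_add]
    have h1 : p' / (1 - p') + 1 = (1 - p')⁻¹ := by
      have : 1 - p' ≠ 0 := by linarith
      field_simp
      ring
    have h2 : Real.exp (2 * β) = (Real.exp (-(2 * β)))⁻¹ := by rw [Real.exp_neg, inv_inv]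
    rw [h1, h2]
    exact inv_strictAnti₀ (by linarith) (by linarith)
  · have h1 : p' / (1 - p') / (1 + p' / (1 - p')) = p' := by
      have : 1 - p' ≠ 0 := by linarith
      field_simp
      ring
    rw [h1]
    exact hp'.2

end

end PottsCLT

/-! ### Assembly of the theorem -/

theorem mainTheorem9 (d q : ℕ) (hd : 2 ≤ d) (hq : 2 ≤ q) (β p : ℝ) (hβ : 0 ≤ β)
    (hβg : β < PottsCLT.betaG d q) (hp : p = 1 - Real.exp (-2 * β)) :
    ∃ μ : ProbabilityMeasure (PottsCLT.SpinConfig d q),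
      PottsCLT.IsPottsGibbs β μ ∧
      (∀ μ' : ProbabilityMeasure (PottsCLT.SpinConfig d q),
        PottsCLT.IsPottsGibbs β μ' → μ' = μ) ∧
      PottsCLT.chi d p q < ∞ ∧
      TendstoInDistribution (fun t : ℕ => PottsCLT.fluctuation (d := d) (q := q) t) atTop id
        (fun _ => (μ : Measure (PottsCLT.SpinConfig d q)))
        (multivariateGaussian 0
          (((PottsCLT.chi d p q).toReal / (q : ℝ) ^ 2) •
            ((q : ℝ) • (1 : Matrix (Fin q) (Fin q) ℝ) - Matrix.of fun _ _ => 1))) := by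
  have : NeZero q := ⟨by omega⟩
  obtain ⟨y, hxy, hy⟩ := PottsCLT.exists_radiusLimsup_lt_top hβ hβg
  have hx : 0 ≤ Real.exp (2 * β) - 1 := by
    have := Real.one_le_exp (x := 2 * β) (by positivity)
    linarith
  have hdec : PottsCLT.FastDecay d q (Real.exp (2 * β) - 1) :=
    PottsCLT.exists_fast_decay hd hx hxy hy
  have hpx : p = (Real.exp (2 * β) - 1) / (1 + (Real.exp (2 * β) - 1)) := by
    have h1 : Real.exp (-2 * β) = (Real.exp (2 * β))⁻¹ := by rw [← Real.exp_neg]; ring_nf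
    have h2 := (Real.exp_pos (2 * β)).ne'
    rw [hp, h1, add_sub_cancel, sub_div, div_self h2, one_div]
  have hchi : PottsCLT.chi d p q = ∫⁻ ω, PottsCLT.csize 0 ω
      ∂(PottsCLT.rcInf d q (Real.exp (2 * β) - 1) : Measure (PottsCLT.EdgeConfig d)) := by
    rw [hpx]
    exact PottsCLT.chi_eq hdec
  obtain ⟨μ, hμ⟩ := PottsCLT.exists_isColouring hd hβ hdec
  refine ⟨μ, hμ.isPottsGibbs hd hβ hdec, fun μ' hμ' => hμ.eq_of_isPottsGibbs hd hβ hdec hμ', ?_, ?_⟩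
  · rw [hchi]
    exact PottsCLT.lintegral_csize_lt_top hdec
  · rw [hchi]
    exact hμ.tendstoInDistribution (by omega) hx hdec
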